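/- Let $V=V_+\oplus V_-$ be a $6$-dimensional complex vector space, where $V_\pm$ has coordinates $x_1^\pm,x_2^\pm,x_3^\pm$, with the involution $\sigma$ fixing the $x_i^+$ and sending $x_i^-\mapsto -x_i^-$. Let $W\subseteq S^2V^\vee$ be a $3$-dimensional space of $\sigma$-invariant quadratic forms with basis $q_1,q_2,q_3$ and corresponding coordinates $u=(u_1,u_2,u_3)$, so that $W\cong\operatorname{Spec}\mathbb C[u]$. Let $q_i^+$ be the symmetric $3\times 3$ matrix of the restriction of $q_i$ to $V_+$, let $q_u^+=\sum_i u_iq_i^+$, $f_+=\det(q_u^+)\in\mathbb C[u]$, $E_+=\{f_+=0\}\subseteq\mathbb PW$ and $A_+=\mathbb C[u,y_+]/\langle y_+^2-f_+\rangle$. Write $W\setminus 0$ and $\operatorname{Spec}A_+\setminus 0$ for the complements of the locus $u=0$. Let $\operatorname{adj}(C)\to W\setminus 0$ be the conic fibration in $(W\setminus 0)\times\mathbb P V_+^\vee$ cut out by the quadratic form whose matrix is the adjugate of $q_u^+$, and put $$\operatorname{adj}(C_+)=\operatorname{adj}(C)\times_{W\setminus 0}(\operatorname{Spec}A_+\setminus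 0).$$ Proposition 4.1. For general $W$ (that is, for all $(q_1,q_2,q_3)$ in a nonempty Zariski open subset of the space of such triples) the cubic $E_+$ is a smooth curve, in the sense that at each $u\ne 0$ with $f_+(u)=0$ some partial derivative $\partial f_+/\partial u_i$ is nonzero. Whenever $E_+$ is smooth in this sense, the scheme $\operatorname{adj}(C_+)$ is integral, and its normalization $P_+$, with the composition $P_+\to\operatorname{adj}(C_+)\to\operatorname{Spec}A_+\setminus 0$, is a $\mathbb P^1$-bundle over $\operatorname{Spec}A_+\setminus 0$: étale locally on $\operatorname{Spec}A_+\setminus 0$ it is isomorphic, over the base, to the projection from the product with $\mathbb P^1$. -/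

import Mathlib

open AlgebraicGeometry CategoryTheory CategoryTheory.Limits

noncomputable section

namespace EnriquesNet

attribute [local instance] MvPolynomial.gradedAlgebra

/-! ### The grading of the quotient of a graded algebra by a homogeneous ideal -/

section QuotientGrading

variable {R A : Type} [CommRing R] [CommRing A] [Algebra R A]

/-- The degree `n` part of `A ⧸ I`: the image of the degree `n` part of `A`. -/
def quotientGrading (𝒜 : ℕ → Submodule R A) (I : Ideal A) (n : ℕ) : Submodule R (A ⧸ I) :=
  (𝒜 n).map (Ideal.Quotient.mkₐ R I).toLinearMap

variable (𝒜 : ℕ → Submodule R A) [GradedAlgebra 𝒜] (I : Ideal A)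

/-- The quotient map in degree `n`. -/
def quotientGradingMap (n : ℕ) : 𝒜 n →ₗ[R] quotientGrading 𝒜 I n :=
  (Ideal.Quotient.mkₐ R I).toLinearMap.submoduleMap _

theorem quotientGrading_gradedMonoid : SetLike.GradedMonoid (quotientGrading 𝒜 I) where
  one_mem := ⟨1, SetLike.GradedOne.one_mem, map_one (Ideal.Quotient.mkₐ R I)⟩
  mul_mem := by
    rintro i j _ _ ⟨a, ha, rfl⟩ ⟨b, hb, rfl⟩
    exact ⟨a * b, SetLike.GradedMul.mul_mem ha hb, map_mul (Ideal.Quotient.mkₐ R I) a b⟩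

/-- The decomposition of `A`, followed by the quotient map in each degree. -/
def quotientDecomposeAux : A →ₗ[R] DirectSum ℕ fun n ↦ quotientGrading 𝒜 I n :=
  (DirectSum.lmap (quotientGradingMap 𝒜 I)).comp (DirectSum.decomposeLinearEquiv 𝒜).toLinearMap

theorem quotientDecomposeAux_of_mem {n : ℕ} {a : A} (ha : a ∈ 𝒜 n) :
    quotientDecomposeAux 𝒜 I a =
      DirectSum.of (fun n ↦ quotientGrading 𝒜 I n) n (quotientGradingMap 𝒜 I n ⟨a, ha⟩) := by
  rw [quotientDecomposeAux, LinearMap.comp_apply, LinearEquiv.coe_coe,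
    DirectSum.decomposeLinearEquiv_apply, DirectSum.decompose_of_mem _ ha]
  exact DirectSum.lmap_of (quotientGradingMap 𝒜 I) n ⟨a, ha⟩

variable {I}

theorem quotientDecomposeAux_eq_zero (hI : I.IsHomogeneous 𝒜) {a : A} (ha : a ∈ I) :
    quotientDecomposeAux 𝒜 I a = 0 :=
  DFinsupp.ext fun n ↦ Subtype.ext (Ideal.Quotient.eq_zero_iff_mem.mpr (hI n ha))

/-- The decomposition of `A ⧸ I` into its graded pieces. -/
def quotientDecompose (hI : I.IsHomogeneous 𝒜) :
    (A ⧸ I) →+ DirectSum ℕ fun n ↦ quotientGrading 𝒜 I n :=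
  QuotientAddGroup.lift I.toAddSubgroup (quotientDecomposeAux 𝒜 I).toAddMonoidHom
    fun _ ha ↦ quotientDecomposeAux_eq_zero 𝒜 hI ha

theorem quotientDecompose_mk (hI : I.IsHomogeneous 𝒜) (a : A) :
    quotientDecompose 𝒜 hI (Ideal.Quotient.mk I a) = quotientDecomposeAux 𝒜 I a :=
  rfl

/-- The quotient of a graded algebra by a homogeneous ideal is a graded algebra. -/
@[reducible]
def quotientGradedAlgebra (hI : I.IsHomogeneous 𝒜) : GradedAlgebra (quotientGrading 𝒜 I) where
  toGradedMonoid := quotientGrading_gradedMonoid 𝒜 I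
  toDecomposition :=
    { decompose' := quotientDecompose 𝒜 hI
      left_inv := by
        intro x
        obtain ⟨a, rfl⟩ := Ideal.Quotient.mk_surjective x
        rw [quotientDecompose_mk]
        induction a using DirectSum.Decomposition.inductionOn 𝒜 with
        | zero => simp
        | @homogeneous i m =>
          rw [quotientDecomposeAux_of_mem 𝒜 I m.2, DirectSum.coeAddMonoidHom_of]
          rfl
        | add m m' h h' => rw [map_add, map_add, h, h', map_add]
      right_inv := by
        intro x
        induction x using DirectSum.induction_on with
        | zero => simp
        | of i x =>
          obtain ⟨_, a, ha, rfl⟩ := x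
          rw [DirectSum.coeAddMonoidHom_of]
          exact (quotientDecompose_mk 𝒜 hI a).trans (quotientDecomposeAux_of_mem 𝒜 I ha)
        | add x y hx hy => rw [map_add, map_add, hx, hy] }

end QuotientGrading

/-! ### Conics in the projective plane over an affine base -/

section Conic

variable {R : Type} [CommRing R]

/-- The ternary quadratic form `∑ i j, M i j * x i * x j` attached to a `3 × 3` matrix. -/
def ternaryForm (M : Matrix (Fin 3) (Fin 3) R) : MvPolynomial (Fin 3) R :=
  ∑ i, ∑ j, MvPolynomial.C (M i j) * (MvPolynomial.X i * MvPolynomial.X j)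

theorem ternaryForm_isHomogeneous (M : Matrix (Fin 3) (Fin 3) R) :
    (ternaryForm M).IsHomogeneous 2 := by
  refine MvPolynomial.IsHomogeneous.sum _ _ _ fun i _ ↦
    MvPolynomial.IsHomogeneous.sum _ _ _ fun j _ ↦ ?_
  simpa using (MvPolynomial.isHomogeneous_C (Fin 3) (M i j)).mul
    ((MvPolynomial.isHomogeneous_X R i).mul (MvPolynomial.isHomogeneous_X R j))

/-- The homogeneous ideal generated by the quadratic form of `M` in `R[x₀, x₁, x₂]`. -/
def conicIdeal (M : Matrix (Fin 3) (Fin 3) R) : Ideal (MvPolynomial (Fin 3) R) :=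
  Ideal.span {ternaryForm M}

theorem conicIdeal_isHomogeneous (M : Matrix (Fin 3) (Fin 3) R) :
    (conicIdeal M).IsHomogeneous (MvPolynomial.homogeneousSubmodule (Fin 3) R) := by
  refine Ideal.homogeneous_span _ _ ?_
  rintro x rfl
  exact ⟨2, ternaryForm_isHomogeneous M⟩

/-- The grading of the homogeneous coordinate ring `R[x₀, x₁, x₂] / (ternaryForm M)` by the
degree in the variables `x`. -/
def conicGrading (M : Matrix (Fin 3) (Fin 3) R) :
    ℕ → Submodule R (MvPolynomial (Fin 3) R ⧸ conicIdeal M) :=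
  quotientGrading (MvPolynomial.homogeneousSubmodule (Fin 3) R) (conicIdeal M)

instance conicGrading_gradedAlgebra (M : Matrix (Fin 3) (Fin 3) R) :
    GradedAlgebra (conicGrading M) :=
  quotientGradedAlgebra _ (conicIdeal_isHomogeneous M)

/-- The conic `{∑ M i j * x i * x j = 0} ⊆ ℙ²_R`, as a scheme. -/
def conic (M : Matrix (Fin 3) (Fin 3) R) : Scheme.{0} :=
  Proj (conicGrading M)

/-- The structure morphism of the conic. -/
def conicToSpec (M : Matrix (Fin 3) (Fin 3) R) : conic M ⟶ Spec (.of R) :=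
  Proj.toSpecZero (conicGrading M) ≫
    Spec.map (CommRingCat.ofHom (algebraMap R (conicGrading M 0)))

end Conic

/-! ### Projective line bundles and normalization -/

/-- The projective line over the integers. -/
def projectiveLineInt : Scheme.{0} :=
  Proj (MvPolynomial.homogeneousSubmodule (Fin 2) ℤ)

/-- The projective line `ℙ¹ × S` over a scheme `S`. -/
def projectiveLine (S : Scheme.{0}) : Scheme.{0} :=
  pullback (terminal.from S) (terminal.from projectiveLineInt)

/-- The structure morphism `ℙ¹ × S ⟶ S`. -/
def projectiveLineToBase (S : Scheme.{0}) : projectiveLine S ⟶ S :=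
  pullback.fst _ _

/-- A morphism `f : P ⟶ S` is a `ℙ¹`-bundle (that is, a Brauer-Severi scheme of relative
dimension one) if, étale locally on `S`, it is isomorphic over the base to the projection
from `ℙ¹ × S`. -/
def IsProjectiveLineBundle {P S : Scheme.{0}} (f : P ⟶ S) : Prop :=
  ∀ s : S, ∃ (U : Scheme.{0}) (g : U ⟶ S) (h : projectiveLine U ⟶ P),
    Etale g ∧ s ∈ Set.range g ∧ IsPullback h (projectiveLineToBase U) f g

section Normalization

variable (X : Scheme.{0}) [IsIntegral X]

/-- The inclusion of the generic point `Spec K(X) ⟶ X` of an integral scheme. -/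
def genericInclusion : Spec X.functionField ⟶ X :=
  X.fromSpecStalk (genericPoint X)

instance : QuasiSeparated (genericInclusion X) := by
  unfold genericInclusion
  infer_instance

instance : QuasiCompact (genericInclusion X) := by
  refine ⟨fun U _ _ ↦ ?_⟩
  have : Subsingleton (Spec X.functionField) :=
    inferInstanceAs (Subsingleton (PrimeSpectrum X.functionField))
  exact (Set.toFinite _).isCompact

/-- The normalization of an integral scheme: the relative normalization of `X` in its
function field. -/
def normalizationOf : Scheme.{0} :=
  (genericInclusion X).normalization

/-- The normalization morphism. -/
def normalizationMap : normalizationOf X ⟶ X :=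
  (genericInclusion X).fromNormalization

end Normalization

/-! ### The family of quadrics -/

/-- The matrix of the involution `σ` of `V = ℂ⁶`, which fixes the coordinates `x⁺` (the left
summand) and negates the coordinates `x⁻` (the right summand). -/
def sigma : Matrix (Fin 3 ⊕ Fin 3) (Fin 3 ⊕ Fin 3) ℂ :=
  Matrix.fromBlocks 1 0 0 (-1)

/-- A three-dimensional space `W` of `σ`-invariant quadratic forms on `V`, given by a basis
`q 0, q 1, q 2` (in terms of symmetric matrices). -/
structure QuadricNet where
  q : Fin 3 → Matrix (Fin 3 ⊕ Fin 3) (Fin 3 ⊕ Fin 3) ℂ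
  isSymm : ∀ i, (q i).IsSymm
  invariant : ∀ i, sigma.transpose * q i * sigma = q i
  linearIndependent : LinearIndependent ℂ q

/-- A property holds for a general net if it holds on a nonempty Zariski open subset of the
space of nets. -/
def HoldsForGeneralNet (P : QuadricNet → Prop) : Prop :=
  ∃ Φ : MvPolynomial (Fin 3 × (Fin 3 ⊕ Fin 3) × (Fin 3 ⊕ Fin 3)) ℂ,
    (∃ N : QuadricNet, MvPolynomial.eval (fun p ↦ N.q p.1 p.2.1 p.2.2) Φ ≠ 0) ∧
    ∀ N : QuadricNet, MvPolynomial.eval (fun p ↦ N.q p.1 p.2.1 p.2.2) Φ ≠ 0 → P N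

/-- The coordinate ring `ℂ[u₁, u₂, u₃]` of `W`. -/
abbrev CoordRing : Type := MvPolynomial (Fin 3) ℂ

/-- The affine space `W`. -/
def affineW : Scheme.{0} := Spec (.of CoordRing)

/-- The open subscheme `W ∖ 0`. -/
def puncturedW : affineW.Opens :=
  ⟨(PrimeSpectrum.zeroLocus (Set.range (MvPolynomial.X : Fin 3 → CoordRing)))ᶜ,
    (PrimeSpectrum.isClosed_zeroLocus _).isOpen_compl⟩

namespace QuadricNet

variable (N : QuadricNet)

/-- The symmetric matrix over `ℂ[u]` of the form `q⁺ = ∑ uᵢ qᵢ⁺` on `V₊`. -/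
def qPlus : Matrix (Fin 3) (Fin 3) CoordRing :=
  ∑ i, (MvPolynomial.X i : CoordRing) • ((N.q i).toBlocks₁₁).map MvPolynomial.C

/-- The cubic `f₊ = det q⁺`, which defines the curve `E₊` in `ℙW`. -/
def fPlus : CoordRing := N.qPlus.det

/-- Smoothness of the plane cubic `E₊ = {f₊ = 0}`, by the Jacobian criterion. -/
def SmoothCurvePlus : Prop :=
  ∀ u : Fin 3 → ℂ, u ≠ 0 → MvPolynomial.eval u N.fPlus = 0 →
    ∃ i, MvPolynomial.eval u (MvPolynomial.pderiv i N.fPlus) ≠ 0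

/-- The ring `A₊ = ℂ[u][y] / (y² - f₊)`. -/
abbrev APlus : Type :=
  AdjoinRoot (Polynomial.X ^ 2 - Polynomial.C N.fPlus : Polynomial CoordRing)

/-- The double cover `Spec A₊ ⟶ W`. -/
def doubleCover : Spec (.of N.APlus) ⟶ affineW :=
  Spec.map (CommRingCat.ofHom (algebraMap CoordRing N.APlus))

/-- The open subscheme `Spec A₊ ∖ 0`, where `0` is the locus `u = 0`. -/
def puncturedCover : (Spec (.of N.APlus)).Opens :=
  N.doubleCover ⁻¹ᵁ puncturedW

/-- The double cover `Spec A₊ ∖ 0 ⟶ W ∖ 0`. -/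
def puncturedDoubleCover : (N.puncturedCover : Scheme.{0}) ⟶ puncturedW :=
  N.doubleCover ∣_ puncturedW

/-- The conic fibration over all of `W` cut out by the adjugate forms, in the projective plane
`ℙ(V₊^∨)`. -/
def adjConicToW : conic N.qPlus.adjugate ⟶ affineW :=
  conicToSpec N.qPlus.adjugate

/-- The conic fibration `adj(C)` over `W ∖ 0`. -/
def adjC : Scheme.{0} := (N.adjConicToW ⁻¹ᵁ puncturedW : Scheme.{0})

/-- The projection `adj(C) ⟶ W ∖ 0`. -/
def adjCToBase : N.adjC ⟶ puncturedW :=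
  N.adjConicToW ∣_ puncturedW

/-- The fibre product `adj(C₊) = adj(C) ×_{W ∖ 0} (Spec A₊ ∖ 0)`. -/
def adjCPlus : Scheme.{0} :=
  pullback N.adjCToBase N.puncturedDoubleCover

/-- The projection `adj(C₊) ⟶ Spec A₊ ∖ 0`. -/
def adjCPlusToBase : N.adjCPlus ⟶ (N.puncturedCover : Scheme.{0}) :=
  pullback.snd _ _

/-- The normalization `P₊` of `adj(C₊)`. -/
def PPlus [IsIntegral N.adjCPlus] : Scheme.{0} :=
  normalizationOf N.adjCPlus

/-- The composition `P₊ ⟶ adj(C₊) ⟶ Spec A₊ ∖ 0`. -/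
def PPlusToBase [IsIntegral N.adjCPlus] : N.PPlus ⟶ (N.puncturedCover : Scheme.{0}) :=
  normalizationMap N.adjCPlus ≫ N.adjCPlusToBase

end QuadricNet

end EnriquesNet

end

/-!
# The normalization of the adjugate conic bundle is a projective line bundle
-/

/-! Smoothness of `E₊` enters twice. First, a square factor of `f₊` would produce singular points,
so `f₊` is squarefree and not a square; since `ℂ[u]` is factorial and `2` is invertible, `A₊` is a
normal domain (`quadExt_isIntegrallyClosed`, `isIntegral_of_sq_mul`). Second, the derivative of `det
q` is the trace of `adj(q) dq`, so a zero of all entries of the adjugate is a singular point of the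
cubic. Hence `q⁺` has rank at least two at every point with `u ≠ 0`
(`SmoothCurvePlus.exists_adjugate_notMem`).

Near such a point a change of basis makes `q 0 0` and the minor `h = adj(q) 2 2` units. Adjoining a
square root of `-h` is étale, and completing the square then turns the adjugate form, up to a unit,
into `Z² - y² X Y`, where `y` is the root of `f₊` in `A₊` (`splitMatrix_pullback`,
`SmoothCurvePlus.exists_splitting_cover`).

For this model over a normal domain `R` the normalization is explicit. On `X = 1` the coordinate
ring is the subring `R[t², y t]` of `R[t]`, with `Y = t²` and `Z = y t`. The ring `R[t]` is normal
and integral over it, and `y` multiplies `R[t]` into it, so inverting `y` identifies the two rings.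
The other chart is symmetric, and the relation `Z/X = (Y/X)(Z/Y)` forces the two parameters to be
inverse to each other, so the normalization is `ℙ¹` over `R`
(`exists_isPullback_splitNormalization`).

It remains to descend. Integrality of `adj(C₊)` follows because it is covered by open images of
integral split conics under étale maps, and these images meet (`SplittingChart.isIntegral`).
Relative normalization commutes with smooth base change (`SplittingChart.isPullback_normalization`),
so `P₊` pulls back to a normalization of the split conic, taken in its fibre over the generic point
of `adj(C₊)`. That fibre need not be the spectrum of the function field of the split conic, so the
model is normalized in a ring of fractions in which the conductor element `y` is invertible; this
suffices because `y` comes from a function on `adj(C₊)`.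

For a general net, write each of the fifteen quartic monomials as a quadratic monomial times a
square, and replace the square by the corresponding partial derivative of the cubic. If the matrix
of the resulting quartics is invertible, the partial derivatives have no common zero except the
origin. Its determinant is a polynomial in the net, and it is nonzero for a net whose cubic is a
multiple of the Fermat cubic. -/

noncomputable section

namespace EnriquesNet

/-! ### Quadratic extensions of normal domains -/

section Quadratic

open Polynomial

variable {R : Type} [CommRing R]

/-- The ring `R[√d]`. -/
abbrev QuadExt (d : R) : Type := AdjoinRoot (X ^ 2 - C d : R[X])

theorem quadExt_monic (d : R) : (X ^ 2 - C d : R[X]).Monic :=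
  monic_X_pow_sub_C d two_ne_zero

theorem quadExt_root_sq (d : R) :
    (AdjoinRoot.root (X ^ 2 - C d)) ^ 2 = algebraMap R (QuadExt d) d := by
  have h := AdjoinRoot.eval₂_root (X ^ 2 - C d)
  rw [eval₂_sub, eval₂_X_pow, eval₂_C, sub_eq_zero] at h
  exact h

theorem quadExt_exists (d : R) (x : QuadExt d) :
    ∃ a b : R, x = algebraMap R _ a + algebraMap R _ b * AdjoinRoot.root (X ^ 2 - C d) := by
  obtain ⟨p, rfl⟩ := AdjoinRoot.mk_surjective x
  induction p using Polynomial.induction_on' with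
  | add p q hp hq =>
    obtain ⟨a, b, h⟩ := hp
    obtain ⟨a', b', h'⟩ := hq
    exact ⟨a + a', b + b', by rw [map_add, h, h', map_add, map_add]; ring⟩
  | monomial n r =>
    induction n with
    | zero => exact ⟨r, 0, by simp⟩
    | succ n ih =>
      obtain ⟨a, b, h⟩ := ih
      refine ⟨b * d, a, ?_⟩
      rw [← monomial_mul_X, map_mul, h, AdjoinRoot.mk_X, map_mul, ← quadExt_root_sq]
      ring

theorem irreducible_X_sq_sub_C {K : Type} [Field K] {d : K} (hd : ¬ IsSquare d) :
    Irreducible (X ^ 2 - C d : K[X]) := by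
  refine (irreducible_iff_roots_eq_zero_of_degree_le_three (by simp) (by simp)).mpr ?_
  refine Multiset.eq_zero_of_forall_notMem fun a ha ↦ hd ⟨a, ?_⟩
  have := (mem_roots'.mp ha).2
  simp [sub_eq_zero, sq] at this
  exact this.symm

/-- The conjugation `σ` is recorded because integrality over the base ring will be read off from `x
+ σ x`. -/
theorem exists_quadratic_field {K : Type} [Field K] {d : K} (hd : ¬ IsSquare d) :
    ∃ (L : Type) (_ : Field L) (_ : Algebra K L) (y : L) (σ : L →ₐ[K] L),
      y ^ 2 = algebraMap K L d ∧ σ y = -y ∧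
      ∀ x : L, ∃ a b : K, x = algebraMap K L a + algebraMap K L b * y := by
  have : Fact (Irreducible (X ^ 2 - C d : K[X])) := ⟨irreducible_X_sq_sub_C hd⟩
  refine ⟨QuadExt d, inferInstance, inferInstance, AdjoinRoot.root _,
    AdjoinRoot.liftAlgHom _ (Algebra.ofId K _) (-AdjoinRoot.root _) ?_, quadExt_root_sq d, ?_,
    quadExt_exists d⟩
  · simp only [eval₂_sub, eval₂_X_pow, eval₂_C]
    rw [neg_sq, quadExt_root_sq d, sub_eq_zero]
    rfl
  · exact AdjoinRoot.liftAlgHom_root ..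

section Normal

variable [IsIntegrallyClosed R]

/-- A square root in the fraction field is integral over `R`, its square being in `R`, so normality
puts it in `R`. -/
theorem not_isSquare_map_fractionRing {d : R} (hd : ¬ IsSquare d) (K : Type) [Field K] [Algebra R K]
    [IsFractionRing R K] : ¬ IsSquare (algebraMap R K d) := by
  rintro ⟨x, hx⟩
  have hi : IsIntegral R x := by
    refine IsIntegral.of_pow two_pos ?_
    rw [sq, ← hx]
    exact isIntegral_algebraMap
  obtain ⟨r, rfl⟩ := IsIntegrallyClosed.isIntegral_iff.mp hi
  refine hd ⟨r, IsFractionRing.injective R K ?_⟩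
  rw [hx, map_mul]

variable [IsDomain R]

/-- Divisibility by a monic polynomial can be tested over the fraction field, where irreducible
polynomials are prime. -/
theorem prime_X_sq_sub_C {d : R} (hd : ¬ IsSquare d) : Prime (X ^ 2 - C d : R[X]) := by
  let K := FractionRing R
  have hm := quadExt_monic d
  have hK := (irreducible_X_sq_sub_C (not_isSquare_map_fractionRing hd K)).prime
  have hmap : (X ^ 2 - C d : R[X]).map (algebraMap R K) = X ^ 2 - C (algebraMap R K d) := by simp
  have hinj := IsFractionRing.injective R K
  refine ⟨hm.ne_zero, fun h ↦ ?_, fun p q h ↦ ?_⟩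
  · have h2 := natDegree_eq_zero_of_isUnit h
    simp at h2
  · rw [← map_dvd_map _ hinj hm, Polynomial.map_mul, hmap] at h
    rw [← map_dvd_map _ hinj hm, ← map_dvd_map _ hinj hm, hmap]
    exact hK.dvd_or_dvd h

theorem quadExt_isDomain {d : R} (hd : ¬ IsSquare d) : IsDomain (QuadExt d) :=
  AdjoinRoot.isDomain_of_prime (prime_X_sq_sub_C hd)

/-- `R[√d]` is normal when `R` is normal, `2` is invertible and `d` is squarefree in the sense that
`x ^ 2 * d ∈ R` forces `x ∈ R`. -/
theorem quadExt_isIntegrallyClosed {d : R} (hd : ¬ IsSquare d) (h2 : IsUnit (2 : R))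
    (hsq : ∀ x : FractionRing R, IsIntegral R (x ^ 2 * algebraMap R _ d) → IsIntegral R x) :
    IsIntegrallyClosed (QuadExt d) := by
  let K := FractionRing R
  let d' : K := algebraMap R K d
  have hd' : ¬ IsSquare d' := not_isSquare_map_fractionRing hd K
  obtain ⟨L, _, _, y', σ, hyd, hσy, hex⟩ := exists_quadratic_field hd'
  let : Algebra R L := Algebra.compHom L (algebraMap R K)
  have : IsScalarTower R K L := .of_algebraMap_eq' rfl
  let y : QuadExt d := AdjoinRoot.root (X ^ 2 - C d)
  let φ : QuadExt d →ₐ[R] L := AdjoinRoot.liftAlgHom _ (Algebra.ofId R L) y' (by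
    simp only [eval₂_sub, eval₂_X_pow, eval₂_C]
    rw [hyd, sub_eq_zero]
    rfl)
  have hφy : φ y = y' := by simp [φ, y]
  let : Algebra (QuadExt d) L := φ.toRingHom.toAlgebra
  have htow : IsScalarTower R (QuadExt d) L := .of_algebraMap_eq' φ.comp_algebraMap.symm
  have hdom := quadExt_isDomain hd
  have hK : Function.Injective (algebraMap K L) := (algebraMap K L).injective
  have hR : Function.Injective (algebraMap R K) := IsFractionRing.injective R K
  have hy' : ∀ a b : K, algebraMap K L a + algebraMap K L b * y' = 0 → a = 0 ∧ b = 0 := by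
    intro a b h
    by_cases hb : b = 0
    · subst hb
      rw [map_zero, zero_mul, add_zero] at h
      exact ⟨(map_eq_zero_iff _ hK).mp h, rfl⟩
    -- If `b ≠ 0` then `y' = -a / b` comes from `K`, which makes `d'` the square of `a / b`.
    · refine absurd ⟨a / b, hK ?_⟩ hd'
      have hb' : algebraMap K L b ≠ 0 := by rwa [Ne, map_eq_zero_iff _ hK]
      have hy : y' = - (algebraMap K L a / algebraMap K L b) := by
        field_simp
        linear_combination h
      rw [← hyd, map_mul, map_div₀, hy]
      ring
  have hinj : Function.Injective (algebraMap (QuadExt d) L) := by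
    rw [injective_iff_map_eq_zero]
    intro x hx
    obtain ⟨a, b, rfl⟩ := quadExt_exists d x
    have : φ (algebraMap R _ a + algebraMap R _ b * y) = 0 := hx
    rw [map_add, map_mul, hφy, φ.commutes, φ.commutes, IsScalarTower.algebraMap_apply R K L,
      IsScalarTower.algebraMap_apply R K L] at this
    obtain ⟨ha, hb⟩ := hy' _ _ this
    rw [map_eq_zero_iff _ hR] at ha hb
    simp [ha, hb]
  have hclosed : IsIntegrallyClosedIn (QuadExt d) L := by
    refine ⟨hinj, fun {x} ↦ ⟨fun hx ↦ ?_, ?_⟩⟩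
    · have hx : IsIntegral R x := by
        have : Algebra.IsIntegral R (QuadExt d) := ⟨fun z ↦ by
          obtain ⟨a, b, rfl⟩ := quadExt_exists d z
          refine isIntegral_algebraMap.add (isIntegral_algebraMap.mul ?_)
          refine IsIntegral.of_pow two_pos ?_
          rw [quadExt_root_sq]
          exact isIntegral_algebraMap⟩
        exact isIntegral_trans x hx
      obtain ⟨a, b, rfl⟩ := hex x
      have hσ : IsIntegral R (σ (algebraMap K L a + algebraMap K L b * y')) :=
        hx.map (σ.restrictScalars R)
      rw [map_add, map_mul, hσy, σ.commutes, σ.commutes] at hσ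
      have hint : ∀ c : K, IsIntegral R (algebraMap K L c) → IsIntegral R c := fun c h ↦
        (isIntegral_algHom_iff (IsScalarTower.toAlgHom R K L) hK).mp h
      obtain ⟨u, hu⟩ := h2
      -- The rational part `a` is half the trace `x + σ x`; this is where `2` has to be invertible.
      have ha : IsIntegral R a := by
        refine hint _ ?_
        have h := (hx.add hσ).smul (↑u⁻¹ : R)
        have h1 : (↑u⁻¹ : R) • (algebraMap K L a + algebraMap K L b * y' +
          (algebraMap K L a + algebraMap K L b * -y')) = algebraMap K L a := by
          rw [show algebraMap K L a + algebraMap K L b * y' +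
            (algebraMap K L a + algebraMap K L b * -y') = (2 : R) • algebraMap K L a by
              rw [two_smul]; ring, smul_smul, ← hu, Units.inv_mul, one_smul]
        rwa [h1] at h
      -- `(x - a) ^ 2 = b ^ 2 * d` is integral, and `hsq` is tailored to conclude from this.
      have hb : IsIntegral R b := by
        refine hsq b (hint _ ?_)
        have h := ((hx.sub (ha.map (IsScalarTower.toAlgHom R K L))).pow 2)
        have h1 : (algebraMap K L a + algebraMap K L b * y' -
            IsScalarTower.toAlgHom R K L a) ^ 2 = algebraMap K L (b ^ 2 * algebraMap R K d) := by
          rw [map_mul, map_pow, ← hyd, IsScalarTower.toAlgHom_apply]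
          ring
        rwa [h1] at h
      obtain ⟨a, rfl⟩ := IsIntegrallyClosed.isIntegral_iff.mp ha
      obtain ⟨b, rfl⟩ := IsIntegrallyClosed.isIntegral_iff.mp hb
      refine ⟨algebraMap R _ a + algebraMap R _ b * y, ?_⟩
      change φ _ = _
      rw [map_add, map_mul, hφy, φ.commutes, φ.commutes, IsScalarTower.algebraMap_apply R K L,
        IsScalarTower.algebraMap_apply R K L]
    · rintro ⟨z, rfl⟩
      exact isIntegral_algebraMap
  have : FaithfulSMul (QuadExt d) L := (faithfulSMul_iff_algebraMap_injective _ _).mpr hinj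
  exact .of_isIntegrallyClosed_of_isIntegrallyClosedIn _ L

end Normal

/-- With `f = X² - d`, the identity `X f' - 2 f = 2 d` shows that `f'` is invertible modulo `f`; `e`
below is the unit `2 d`. The pair is standard étale with nothing further inverted (`g = 1`). -/
theorem quadExt_etale {d : R} (h2 : IsUnit (2 : R)) (hd : IsUnit d) :
    Algebra.Etale R (QuadExt d) := by
  obtain ⟨e, he⟩ := h2.mul hd
  let P : StandardEtalePair R :=
    { f := X ^ 2 - C d
      monic_f := quadExt_monic d
      g := 1
      cond := ⟨C (↑e⁻¹) * X, - C (↑e⁻¹ * 2), 0, by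
        have h1 : (↑e⁻¹ : R) * (2 * d) = 1 := by rw [← he]; simp
        have h3 : C (↑e⁻¹ : R) * (C 2 * C d) = 1 := by rw [← C_mul, ← C_mul, h1, C_1]
        simp only [derivative_sub, derivative_X_pow, derivative_C, C_mul, C_ofNat] at h3 ⊢
        simp only [Nat.cast_ofNat, C_ofNat]
        linear_combination h3⟩ }
  have : IsUnit (AdjoinRoot.mk P.f P.g) := by simp [P]
  let e1 : AdjoinRoot P.f ≃ₐ[R] Localization.Away (AdjoinRoot.mk P.f P.g) :=
    (IsLocalization.atUnits (AdjoinRoot P.f) (.powers (AdjoinRoot.mk P.f P.g)) (by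
      rintro _ ⟨n, rfl⟩
      exact this.pow n)).restrictScalars R
  exact Algebra.Etale.of_equiv (P.equivAwayAdjoinRoot.trans e1.symm)

end Quadratic

/-- Over a normal domain in which `2` and `d` are invertible, there is a surjective étale
extension by a normal domain in which `d` becomes a square. -/
theorem exists_etale_sqrt {R : Type} [CommRing R] [IsDomain R] [IsIntegrallyClosed R]
    (h2 : IsUnit (2 : R)) {d : R} (hd : IsUnit d) :
    ∃ (S : Type) (_ : CommRing S) (_ : Algebra R S), IsDomain S ∧ IsIntegrallyClosed S ∧
      Algebra.Etale R S ∧ Function.Injective (algebraMap R S) ∧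
      Algebra.IsIntegral R S ∧ ∃ r : S, r ^ 2 = algebraMap R S d := by
  -- If `d` is already a square then `R[√d]` is not a domain, and `R` itself serves.
  by_cases h : IsSquare d
  · obtain ⟨r, hr⟩ := h
    exact ⟨R, inferInstance, inferInstance, inferInstance, inferInstance, inferInstance,
      Function.injective_id, inferInstance, r, by rw [hr, sq]; rfl⟩
  · refine ⟨QuadExt d, inferInstance, inferInstance, quadExt_isDomain h,
      quadExt_isIntegrallyClosed h h2 fun x hx ↦ ?_, quadExt_etale h2 hd, ?_, ?_, _,
      quadExt_root_sq d⟩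
    · obtain ⟨u, rfl⟩ := hd
      refine IsIntegral.of_pow two_pos ?_
      have h := hx.mul (isIntegral_algebraMap (x := (↑u⁻¹ : R)))
      rw [mul_assoc, ← map_mul, Units.mul_inv, map_one, mul_one] at h
      exact h
    · exact AdjoinRoot.of.injective_of_degree_ne_zero (by
        rw [Polynomial.degree_X_pow_sub_C two_pos]; decide)
    · have := (quadExt_monic d).finite_adjoinRoot
      infer_instance

/-! ### Evaluation of homogeneous fractions -/

section AwayEval

open HomogeneousLocalization

variable {A σ G H : Type*} [CommRing A] [SetLike σ A] [AddSubgroupClass σ A] (𝒜 : ℕ → σ)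
  [GradedRing 𝒜] [CommRing G] [CommRing H]

/-- The evaluation of a homogeneous fraction `a / f ^ n` at a ring homomorphism for which `f`
becomes invertible. -/
def awayEval (β : A →+* G) {f : A} (hf : IsUnit (β f)) : Away 𝒜 f →+* G :=
  (Localization.awayLift β f hf).comp (algebraMap (Away 𝒜 f) (Localization.Away f))

theorem awayEval_mk_mul (β : A →+* G) {f : A} (hf : IsUnit (β f)) {d : ℕ} (hd : f ∈ 𝒜 d) (n : ℕ)
    {x : A} (hx : x ∈ 𝒜 (n • d)) :
    awayEval 𝒜 β hf (Away.mk 𝒜 hd n x hx) * β f ^ n = β x := by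
  obtain ⟨v, hv⟩ := isUnit_iff_exists_inv.mp hf
  rw [awayEval, RingHom.comp_apply, HomogeneousLocalization.algebraMap_apply, Away.val_mk,
    Localization.awayLift_mk (hv := hv), mul_assoc, ← mul_pow, mul_comm v, hv, one_pow, mul_one]

theorem awayEval_eq_iff (β : A →+* G) {f : A} (hf : IsUnit (β f)) {d : ℕ} (hd : f ∈ 𝒜 d) (n : ℕ)
    {x : A} (hx : x ∈ 𝒜 (n • d)) (z : G) :
    awayEval 𝒜 β hf (Away.mk 𝒜 hd n x hx) = z ↔ z * β f ^ n = β x := by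
  rw [← awayEval_mk_mul 𝒜 β hf hd n hx, (hf.pow n).mul_left_inj, eq_comm]

theorem comp_awayEval (β : A →+* G) {f : A} (hf : IsUnit (β f)) (γ : G →+* H) {d : ℕ}
    (hd : f ∈ 𝒜 d) :
    γ.comp (awayEval 𝒜 β hf) = awayEval 𝒜 (γ.comp β) (f := f) (hf.map γ) := by
  ext z
  obtain ⟨n, x, hx, rfl⟩ := Away.mk_surjective 𝒜 hd z
  rw [eq_comm, awayEval_eq_iff, RingHom.comp_apply, RingHom.comp_apply, RingHom.comp_apply,
    ← map_pow, ← map_mul, awayEval_mk_mul]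

theorem awayEval_comp_awayMap (β : A →+* G) {f g x : A} (hx : x = f * g) (hβ : IsUnit (β x))
    (hf : IsUnit (β f)) {d e : ℕ} (hd : f ∈ 𝒜 d) (he : g ∈ 𝒜 e) :
    (awayEval 𝒜 β hβ).comp (awayMap 𝒜 he hx) = awayEval 𝒜 β hf := by
  ext z
  obtain ⟨n, a, ha, rfl⟩ := Away.mk_surjective 𝒜 hd z
  rw [RingHom.comp_apply, awayMap_mk, awayEval_eq_iff, hx, map_mul, mul_pow, ← mul_assoc,
    awayEval_mk_mul, map_mul, map_pow]

/-- Numerator and denominator of a homogeneous fraction of degree zero acquire the same power of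
`u`. -/
theorem awayEval_congr_of_smul {β γ : A →+* G} {f : A} {d : ℕ} (hd : f ∈ 𝒜 d) (hβ : IsUnit (β f))
    (hγ : IsUnit (γ f)) (u : G) (h : ∀ n, ∀ a ∈ 𝒜 n, γ a = u ^ n * β a) :
    awayEval 𝒜 β hβ = awayEval 𝒜 γ hγ := by
  ext z
  obtain ⟨n, a, ha, rfl⟩ := Away.mk_surjective 𝒜 hd z
  rw [eq_comm, awayEval_eq_iff, h _ _ hd, h _ _ ha, ← awayEval_mk_mul 𝒜 β hβ hd n ha, mul_pow,
    ← pow_mul, smul_eq_mul, mul_comm d n]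
  ring

theorem awayEval_fromZeroRingHom (β : A →+* G) {f : A} (hf : IsUnit (β f)) {d : ℕ} (hd : f ∈ 𝒜 d)
    (a : 𝒜 0) : awayEval 𝒜 β hf (fromZeroRingHom 𝒜 _ a) = β a := by
  have : fromZeroRingHom 𝒜 (.powers f) a = Away.mk 𝒜 hd 0 a (by simp) := by
    ext
    simp [fromZeroRingHom]
    rfl
  rw [this, awayEval_eq_iff, pow_zero, mul_one]

theorem awayEval_comp_map {B τ : Type*} [CommRing B] [SetLike τ B] [AddSubgroupClass τ B]
    (ℬ : ℕ → τ) [GradedRing ℬ] (φ : 𝒜 →+*ᵍ ℬ) (β : B →+* G) {f : A} (hf : IsUnit (β (φ f)))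
    {d : ℕ} (hd : f ∈ 𝒜 d) :
    (awayEval ℬ β hf).comp (Away.map φ f) = awayEval 𝒜 (β.comp (φ : A →+* B)) (f := f) hf := by
  ext z
  obtain ⟨n, a, ha, rfl⟩ := Away.mk_surjective 𝒜 hd z
  rw [RingHom.comp_apply, Away.map_mk, awayEval_eq_iff]
  exact awayEval_mk_mul 𝒜 (β.comp (φ : A →+* B)) hf hd n ha

/-- For `f` of degree one, the homogeneous fractions with denominators powers of `f` are
`A / (f - 1)`. -/
def awayDehomogenize (f : A) : Away 𝒜 f →+* A ⧸ Ideal.span {f - 1} :=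
  awayEval 𝒜 (Ideal.Quotient.mk (Ideal.span {f - 1})) (f := f) (by
    rw [show Ideal.Quotient.mk (Ideal.span {f - 1}) f = 1 by
      rw [← map_one (Ideal.Quotient.mk (Ideal.span {f - 1})), Ideal.Quotient.eq]
      exact Ideal.mem_span_singleton_self _]
    exact isUnit_one)

theorem mk_span_sub_one (f : A) : Ideal.Quotient.mk (Ideal.span {f - 1}) f = 1 := by
  rw [← map_one (Ideal.Quotient.mk (Ideal.span {f - 1})), Ideal.Quotient.eq]
  exact Ideal.mem_span_singleton_self _

theorem awayDehomogenize_mk {f : A} (hf : f ∈ 𝒜 1) (n : ℕ) {x : A} (hx : x ∈ 𝒜 (n • 1)) :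
    awayDehomogenize 𝒜 f (Away.mk 𝒜 hf n x hx) = Ideal.Quotient.mk _ x := by
  rw [awayDehomogenize, awayEval_eq_iff, mk_span_sub_one, one_pow, mul_one]

/-- Write `x = b (f - 1)` and compare homogeneous components: those of `b` vanish below degree `n`,
and the one in degree `n + k` is `-f ^ k * x`. Only finitely many components of `b` are nonzero.
This is the injectivity of `A_(f) → A / (f - 1)`. -/
theorem exists_pow_mul_eq_zero_of_mem_span_sub_one {f : A} (hf : f ∈ 𝒜 1) {n : ℕ} {x : A}
    (hx : x ∈ 𝒜 n) (h : x ∈ Ideal.span {f - 1}) : ∃ k, f ^ k * x = 0 := by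
  obtain ⟨b, hb⟩ := Ideal.mem_span_singleton'.mp h
  have hproj : ∀ i, GradedRing.proj 𝒜 (i + 1) x =
      f * GradedRing.proj 𝒜 i b - GradedRing.proj 𝒜 (i + 1) b := by
    intro i
    rw [← hb, mul_sub, mul_one, map_sub, mul_comm b f]
    congr 1
    simp only [GradedRing.proj_apply]
    exact DirectSum.coe_decompose_mul_of_left_mem_of_le  𝒜 hf (by omega)
  have hproj0 : GradedRing.proj 𝒜 0 x = - GradedRing.proj 𝒜 0 b := by
    rw [← hb, mul_sub, mul_one, map_sub, mul_comm b f]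
    simp only [GradedRing.proj_apply]
    rw [DirectSum.coe_decompose_mul_of_left_mem_of_not_le 𝒜 hf (by omega), zero_sub]
  have hne : ∀ i, i ≠ n → GradedRing.proj 𝒜 i x = 0 := fun i hi ↦ by
    rw [GradedRing.proj_apply, DirectSum.decompose_of_mem_ne 𝒜 hx (Ne.symm hi)]
  have hn : GradedRing.proj 𝒜 n x = x := by
    rw [GradedRing.proj_apply, DirectSum.decompose_of_mem_same 𝒜 hx]
  have hlt : ∀ i < n, GradedRing.proj 𝒜 i b = 0 := by
    intro i
    induction i with
    | zero =>
      intro hi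
      rw [← neg_eq_zero, ← hproj0, hne _ hi.ne]
    | succ i ih =>
      intro hi
      have := hproj i
      rw [ih (by omega), hne _ hi.ne, mul_zero, zero_sub, eq_comm, neg_eq_zero] at this
      exact this
  have hbn : GradedRing.proj 𝒜 n b = - x := by
    cases n with
    | zero => rw [← hn, hproj0, neg_neg]
    | succ n =>
      have := hproj n
      rw [hlt n (by omega), hn, mul_zero, zero_sub] at this
      rw [this, neg_neg]
  have hge : ∀ k, GradedRing.proj 𝒜 (n + k) b = - (f ^ k * x) := by
    intro k
    induction k with
    | zero => rw [add_zero, hbn, pow_zero, one_mul]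
    | succ k ih =>
      have := hproj (n + k)
      rw [ih, hne _ (by omega)] at this
      rw [← add_assoc]
      linear_combination this
  classical
  obtain ⟨k, hk⟩ : ∃ k, GradedRing.proj 𝒜 (n + k) b = 0 := by
    obtain ⟨N, hN⟩ := (DirectSum.decompose 𝒜 b).support.exists_nat_subset_range
    refine ⟨N, ?_⟩
    rw [GradedRing.proj_apply]
    by_contra hne
    have : n + N ∈ (DirectSum.decompose 𝒜 b).support := by
      rw [DFinsupp.mem_support_iff]
      intro h
      exact hne (by rw [h]; rfl)
    have := Finset.mem_range.mp (hN this)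
    omega
  exact ⟨k, by rw [← neg_eq_zero, ← hge, hk]⟩

theorem awayDehomogenize_bijective {f : A} (hf : f ∈ 𝒜 1) :
    Function.Bijective (awayDehomogenize 𝒜 f) := by
  constructor
  · rw [injective_iff_map_eq_zero]
    intro z hz
    obtain ⟨n, x, hx, rfl⟩ := Away.mk_surjective 𝒜 hf z
    rw [awayDehomogenize_mk, Ideal.Quotient.eq_zero_iff_mem] at hz
    obtain ⟨k, hk⟩ := exists_pow_mul_eq_zero_of_mem_span_sub_one 𝒜 hf hx hz
    ext
    rw [Away.val_mk, val_zero, ← Localization.mk_zero 1, Localization.mk_eq_mk_iff,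
      Localization.r_iff_exists]
    exact ⟨⟨f ^ k, k, rfl⟩, by simpa using hk⟩
  · intro z
    obtain ⟨a, rfl⟩ := Ideal.Quotient.mk_surjective z
    rw [← RingHom.mem_range]
    induction a using DirectSum.Decomposition.inductionOn 𝒜 with
    | zero => rw [map_zero]; exact zero_mem _
    | @homogeneous i m =>
      exact ⟨Away.mk 𝒜 hf i m (by simp), awayDehomogenize_mk 𝒜 hf i _⟩
    | add m m' h h' => rw [map_add]; exact add_mem h h'

variable {𝒜} in
/-- For `f` of degree one, `A_(f)` is `A / (f - 1)`. -/
def awayEquivQuotient {f : A} (hf : f ∈ 𝒜 1) : Away 𝒜 f ≃+* A ⧸ Ideal.span {f - 1} :=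
  RingEquiv.ofBijective _ (awayDehomogenize_bijective 𝒜 hf)

variable {𝒜} in
/-- The map `A → A_(f)` sending `a` of degree `n` to `a / f ^ n`, for `f` of degree one. -/
def awayHomogenize {f : A} (hf : f ∈ 𝒜 1) : A →+* Away 𝒜 f :=
  ((awayEquivQuotient hf).symm : A ⧸ Ideal.span {f - 1} →+* Away 𝒜 f).comp
    (Ideal.Quotient.mk (Ideal.span {f - 1}))

variable {𝒜} in
theorem awayHomogenize_of_mem {f : A} (hf : f ∈ 𝒜 1) (n : ℕ) {x : A} (hx : x ∈ 𝒜 (n • 1)) :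
    awayHomogenize hf x = Away.mk 𝒜 hf n x hx :=
  (RingEquiv.symm_apply_eq (awayEquivQuotient hf)).mpr (awayDehomogenize_mk 𝒜 hf n hx).symm

variable {𝒜} in
theorem awayHomogenize_surjective {f : A} (hf : f ∈ 𝒜 1) :
    Function.Surjective (awayHomogenize hf) :=
  (awayEquivQuotient hf).symm.surjective.comp Ideal.Quotient.mk_surjective

variable {𝒜} in
theorem awayHomogenize_self {f : A} (hf : f ∈ 𝒜 1) : awayHomogenize hf f = 1 :=
  (RingEquiv.symm_apply_eq (awayEquivQuotient hf)).mpr ((mk_span_sub_one f).trans (map_one _).symm)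

variable {𝒜} in
theorem awayHomogenize_zero {f : A} (hf : f ∈ 𝒜 1) (a : 𝒜 0) :
    awayHomogenize hf a = fromZeroRingHom 𝒜 _ a := by
  rw [awayHomogenize_of_mem hf 0 (by simp)]
  ext
  simp [fromZeroRingHom]
  rfl

variable {𝒜} in
theorem awayEval_homogenize {f : A} (hf : f ∈ 𝒜 1) (β : A →+* G) (h : β f = 1) (a : A) :
    awayEval 𝒜 β (f := f) (by rw [h]; exact isUnit_one) (awayHomogenize hf a) = β a := by
  induction a using DirectSum.Decomposition.inductionOn 𝒜 with
  | zero => simp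
  | @homogeneous i m =>
    rw [awayHomogenize_of_mem hf i (by simp), awayEval_eq_iff, h, one_pow, mul_one]
  | add m m' h h' => rw [map_add, map_add, h, h', map_add]

end AwayEval

section

attribute [local instance] MvPolynomial.gradedAlgebra

/-! ### The homogeneous coordinate ring of a conic -/

section ConicRing

open HomogeneousLocalization Matrix

variable {R R' G : Type} [CommRing R] [CommRing R'] [CommRing G]

theorem mem_span_X_of_isHomogeneous {ι : Type} {p : MvPolynomial ι R} {n : ℕ}
    (hp : p.IsHomogeneous n) (hn : 0 < n) :
    p ∈ Ideal.span (Set.range (MvPolynomial.X : ι → MvPolynomial ι R)) := by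
  rw [← Set.image_univ, MvPolynomial.mem_ideal_span_X_image]
  intro m hm
  have h := hp (MvPolynomial.mem_support_iff.mp hm)
  by_contra! hc
  have : m = 0 := Finsupp.ext fun i ↦ hc i (Set.mem_univ i)
  rw [this] at h
  simp at h
  omega

/-- The homogeneous coordinate ring of the conic attached to `M`. -/
abbrev ConicRing (M : Matrix (Fin 3) (Fin 3) R) : Type := MvPolynomial (Fin 3) R ⧸ conicIdeal M

/-- The homogeneous coordinates on the conic attached to `M`. -/
def conicCoord (M : Matrix (Fin 3) (Fin 3) R) (i : Fin 3) : ConicRing M :=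
  Ideal.Quotient.mk _ (MvPolynomial.X i)

variable (M : Matrix (Fin 3) (Fin 3) R)

theorem eval₂_ternaryForm (φ : R →+* G) (v : Fin 3 → G) :
    MvPolynomial.eval₂ φ v (ternaryForm M) = v ⬝ᵥ M.map φ *ᵥ v := by
  simp only [ternaryForm, MvPolynomial.eval₂_sum, MvPolynomial.eval₂_mul, MvPolynomial.eval₂_C,
    MvPolynomial.eval₂_X, dotProduct, mulVec, Matrix.map_apply, Finset.mul_sum]
  exact Finset.sum_congr rfl fun i _ ↦ Finset.sum_congr rfl fun j _ ↦ by ring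

/-- Ring homomorphisms out of the coordinate ring of a conic. -/
def conicLift (φ : R →+* G) (v : Fin 3 → G) (h : v ⬝ᵥ M.map φ *ᵥ v = 0) : ConicRing M →+* G :=
  Ideal.Quotient.lift _ (MvPolynomial.eval₂Hom φ v) fun a ha ↦ by
    obtain ⟨b, rfl⟩ := Ideal.mem_span_singleton'.mp ha
    rw [map_mul, MvPolynomial.coe_eval₂Hom, eval₂_ternaryForm, h, mul_zero]

variable {M} in
@[simp]
theorem conicLift_coord (φ : R →+* G) (v : Fin 3 → G) (h : v ⬝ᵥ M.map φ *ᵥ v = 0) (i : Fin 3) :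
    conicLift M φ v h (conicCoord M i) = v i :=
  (Ideal.Quotient.lift_mk ..).trans (MvPolynomial.eval₂Hom_X' ..)

variable {M} in
@[simp]
theorem conicLift_algebraMap (φ : R →+* G) (v : Fin 3 → G) (h : v ⬝ᵥ M.map φ *ᵥ v = 0) (r : R) :
    conicLift M φ v h (algebraMap R _ r) = φ r :=
  (Ideal.Quotient.lift_mk ..).trans (MvPolynomial.eval₂Hom_C ..)

variable {M} in
theorem conicRing_hom_ext {f g : ConicRing M →+* G}
    (h : f.comp (algebraMap R _) = g.comp (algebraMap R _))
    (h' : ∀ i, f (conicCoord M i) = g (conicCoord M i)) : f = g := by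
  refine Ideal.Quotient.ringHom_ext (MvPolynomial.ringHom_ext (fun r ↦ ?_) h')
  exact RingHom.congr_fun h r

theorem conicCoord_relation :
    conicCoord M ⬝ᵥ M.map (algebraMap R (ConicRing M)) *ᵥ conicCoord M = 0 := by
  have h : Ideal.Quotient.mk (conicIdeal M) (ternaryForm M) = 0 :=
    Ideal.Quotient.eq_zero_iff_mem.mpr (Ideal.mem_span_singleton_self _)
  rw [← h, ← eval₂_ternaryForm]
  exact RingHom.congr_fun (MvPolynomial.ringHom_ext (f := MvPolynomial.eval₂Hom
    (algebraMap R (ConicRing M)) (conicCoord M)) (g := Ideal.Quotient.mk (conicIdeal M))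
    (fun r ↦ MvPolynomial.eval₂Hom_C ..) (fun i ↦ MvPolynomial.eval₂Hom_X' ..)) (ternaryForm M)

variable {M} in
theorem conicHom_relation (f : ConicRing M →+* G) (φ : R →+* G) (hφ : f.comp (algebraMap R _) = φ) :
    (f ∘ conicCoord M) ⬝ᵥ M.map φ *ᵥ (f ∘ conicCoord M) = 0 := by
  have h := congrArg f (conicCoord_relation M)
  rw [map_zero, ← eval₂_ternaryForm, MvPolynomial.hom_eval₂, hφ, eval₂_ternaryForm] at h
  exact h

theorem conicCoord_mem (i : Fin 3) : conicCoord M i ∈ conicGrading M 1 :=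
  ⟨_, MvPolynomial.isHomogeneous_X R i, rfl⟩

theorem conicGrading_le_span {n : ℕ} (hn : 0 < n) {x : ConicRing M} (hx : x ∈ conicGrading M n) :
    x ∈ Ideal.span (Set.range (conicCoord M)) := by
  obtain ⟨p, hp, rfl⟩ := hx
  have := Ideal.mem_map_of_mem (Ideal.Quotient.mk (conicIdeal M))
    (mem_span_X_of_isHomogeneous hp hn)
  rw [Ideal.map_span, ← Set.range_comp] at this
  exact this

theorem irrelevant_le_span_conicCoord :
    (HomogeneousIdeal.irrelevant (conicGrading M)).toIdeal ≤
      Ideal.span (Set.range (conicCoord M)) :=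
  (HomogeneousIdeal.toIdeal_irrelevant_le _).mpr fun _ hi _ hx ↦ conicGrading_le_span M hi hx

variable {M} {M' : Matrix (Fin 3) (Fin 3) R'}

/-- The graded ring homomorphism of coordinate rings of conics induced by a homomorphism of the
base rings and a linear change of variables. -/
def conicGradedHom (φ : R →+* R') (T : Matrix (Fin 3) (Fin 3) R')
    (h : ((T.map (algebraMap R' (ConicRing M'))) *ᵥ conicCoord M') ⬝ᵥ
      (M.map ((algebraMap R' (ConicRing M')).comp φ)) *ᵥ
      ((T.map (algebraMap R' (ConicRing M'))) *ᵥ conicCoord M') = 0) :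
    conicGrading M →+*ᵍ conicGrading M' where
  toRingHom := conicLift M ((algebraMap R' _).comp φ) _ h
  map_mem := by
    intro n x hx
    obtain ⟨p, hp, rfl⟩ := hx
    change MvPolynomial.eval₂ _ _ p ∈ _
    rw [MvPolynomial.eval₂_eq]
    refine Submodule.sum_mem _ fun m hm ↦ ?_
    have hdeg := hp (MvPolynomial.mem_support_iff.mp hm)
    rw [RingHom.comp_apply, ← Algebra.smul_def]
    refine Submodule.smul_mem _ _ ?_
    have hT : ∀ i, (T.map (algebraMap R' (ConicRing M')) *ᵥ conicCoord M') i ∈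
        conicGrading M' 1 := by
      intro i
      rw [Matrix.mulVec, dotProduct]
      refine Submodule.sum_mem _ fun j _ ↦ ?_
      rw [Matrix.map_apply, ← Algebra.smul_def]
      exact Submodule.smul_mem _ _ (conicCoord_mem M' j)
    have := SetLike.prod_pow_mem_graded (conicGrading M') (F := m.support) (fun _ ↦ 1) _ m
      (fun i _ ↦ hT i)
    rw [← hdeg]
    simpa [Finsupp.weight_apply, Finsupp.sum] using this

theorem conicGradedHom_algebraMap (φ : R →+* R') (T : Matrix (Fin 3) (Fin 3) R') (h) (r : R) :
    conicGradedHom (M := M) (M' := M') φ T h (algebraMap R _ r) = algebraMap R' _ (φ r) :=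
  conicLift_algebraMap _ _ h r

theorem conicGradedHom_coord (φ : R →+* R') (T : Matrix (Fin 3) (Fin 3) R') (h) (i : Fin 3) :
    conicGradedHom (M := M) (M' := M') φ T h (conicCoord M i) =
      (T.map (algebraMap R' (ConicRing M')) *ᵥ conicCoord M') i :=
  conicLift_coord _ _ h i

theorem mulVec_comp_conicGradedHom (φ : R →+* R') (T T' : Matrix (Fin 3) (Fin 3) R')
    (hT : T' * T = 1) (h) :
    (T'.map (algebraMap R' (ConicRing M'))) *ᵥ
      (conicGradedHom (M := M) (M' := M') φ T h ∘ conicCoord M) = conicCoord M' := by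
  have : conicGradedHom (M := M) (M' := M') φ T h ∘ conicCoord M =
      T.map (algebraMap R' (ConicRing M')) *ᵥ conicCoord M' :=
    funext fun i ↦ conicGradedHom_coord φ T h i
  rw [this, Matrix.mulVec_mulVec, ← Matrix.map_mul, hT]
  simp

theorem dotProduct_mulVec_congr {S : Type} [CommRing S] (T N : Matrix (Fin 3) (Fin 3) S)
    (v : Fin 3 → S) : (T *ᵥ v) ⬝ᵥ N *ᵥ (T *ᵥ v) = v ⬝ᵥ (Tᵀ * N * T) *ᵥ v := by
  rw [← Matrix.mulVec_mulVec, ← Matrix.mulVec_mulVec, Matrix.dotProduct_mulVec v,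
    Matrix.vecMul_transpose]

/-- The relation between the coordinates on the conic of `M'` is `c` times the desired one, and `c`
is a unit. -/
theorem conicGradedHom_relation (φ : R →+* R') (T : Matrix (Fin 3) (Fin 3) R') {c : R'}
    (hc : IsUnit c) (hM : M' = c • (Tᵀ * M.map φ * T)) :
    ((T.map (algebraMap R' (ConicRing M'))) *ᵥ conicCoord M') ⬝ᵥ
      (M.map ((algebraMap R' (ConicRing M')).comp φ)) *ᵥ
      ((T.map (algebraMap R' (ConicRing M'))) *ᵥ conicCoord M') = 0 := by
  rw [dotProduct_mulVec_congr]
  have h := conicCoord_relation M'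
  have h1 : M'.map (algebraMap R' (ConicRing M')) = algebraMap R' (ConicRing M') c •
      ((T.map (algebraMap R' (ConicRing M')))ᵀ *
        M.map ((algebraMap R' (ConicRing M')).comp φ) * T.map (algebraMap R' (ConicRing M'))) := by
    conv_lhs => rw [show M'.map (algebraMap R' (ConicRing M')) =
      (c • (Tᵀ * M.map φ * T)).map (algebraMap R' (ConicRing M')) by rw [← hM]]
    rw [Matrix.map_smul' _ _ _ (map_mul _), Matrix.map_mul, Matrix.map_mul, Matrix.transpose_map,
      Matrix.map_map]
    rfl
  rw [h1, Matrix.smul_mulVec, dotProduct_smul, smul_eq_mul] at h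
  exact (hc.map _).mul_right_eq_zero.mp h

end ConicRing

/-! ### Base change of conics -/

section ConicBaseChange

open HomogeneousLocalization Matrix

variable {R R' : Type} [CommRing R] [CommRing R'] {M : Matrix (Fin 3) (Fin 3) R}
  {M' : Matrix (Fin 3) (Fin 3) R'}

/-- The structure map of a chart of a conic. -/
def conicAwayBase (M : Matrix (Fin 3) (Fin 3) R) (s : ConicRing M) :
    R →+* Away (conicGrading M) s :=
  (fromZeroRingHom (conicGrading M) _).comp (algebraMap R (conicGrading M 0))

theorem awayι_conicToSpec {s : ConicRing M} {n : ℕ} (hs : s ∈ conicGrading M n) (hn : 0 < n) :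
    Proj.awayι (conicGrading M) s hs hn ≫ conicToSpec M =
      Spec.map (CommRingCat.ofHom (conicAwayBase M s)) := by
  refine (Proj.awayι_toSpecZero_assoc (conicGrading M) s hs hn
    (Spec.map (CommRingCat.ofHom (algebraMap R (conicGrading M 0))))).trans ?_
  rw [← Spec.map_comp]
  rfl

theorem awayHomogenize_algebraMap {s : ConicRing M} (hs : s ∈ conicGrading M 1) (r : R) :
    awayHomogenize hs (algebraMap R _ r) = conicAwayBase M s r :=
  awayHomogenize_zero hs (algebraMap R (conicGrading M 0) r)

theorem awayEval_conicAwayBase {G : Type} [CommRing G] (β : ConicRing M →+* G) {s : ConicRing M}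
    {n : ℕ} (hs : s ∈ conicGrading M n) (hβ : IsUnit (β s)) (r : R) :
    awayEval (conicGrading M) β hβ (conicAwayBase M s r) = β (algebraMap R _ r) :=
  awayEval_fromZeroRingHom (conicGrading M) β hβ hs (algebraMap R (conicGrading M 0) r)

variable (φ : R →+* R') (T T' : Matrix (Fin 3) (Fin 3) R') {c : R'}

theorem map_conicAwayBase (h) {s : ConicRing M} (hs : s ∈ conicGrading M 1) (r : R) :
    Away.map (conicGradedHom (M := M) (M' := M') φ T h) s (conicAwayBase M s r) =
      conicAwayBase M' _ (φ r) := by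
  have hs' := GradedFunLike.map_mem (conicGradedHom (M := M) (M' := M') φ T h) hs
  have h0 : algebraMap R (ConicRing M) r ∈ conicGrading M (0 • 1) :=
    (algebraMap R (conicGrading M 0) r).2
  have h0' : algebraMap R' (ConicRing M') (φ r) ∈ conicGrading M' (0 • 1) :=
    (algebraMap R' (conicGrading M' 0) (φ r)).2
  rw [← awayHomogenize_algebraMap hs, ← awayHomogenize_algebraMap hs',
    awayHomogenize_of_mem hs 0 h0, awayHomogenize_of_mem hs' 0 h0', Away.map_mk]
  congr 1
  exact conicGradedHom_algebraMap φ T h r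

/-- Existence half of the universal property of a base-changed chart. As `s` has degree one, `α` is
determined by the values of the coordinates of `M`. Applying `T'` to these values gives admissible
coordinates for `M'`, because `T T' = 1` turns the form of `M'` back into a multiple of that of `M`.
-/
theorem exists_conicAway_desc (hT' : T * T' = 1)
    (hM : M' = c • (Tᵀ * M.map φ * T)) (h) {s : ConicRing M} (hs : s ∈ conicGrading M 1)
    {G : Type} [CommRing G] (γ : R' →+* G) (α : Away (conicGrading M) s →+* G)
    (hγα : γ.comp φ = α.comp (conicAwayBase M s)) :
    ∃ δ : Away (conicGrading M') (conicGradedHom (M := M) (M' := M') φ T h s) →+* G,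
      δ.comp (conicAwayBase M' _) = γ ∧ δ.comp (Away.map (conicGradedHom φ T h) s) = α := by
  set g := conicGradedHom (M := M) (M' := M') φ T h with hg
  have hs' : g s ∈ conicGrading M' 1 := GradedFunLike.map_mem g hs
  let ε : ConicRing M →+* G := α.comp (awayHomogenize hs)
  have hε : ε.comp (algebraMap R _) = γ.comp φ := by
    rw [hγα]
    ext r
    simp only [ε, RingHom.comp_apply, awayHomogenize_algebraMap]
  have hrel := conicHom_relation ε _ hε
  have hw : (T'.map γ *ᵥ (ε ∘ conicCoord M)) ⬝ᵥ M'.map γ *ᵥ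
    (T'.map γ *ᵥ (ε ∘ conicCoord M)) = 0 := by
    have h1 : (T'.map γ)ᵀ * M'.map γ * T'.map γ = γ c • M.map (γ.comp φ) := by
      rw [hM, Matrix.map_smul' _ _ _ (map_mul _), Matrix.mul_smul, Matrix.smul_mul,
        ← Matrix.transpose_map, ← Matrix.map_mul, ← Matrix.map_mul]
      congr 1
      rw [show T'ᵀ * (Tᵀ * M.map φ * T) * T' = (T * T')ᵀ * M.map φ * (T * T') by
        rw [Matrix.transpose_mul]; simp only [Matrix.mul_assoc], hT']
      simp only [transpose_one, Matrix.one_mul, Matrix.mul_one, Matrix.map_map]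
      rfl
    rw [dotProduct_mulVec_congr, h1, Matrix.smul_mulVec, dotProduct_smul, hrel, smul_zero]
  let δ₀ : ConicRing M' →+* G := conicLift M' γ _ hw
  have hδ₀ : δ₀.comp (g : ConicRing M →+* ConicRing M') = ε := by
    refine conicRing_hom_ext ?_ fun i ↦ ?_
    · rw [hε]
      ext r
      change δ₀ (g (algebraMap R _ r)) = γ (φ r)
      rw [hg, conicGradedHom_algebraMap]
      exact conicLift_algebraMap ..
    · change δ₀ (g (conicCoord M i)) = _
      rw [hg, conicGradedHom_coord]
      have h1 : δ₀ ((T.map (algebraMap R' (ConicRing M')) *ᵥ conicCoord M') i) =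
          (T.map γ *ᵥ (T'.map γ *ᵥ (ε ∘ conicCoord M))) i := by
        rw [Matrix.mulVec, dotProduct, map_sum, Matrix.mulVec, dotProduct]
        refine Finset.sum_congr rfl fun j _ ↦ ?_
        rw [map_mul, Matrix.map_apply, Matrix.map_apply]
        congr 1
        · exact conicLift_algebraMap ..
        · exact conicLift_coord ..
      rw [h1, Matrix.mulVec_mulVec, ← Matrix.map_mul, hT']
      simp
  -- Dehomogenization sends `s` to `1`, so the lifted map extends to fractions with denominators
  -- powers of `g s`.
  have hδs : δ₀ (g s) = 1 := by
    refine (RingHom.congr_fun hδ₀ s).trans ?_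
    simp only [ε, RingHom.comp_apply, awayHomogenize_self, map_one]
  have hu : IsUnit (δ₀ (g s)) := by rw [hδs]; exact isUnit_one
  refine ⟨awayEval (conicGrading M') δ₀ hu, ?_, ?_⟩
  · ext r
    rw [RingHom.comp_apply, awayEval_conicAwayBase δ₀ hs' hu]
    exact conicLift_algebraMap ..
  · rw [awayEval_comp_map (conicGrading M) (conicGrading M') g δ₀ hu hs]
    refine RingHom.cancel_right (awayHomogenize_surjective hs) |>.mp ?_
    refine RingHom.ext fun x ↦ ?_
    have hs1 : (δ₀.comp (g : ConicRing M →+* ConicRing M')) s = 1 := hδs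
    exact (awayEval_homogenize hs _ hs1 x).trans (RingHom.congr_fun hδ₀ x)

/-- Uniqueness half: since `T' T = 1`, the coordinates of `M'` are `R'`-linear combinations of the
images of the coordinates of `M`. -/
theorem conicAway_hom_ext (hT : T' * T = 1) (h) {s : ConicRing M} (hs : s ∈ conicGrading M 1)
    {G : Type} [CommRing G]
    {δ δ' : Away (conicGrading M') (conicGradedHom (M := M) (M' := M') φ T h s) →+* G}
    (h₁ : δ.comp (conicAwayBase M' _) = δ'.comp (conicAwayBase M' _))
    (h₂ : δ.comp (Away.map (conicGradedHom φ T h) s) =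
      δ'.comp (Away.map (conicGradedHom φ T h) s)) : δ = δ' := by
  have hs' : conicGradedHom (M := M) (M' := M') φ T h s ∈ conicGrading M' 1 :=
    GradedFunLike.map_mem (conicGradedHom φ T h) hs
  have hR : ∀ r, (δ.comp (awayHomogenize hs')) (algebraMap R' _ r) =
      (δ'.comp (awayHomogenize hs')) (algebraMap R' _ r) := fun r ↦ by
    rw [RingHom.comp_apply, RingHom.comp_apply, awayHomogenize_algebraMap]
    exact RingHom.congr_fun h₁ r
  have hcoord : ∀ j, (δ.comp (awayHomogenize hs')) (conicGradedHom φ T h (conicCoord M j)) =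
      (δ'.comp (awayHomogenize hs')) (conicGradedHom φ T h (conicCoord M j)) := fun j ↦ by
    have h0 : conicCoord M j ∈ conicGrading M (1 • 1) := conicCoord_mem M j
    have h0' : conicGradedHom (M := M) (M' := M') φ T h (conicCoord M j) ∈
        conicGrading M' (1 • 1) := GradedFunLike.map_mem (conicGradedHom φ T h) h0
    rw [RingHom.comp_apply, RingHom.comp_apply, awayHomogenize_of_mem hs' 1 h0',
      ← Away.map_mk (conicGradedHom φ T h) s hs 1 (conicCoord M j) h0]
    exact RingHom.congr_fun h₂ _
  refine RingHom.cancel_right (awayHomogenize_surjective hs') |>.mp ?_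
  refine conicRing_hom_ext (RingHom.ext hR) fun i ↦ ?_
  have := congrFun (mulVec_comp_conicGradedHom φ T T' hT h) i
  rw [← this, Matrix.mulVec, dotProduct, map_sum, map_sum]
  refine Finset.sum_congr rfl fun j _ ↦ ?_
  rw [map_mul, map_mul, Matrix.map_apply, hR]
  congr 1
  exact hcoord j

theorem isPushout_conicAway (hT : T' * T = 1) (hT' : T * T' = 1)
    (hM : M' = c • (Tᵀ * M.map φ * T)) (h) {s : ConicRing M} (hs : s ∈ conicGrading M 1) :
    IsPushout (CommRingCat.ofHom φ) (CommRingCat.ofHom (conicAwayBase M s))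
      (CommRingCat.ofHom (conicAwayBase M' (conicGradedHom (M := M) (M' := M') φ T h s)))
      (CommRingCat.ofHom (Away.map (conicGradedHom (M := M) (M' := M') φ T h) s)) := by
  have hw : (conicAwayBase M' (conicGradedHom (M := M) (M' := M') φ T h s)).comp φ =
      (Away.map (conicGradedHom (M := M) (M' := M') φ T h) s).comp (conicAwayBase M s) :=
    RingHom.ext fun r ↦ (map_conicAwayBase φ T h hs r).symm
  have hdesc (t : PushoutCocone (CommRingCat.ofHom φ) (CommRingCat.ofHom (conicAwayBase M s))) :=
    exists_conicAway_desc φ T T' hT' hM h hs t.inl.hom t.inr.hom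
      (congrArg CommRingCat.Hom.hom t.condition)
  refine ⟨⟨CommRingCat.hom_ext hw⟩, ⟨PushoutCocone.IsColimit.mk _
    (fun t ↦ CommRingCat.ofHom (hdesc t).choose)
    (fun t ↦ CommRingCat.hom_ext (hdesc t).choose_spec.1)
    (fun t ↦ CommRingCat.hom_ext (hdesc t).choose_spec.2) fun t m h₁ h₂ ↦ CommRingCat.hom_ext ?_⟩⟩
  exact conicAway_hom_ext φ T T' hT h hs
    ((congrArg CommRingCat.Hom.hom h₁).trans (hdesc t).choose_spec.1.symm)
    ((congrArg CommRingCat.Hom.hom h₂).trans (hdesc t).choose_spec.2.symm)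

end ConicBaseChange

/-- A square is a pullback if it is so over an open cover of one of the corners. -/
theorem isPullback_of_openCover_of_isPullback {W X Y Z : Scheme.{0}} (fWX : W ⟶ X) (fWY : W ⟶ Y)
    (fXZ : X ⟶ Z) (fYZ : Y ⟶ Z) (𝒰 : X.OpenCover) {V : 𝒰.I₀ → Scheme.{0}} (a : ∀ i, V i ⟶ W)
    (b : ∀ i, V i ⟶ 𝒰.X i) (h₁ : ∀ i, IsPullback (b i) (a i) (𝒰.f i) fWX)
    (h₂ : ∀ i, IsPullback (b i) (a i ≫ fWY) (𝒰.f i ≫ fXZ) fYZ) :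
    IsPullback fWX fWY fXZ fYZ := by
  refine Scheme.isPullback_of_openCover fWX fWY fXZ fYZ 𝒰 fun i ↦ ?_
  have h := (IsPullback.of_hasPullback fWX (𝒰.f i)).flip
  refine (h₂ i).of_iso ((h₁ i).isoIsPullback _ _ h) (Iso.refl _) (Iso.refl _) (Iso.refl _) ?_ ?_
    (by simp) (by simp)
  · simp only [Iso.refl_hom, Category.comp_id]
    exact ((h₁ i).isoIsPullback_hom_fst _ _ h).symm
  · simp only [Iso.refl_hom, Category.comp_id]
    exact (congrArg (· ≫ fWY) ((h₁ i).isoIsPullback_hom_snd _ _ h).symm).trans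
      (Category.assoc _ _ _)

open Matrix in
-- The graded map given by `T` induces a morphism on all of `Proj`, because invertibility of `T`
-- puts every coordinate of `M'` in the ideal generated by the images of the coordinates of `M`. The
-- pullback property is then checked on the charts where a coordinate of `M` is invertible; there it
-- is the pushout of rings just established. The unit `c` and the base change matter later, when the
-- adjugate conic is compared with its split form.
theorem exists_isPullback_conic {R R' : Type} [CommRing R] [CommRing R']
    {M : Matrix (Fin 3) (Fin 3) R} {M' : Matrix (Fin 3) (Fin 3) R'} (φ : R →+* R')
    (T T' : Matrix (Fin 3) (Fin 3) R') {c : R'} (hc : IsUnit c) (hT : T' * T = 1) (hT' : T * T' = 1)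
    (hM : M' = c • (T.transpose * M.map φ * T)) :
    ∃ k : conic M' ⟶ conic M,
      IsPullback k (conicToSpec M') (conicToSpec M) (Spec.map (CommRingCat.ofHom φ)) := by
  have h := conicGradedHom_relation φ T hc hM
  let g := conicGradedHom (M := M) (M' := M') φ T h
  have hirr : HomogeneousIdeal.irrelevant (conicGrading M') ≤
      (HomogeneousIdeal.irrelevant (conicGrading M)).map g := by
    refine toIdeal_le_toIdeal_iff.1 <|
      (irrelevant_le_span_conicCoord M').trans (Ideal.span_le.mpr ?_)
    rintro _ ⟨i, rfl⟩
    have h1 := congrFun (mulVec_comp_conicGradedHom φ T T' hT h) i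
    rw [← h1, Matrix.mulVec, dotProduct]
    refine Ideal.sum_mem _ fun j _ ↦ Ideal.mul_mem_left _ _ (Ideal.mem_map_of_mem g ?_)
    exact HomogeneousIdeal.mem_irrelevant_of_mem _ zero_lt_one (conicCoord_mem M j)
  refine ⟨Proj.map g hirr, ?_⟩
  refine isPullback_of_openCover_of_isPullback _ _ _ _
    (Proj.affineOpenCoverOfIrrelevantLESpan (conicGrading M) (conicCoord M) (conicCoord_mem M)
      (fun _ ↦ zero_lt_one) (irrelevant_le_span_conicCoord M)).openCover
    (V := fun i ↦ Spec (.of (HomogeneousLocalization.Away (conicGrading M') (g (conicCoord M i)))))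
    (fun i ↦ Proj.awayι (conicGrading M') (g (conicCoord M i))
      (GradedFunLike.map_mem g (conicCoord_mem M i)) zero_lt_one)
    (fun i ↦ Spec.map (CommRingCat.ofHom (HomogeneousLocalization.Away.map g (conicCoord M i))))
    (fun i ↦ ?_) fun i ↦ ?_
  · have : IsOpenImmersion (Proj.awayι (conicGrading M') (g (conicCoord M i))
      (GradedFunLike.map_mem g (conicCoord_mem M i)) zero_lt_one) := inferInstance
    refine IsOpenImmersion.isPullback (X := Proj (conicGrading M'))
      (Y := Proj (conicGrading M)) _ _ _ _
      (Proj.awayι_comp_map g hirr zero_lt_one _ (conicCoord_mem M i)) ?_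
    refine (congrArg _ (Proj.opensRange_awayι _ _ _ _)).trans
      ((Proj.map_preimage_basicOpen g hirr (conicCoord M i)).trans ?_)
    exact (Proj.opensRange_awayι _ _ _ _).symm
  · have h1 := isPullback_SpecMap_of_isPushout _ _ _ _
      (isPushout_conicAway φ T T' hT hT' hM h (conicCoord_mem M i))
    refine h1.flip.of_iso (Iso.refl _) (Iso.refl _) (Iso.refl _) (Iso.refl _) ?_ ?_ ?_ ?_
    · exact (Category.comp_id _).trans (Category.id_comp _).symm
    · refine (Category.comp_id _).trans (Eq.trans ?_ (Category.id_comp _).symm)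
      exact (awayι_conicToSpec _ _).symm
    · refine (Category.comp_id _).trans (Eq.trans ?_ (Category.id_comp _).symm)
      exact (awayι_conicToSpec _ _).symm
    · exact (Category.comp_id _).trans (Category.id_comp _).symm

end

section

attribute [local instance] MvPolynomial.gradedAlgebra

/-! ### Morphisms to `Proj` -/

section MapsToProj

open HomogeneousLocalization

variable {R A G H : Type} [CommRing R] [CommRing A] [Algebra R A] (𝒜 : ℕ → Submodule R A)
  [GradedAlgebra 𝒜] [CommRing G] [CommRing H]

/-- The morphism `Spec G ⟶ Proj 𝒜` attached to a ring homomorphism for which a form of degree one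
becomes invertible. -/
def specToProj (β : A →+* G) {f : A} (hd : f ∈ 𝒜 1) (hf : IsUnit (β f)) :
    Spec (.of G) ⟶ Proj 𝒜 :=
  Spec.map (CommRingCat.ofHom (awayEval 𝒜 β hf)) ≫ Proj.awayι 𝒜 f hd zero_lt_one

variable {𝒜}

theorem specMap_specToProj (γ : G →+* H) (β : A →+* G) {f : A} (hd : f ∈ 𝒜 1) (hf : IsUnit (β f)) :
    Spec.map (CommRingCat.ofHom γ) ≫ specToProj 𝒜 β hd hf =
      specToProj 𝒜 (γ.comp β) hd (hf.map γ) := by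
  rw [specToProj, specToProj, ← Category.assoc, ← Spec.map_comp, ← CommRingCat.ofHom_comp,
    comp_awayEval 𝒜 β hf γ hd]

theorem specToProj_congr {β : A →+* G} {f g : A} (hd : f ∈ 𝒜 1) (he : g ∈ 𝒜 1)
    (hf : IsUnit (β f)) (hg : IsUnit (β g)) :
    specToProj 𝒜 β hd hf = specToProj 𝒜 β he hg := by
  have hfg : IsUnit (β (f * g)) := by rw [map_mul]; exact hf.mul hg
  rw [specToProj, specToProj, ← awayEval_comp_awayMap 𝒜 β rfl hfg hf hd he,
    ← awayEval_comp_awayMap 𝒜 β (mul_comm f g) hfg hg he hd, CommRingCat.ofHom_comp,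
    CommRingCat.ofHom_comp, Spec.map_comp, Spec.map_comp, Category.assoc, Category.assoc,
    Proj.SpecMap_awayMap_awayι, Proj.SpecMap_awayMap_awayι]

theorem specToProj_congr_of_smul {β γ : A →+* G} {f : A} (hd : f ∈ 𝒜 1) (hβ : IsUnit (β f))
    (hγ : IsUnit (γ f)) (u : G) (h : ∀ n, ∀ a ∈ 𝒜 n, γ a = u ^ n * β a) :
    specToProj 𝒜 β hd hβ = specToProj 𝒜 γ hd hγ := by
  rw [specToProj, specToProj, awayEval_congr_of_smul 𝒜 hd hβ hγ u h]

theorem specToProj_preimage_basicOpen (β : A →+* G) {f g : A} (hd : f ∈ 𝒜 1) (he : g ∈ 𝒜 1)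
    (hf : IsUnit (β f)) :
    specToProj 𝒜 β hd hf ⁻¹ᵁ Proj.basicOpen 𝒜 g = PrimeSpectrum.basicOpen (β g) := by
  rw [specToProj, Scheme.Hom.comp_preimage, Proj.awayι_preimage_basicOpen 𝒜 hd zero_lt_one he
    zero_lt_one, SpecMap_preimage_basicOpen]
  have : IsUnit (β f) := hf
  have h : awayEval 𝒜 β hf (Away.isLocalizationElem hd he) * β f ^ 1 = β (g ^ 1) :=
    awayEval_mk_mul 𝒜 β hf hd 1 _
  rw [pow_one, pow_one] at h
  rw [← h]
  ext x
  exact (PrimeSpectrum.mem_basicOpen _ _).trans (((x.asIdeal.mul_unit_mem_iff_mem hf).not).symm)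

end MapsToProj

/-- Morphisms on the members of an open cover which agree on the intersections can be glued. -/
theorem exists_glue_opens {ι : Type} {P Y : Scheme.{0}} (V : ι → P.Opens) (hV : ⨆ i, V i = ⊤)
    (ψ : ∀ i, (V i : Scheme.{0}) ⟶ Y)
    (h : ∀ i j, P.homOfLE inf_le_left ≫ ψ i =
      P.homOfLE (V := V j) (U := V i ⊓ V j) inf_le_right ≫ ψ j) :
    ∃ φ : P ⟶ Y, ∀ i, (V i).ι ≫ φ = ψ i := by
  let 𝒰 := P.openCoverOfIsOpenCover V hV
  have h' : ∀ i j, pullback.fst (𝒰.f i) (𝒰.f j) ≫ ψ i = pullback.snd (𝒰.f i) (𝒰.f j) ≫ ψ j := by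
    intro i j
    have hp := isPullback_opens_inf (V i) (V j)
    have h₁ : hp.isoPullback.hom ≫ pullback.fst (𝒰.f i) (𝒰.f j) = P.homOfLE inf_le_left :=
      hp.isoPullback_hom_fst
    have h₂ : hp.isoPullback.hom ≫ pullback.snd (𝒰.f i) (𝒰.f j) = P.homOfLE inf_le_right :=
      hp.isoPullback_hom_snd
    refine (cancel_epi hp.isoPullback.hom).mp ?_
    refine (Category.assoc _ _ _).symm.trans (Eq.trans ?_ (Category.assoc _ _ _))
    exact (congrArg (· ≫ ψ i) h₁).trans ((h i j).trans (congrArg (· ≫ ψ j) h₂).symm)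
  exact ⟨𝒰.glueMorphisms ψ h', fun i ↦ 𝒰.ι_glueMorphisms ψ h' i⟩

section GlueToProj

variable {R A : Type} [CommRing R] [CommRing A] [Algebra R A] {𝒜 : ℕ → Submodule R A}
  [GradedAlgebra 𝒜]

/-- A morphism to `Proj` given by local values of the homogeneous coordinates. -/
theorem exists_hom_to_proj {ι : Type} {P : Scheme.{0}} (V : ι → P.Opens) (hV : ⨆ i, V i = ⊤)
    (f : ι → A) (hf : ∀ i, f i ∈ 𝒜 1) (β : ∀ i, A →+* Γ(P, V i)) (hβ : ∀ i, IsUnit (β i (f i)))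
    (u : ∀ i j, Γ(P, V i ⊓ V j)) (hu : ∀ i j, IsUnit (u i j))
    (h : ∀ i j n, ∀ a ∈ 𝒜 n, P.presheaf.map (homOfLE inf_le_left).op (β i a) =
      u i j ^ n * P.presheaf.map (homOfLE inf_le_right).op (β j a)) :
    ∃ ψ : P ⟶ Proj 𝒜,
      (∀ i, (V i).ι ≫ ψ = (V i).toSpecΓ ≫ specToProj 𝒜 (β i) (hf i) (hβ i)) ∧
      ∀ i j, V i ⊓ ψ ⁻¹ᵁ Proj.basicOpen 𝒜 (f j) = P.basicOpen (β i (f j)) := by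
  obtain ⟨ψ, hψ⟩ := exists_glue_opens V hV
    (fun i ↦ (V i).toSpecΓ ≫ specToProj 𝒜 (β i) (hf i) (hβ i)) (by
    intro i j
    rw [← Scheme.Opens.toSpecΓ_SpecMap_presheaf_map_assoc,
      ← Scheme.Opens.toSpecΓ_SpecMap_presheaf_map_assoc]
    congr 1
    have e₁ := specMap_specToProj
      (P.presheaf.map (homOfLE (inf_le_left (a := V i) (b := V j))).op).hom
      (β i) (hf i) (hβ i)
    have e₂ := specMap_specToProj
      (P.presheaf.map (homOfLE (inf_le_right (a := V i) (b := V j))).op).hom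
      (β j) (hf j) (hβ j)
    have hj := (hβ j).map (P.presheaf.map (homOfLE (inf_le_right (a := V i) (b := V j))).op).hom
    have hij : IsUnit (((P.presheaf.map (homOfLE (inf_le_left (a := V i) (b := V j))).op).hom.comp
        (β i)) (f j)) := by
      have := h i j 1 (f j) (hf j)
      refine this ▸ ((hu i j).pow 1).mul hj
    refine e₁.trans (Eq.trans ?_ e₂.symm)
    refine (specToProj_congr (hf i) (hf j) _ hij).trans ?_
    exact (specToProj_congr_of_smul (hf j) _ _ (u i j) (h i j)).symm)
  refine ⟨ψ, hψ, fun i j ↦ ?_⟩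
  have h1 : (V i).ι ⁻¹ᵁ (ψ ⁻¹ᵁ Proj.basicOpen 𝒜 (f j)) = (V i).ι ⁻¹ᵁ P.basicOpen (β i (f j)) := by
    rw [← Scheme.Hom.comp_preimage, hψ, Scheme.Hom.comp_preimage,
      specToProj_preimage_basicOpen _ _ (hf j)]
    exact (V i).toSpecΓ_preimage_basicOpen _
  have h2 := congrArg (fun W ↦ (V i).ι ''ᵁ W) h1
  simp only [Scheme.Hom.image_preimage_eq_opensRange_inf, Scheme.Opens.opensRange_ι] at h2
  rw [h2]
  exact inf_eq_right.mpr (P.basicOpen_le _)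

end GlueToProj

/-! ### Recognizing the projective line -/

section ProjectiveLine

open HomogeneousLocalization

variable {G : Type} [CommRing G]

theorem map_eq_pow_mul_of_isHomogeneous {ι : Type} {β γ : MvPolynomial ι ℤ →+* G} {u : G}
    (h : ∀ k, β (.X k) = u * γ (.X k)) {n : ℕ} {a : MvPolynomial ι ℤ} (ha : a.IsHomogeneous n) :
    β a = u ^ n * γ a := by
  rw [a.as_sum, map_sum, map_sum, Finset.mul_sum]
  refine Finset.sum_congr rfl fun m hm ↦ ?_
  have hdeg := ha (MvPolynomial.mem_support_iff.mp hm)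
  rw [MvPolynomial.monomial_eq, map_mul, map_mul, Finsupp.prod, map_prod, map_prod]
  simp only [map_pow, h, mul_pow, Finset.prod_mul_distrib, Finset.prod_pow_eq_pow_sum]
  have : ∑ i ∈ m.support, m i = n := by
    rw [← hdeg, Finsupp.weight_apply]
    simp [Finsupp.sum]
  rw [this, show β (MvPolynomial.C (a.coeff m)) = γ (MvPolynomial.C (a.coeff m)) from
    RingHom.congr_fun (RingHom.ext_int (β.comp MvPolynomial.C) (γ.comp MvPolynomial.C)) _]
  ring

/-- The ring homomorphism `ℤ[X₀, X₁] →+* G` with `X i ↦ 1` and with value `t` at the other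
coordinate. -/
def lineEval (i : Fin 2) (t : G) : MvPolynomial (Fin 2) ℤ →+* G :=
  MvPolynomial.eval₂Hom (Int.castRingHom G) (fun k ↦ if k = i then 1 else t)

theorem lineEval_X_self (i : Fin 2) (t : G) : lineEval i t (.X i) = 1 := by
  simp [lineEval]

theorem lineEval_X_of_ne {i k : Fin 2} (h : k ≠ i) (t : G) : lineEval i t (.X k) = t := by
  simp [lineEval, h]

theorem isUnit_lineEval (i : Fin 2) (t : G) : IsUnit (lineEval i t (.X i)) := by
  rw [lineEval_X_self]
  exact isUnit_one

theorem X_mem_homogeneousSubmodule (i : Fin 2) :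
    (MvPolynomial.X i : MvPolynomial (Fin 2) ℤ) ∈ MvPolynomial.homogeneousSubmodule (Fin 2) ℤ 1 :=
  MvPolynomial.isHomogeneous_X ℤ i

/-- Two ring homomorphisms out of `ℤ[X₀, X₁]_(X i)` agree if they agree on the coordinate. -/
theorem away_hom_ext (i : Fin 2)
    {α α' : Away (MvPolynomial.homogeneousSubmodule (Fin 2) ℤ) (MvPolynomial.X i) →+* G}
    (h : ∀ k ≠ i, α (awayHomogenize (𝒜 := MvPolynomial.homogeneousSubmodule (Fin 2) ℤ)
      (X_mem_homogeneousSubmodule i) (MvPolynomial.X k)) = α' (awayHomogenize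
        (𝒜 := MvPolynomial.homogeneousSubmodule (Fin 2) ℤ) (X_mem_homogeneousSubmodule i)
          (MvPolynomial.X k))) : α = α' := by
  refine RingHom.cancel_right
    (awayHomogenize_surjective (𝒜 := MvPolynomial.homogeneousSubmodule (Fin 2) ℤ)
      (X_mem_homogeneousSubmodule i)) |>.mp ?_
  refine MvPolynomial.ringHom_ext (fun n ↦ ?_) fun k ↦ ?_
  · have hC (γ : MvPolynomial (Fin 2) ℤ →+* G) : γ (MvPolynomial.C n) = n :=
      eq_intCast (γ.comp MvPolynomial.C) n
    exact (hC (α.comp _)).trans (hC (α'.comp _)).symm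
  · by_cases hk : k = i
    · subst hk
      rw [RingHom.comp_apply, RingHom.comp_apply, awayHomogenize_self, map_one, map_one]
    · exact h k hk

/-- The ring of the standard chart `X i ≠ 0` of the integral line is a polynomial ring in the other
coordinate, and polynomial rings commute with base change. The isomorphism `e` permits an abstract
copy `G` of `R[X]`, such as a ring of sections. -/
theorem isPushout_lineEval {R : Type} [CommRing R] (i : Fin 2) (e : Polynomial R ≃+* G) :
    IsPushout (CommRingCat.ofHom (Int.castRingHom R))
      (CommRingCat.ofHom (Int.castRingHom
        (Away (MvPolynomial.homogeneousSubmodule (Fin 2) ℤ) (MvPolynomial.X i))))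
      (CommRingCat.ofHom ((e : Polynomial R →+* G).comp Polynomial.C))
      (CommRingCat.ofHom (awayEval (MvPolynomial.homogeneousSubmodule (Fin 2) ℤ)
        (lineEval i (e .X)) (isUnit_lineEval i _))) := by
  obtain ⟨k, hk⟩ : ∃ k : Fin 2, k ≠ i := exists_ne i
  have hk' : ∀ j : Fin 2, j ≠ i → j = k := by omega
  have hX := X_mem_homogeneousSubmodule i
  have heval : awayEval (MvPolynomial.homogeneousSubmodule (Fin 2) ℤ)
      (lineEval i (e .X)) (isUnit_lineEval i _) (awayHomogenize hX (MvPolynomial.X k)) = e .X := by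
    rw [awayEval_homogenize hX _ (lineEval_X_self i _), lineEval_X_of_ne hk]
  let desc (t : PushoutCocone (CommRingCat.ofHom (Int.castRingHom R)) (CommRingCat.ofHom
      (Int.castRingHom (Away (MvPolynomial.homogeneousSubmodule (Fin 2) ℤ) (MvPolynomial.X i))))) :
      G →+* t.pt :=
    (Polynomial.eval₂RingHom t.inl.hom (t.inr.hom (awayHomogenize hX (MvPolynomial.X k)))).comp
      (e.symm : G →+* Polynomial R)
  refine ⟨⟨CommRingCat.hom_ext (RingHom.ext_int _ _)⟩, ⟨PushoutCocone.IsColimit.mk _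
    (fun t ↦ CommRingCat.ofHom (desc t)) (fun t ↦ CommRingCat.hom_ext (RingHom.ext fun r ↦ ?_))
    (fun t ↦ CommRingCat.hom_ext (away_hom_ext i fun j hj ↦ ?_)) fun t m h₁ h₂ ↦
      CommRingCat.hom_ext ?_⟩⟩
  · change desc t (e (Polynomial.C r)) = _
    simp [desc]
  · obtain rfl := hk' j hj
    change desc t (awayEval _ _ _ _) = _
    rw [heval]
    simp [desc]
  · have hsurj : Function.Surjective (e : Polynomial R →+* G) := e.surjective
    refine RingHom.cancel_right hsurj |>.mp (Polynomial.ringHom_ext (fun r ↦ ?_) ?_)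
    · change m.hom (e (Polynomial.C r)) = desc t (e (Polynomial.C r))
      simp only [desc, RingHom.comp_apply, RingHom.coe_coe, RingEquiv.symm_apply_apply,
        Polynomial.coe_eval₂RingHom, Polynomial.eval₂_C]
      exact ConcreteCategory.congr_hom h₁ r
    · change m.hom (e Polynomial.X) = desc t (e Polynomial.X)
      simp only [desc, RingHom.comp_apply, RingHom.coe_coe, RingEquiv.symm_apply_apply,
        Polynomial.coe_eval₂RingHom, Polynomial.eval₂_X]
      rw [← heval]
      exact ConcreteCategory.congr_hom h₂ _

theorem irrelevant_le_span_X :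
    (HomogeneousIdeal.irrelevant (MvPolynomial.homogeneousSubmodule (Fin 2) ℤ)).toIdeal ≤
      Ideal.span (Set.range (MvPolynomial.X : Fin 2 → MvPolynomial (Fin 2) ℤ)) :=
  (HomogeneousIdeal.toIdeal_irrelevant_le _).mpr fun _ hi _ hx ↦
    mem_span_X_of_isHomogeneous hx hi

/-- A scheme glued from two affine lines along `t ↦ 1 / t` is a projective line. -/
theorem exists_isPullback_projectiveLineToBase {R : Type} [CommRing R] {P : Scheme.{0}}
    (π : P ⟶ Spec (.of R)) (V : Fin 2 → P.Opens) (hV : ∀ i, IsAffineOpen (V i))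
    (hcov : ⨆ i, V i = ⊤) (e : ∀ i, Polynomial R ≃+* Γ(P, V i))
    (he : ∀ i, (V i).toSpecΓ ≫ Spec.map (CommRingCat.ofHom
      ((e i : Polynomial R →+* Γ(P, V i)).comp Polynomial.C)) = (V i).ι ≫ π)
    (hb : ∀ i j, i ≠ j → P.basicOpen (e i .X) = V i ⊓ V j)
    (hmul : ∀ i j, i ≠ j → P.presheaf.map (homOfLE (inf_le_left (b := V j))).op (e i .X) *
      P.presheaf.map (homOfLE (inf_le_right (a := V i))).op (e j .X) = 1) :
    ∃ h : projectiveLine (Spec (.of R)) ⟶ P,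
      IsPullback h (projectiveLineToBase (Spec (.of R))) π (𝟙 _) := by
  let 𝒜 := MvPolynomial.homogeneousSubmodule (Fin 2) ℤ
  let β (i) : MvPolynomial (Fin 2) ℤ →+* Γ(P, V i) := lineEval i (e i .X)
  have hf (i : Fin 2) : (MvPolynomial.X i : MvPolynomial (Fin 2) ℤ) ∈ 𝒜 1 :=
    X_mem_homogeneousSubmodule i
  obtain ⟨ψ, hψ, hψ'⟩ := exists_hom_to_proj (𝒜 := 𝒜) V hcov (fun i ↦ .X i) hf β
    (fun i ↦ isUnit_lineEval i _)
    -- The factor relating the coordinates on chart `i` to those on chart `j` is `X j / X i`: it is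
    -- `1` for `i = j`, and otherwise the parameter of chart `i`, a unit on the overlap by `hmul`.
    (fun i j ↦ P.presheaf.map (homOfLE (inf_le_left (b := V j))).op (β i (MvPolynomial.X j)))
    (fun i j ↦ by
      by_cases hij : i = j
      · subst hij
        simp only [β, lineEval_X_self, map_one, isUnit_one]
      · simp only [β, lineEval_X_of_ne (Ne.symm hij)]
        exact IsUnit.of_mul_eq_one _ (hmul i j hij))
    (fun i j n a ha ↦ by
      refine map_eq_pow_mul_of_isHomogeneous
        (β := (P.presheaf.map (homOfLE (inf_le_left (b := V j))).op).hom.comp (β i))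
        (γ := (P.presheaf.map (homOfLE (inf_le_right (a := V i))).op).hom.comp (β j))
        (fun k ↦ ?_) ha
      change P.presheaf.map _ (β i (MvPolynomial.X k)) = P.presheaf.map _ (β i (MvPolynomial.X j)) *
        P.presheaf.map _ (β j (MvPolynomial.X k))
      by_cases hij : i = j
      · subst hij
        simp only [β, lineEval_X_self, map_one, one_mul]
      · by_cases hk : k = j
        · subst hk
          simp only [β, lineEval_X_self, map_one, mul_one]
        · obtain rfl : k = i := by omega
          simp only [β, lineEval_X_self, lineEval_X_of_ne (Ne.symm hij), lineEval_X_of_ne hij,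
            map_one]
          exact (hmul k j hij).symm)
  -- The other chart contributes no further points: there `X i` is the parameter, and `hb` says that
  -- the parameter is invertible exactly on the overlap.
  have hpre (i : Fin 2) : ψ ⁻¹ᵁ Proj.basicOpen 𝒜 (MvPolynomial.X i) = V i := by
    have h1 : ψ ⁻¹ᵁ Proj.basicOpen 𝒜 (MvPolynomial.X i) =
      ⨆ j, V j ⊓ ψ ⁻¹ᵁ Proj.basicOpen 𝒜 (MvPolynomial.X i) := by
      rw [← iSup_inf_eq, hcov, top_inf_eq]
    rw [h1]
    refine le_antisymm (iSup_le fun j ↦ ?_) ?_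
    · rw [hψ']
      by_cases hij : j = i
      · subst hij
        exact P.basicOpen_le _
      · simp only [β, lineEval_X_of_ne (Ne.symm hij), hb j i hij]
        exact inf_le_right
    · refine le_trans ?_ (le_iSup _ i)
      rw [hψ']
      simp only [β, lineEval_X_self]
      exact (P.basicOpen_of_isUnit isUnit_one).ge
  have hpb : IsPullback ψ π (terminal.from projectiveLineInt) (terminal.from (Spec (.of R))) := by
    refine isPullback_of_openCover_of_isPullback _ _ _ _
      (Proj.affineOpenCoverOfIrrelevantLESpan 𝒜 _ hf
        (fun _ ↦ zero_lt_one) irrelevant_le_span_X).openCover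
      (V := fun i ↦ (V i : Scheme.{0}))
      (fun i ↦ (V i).ι)
      (fun i ↦ (V i).toSpecΓ ≫ Spec.map (CommRingCat.ofHom (awayEval 𝒜 (β i)
        (isUnit_lineEval i _)))) (fun i ↦ ?_) fun i ↦ ?_
    · refine IsOpenImmersion.isPullback (Y := Proj 𝒜) _ _ _ _ ((hψ i).trans ?_) ?_
      · exact (Category.assoc _ _ _).symm
      · refine (congrArg _ (Proj.opensRange_awayι _ _ _ _)).trans ((hpre i).trans ?_)
        exact (V i).opensRange_ι.symm
    · have h1 := isPullback_SpecMap_of_isPushout _ _ _ _ (isPushout_lineEval i (e i))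
      have : IsIso (V i).toSpecΓ := (hV i).isoSpec.isIso_hom
      refine h1.flip.of_iso (asIso (V i).toSpecΓ).symm (Iso.refl _) (Iso.refl _)
        (terminalIsoIsTerminal specZIsTerminal).symm ?_ ?_ ?_ ?_
      · simp [β]; rfl
      · rw [← he i]
        simp
      · exact terminal.hom_ext _ _
      · exact terminal.hom_ext _ _
  let ε : projectiveLine (Spec (.of R)) ≅ P := hpb.flip.isoPullback.symm
  refine ⟨ε.hom, IsPullback.of_horiz_isIso ⟨?_⟩⟩
  rw [Category.comp_id]
  exact hpb.flip.isoPullback_inv_fst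

end ProjectiveLine

end

/-! ### Normalization in the generic fibre -/

section GenericFibre

theorem isLocalization_of_isPushout {R S K E : CommRingCat.{0}} {f : R ⟶ S} {g : R ⟶ K} {i : S ⟶ E}
    {j : K ⟶ E} (h : IsPushout f g i j) (T : Submonoid R)
    (hg : let := g.hom.toAlgebra; IsLocalization T K) :
    let := i.hom.toAlgebra; IsLocalization (T.map f.hom) E := by
  let := g.hom.toAlgebra
  let := f.hom.toAlgebra
  let := i.hom.toAlgebra
  let := j.hom.toAlgebra
  let := (i.hom.comp f.hom).toAlgebra
  have : IsScalarTower R S E := .of_algebraMap_eq' rfl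
  have : IsScalarTower R K E := .of_algebraMap_eq' (congrArg CommRingCat.Hom.hom h.w)
  have hp : Algebra.IsPushout R S K E := CommRingCat.isPushout_iff_isPushout.mp h
  exact (Algebra.isLocalization_iff_isPushout T K).mpr hp

variable (X : Scheme.{0}) [IsIntegral X]

instance flat_genericInclusion : Flat (genericInclusion X) := by
  obtain ⟨U, hU, hx, -⟩ := exists_isAffineOpen_mem_and_subset (x := genericPoint X) (U := ⊤) trivial
  have : Nonempty U := ⟨⟨_, hx⟩⟩
  have hfr := functionField_isFractionRing_of_isAffineOpen X U hU
  have : Module.Flat Γ(X, U) X.functionField := IsLocalization.flat _ (nonZeroDivisors Γ(X, U))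
  rw [genericInclusion, ← hU.fromSpecStalk_eq_fromSpecStalk hx, IsAffineOpen.fromSpecStalk]
  have : Flat (Spec.map (X.presheaf.germ U (genericPoint X) hx)) :=
    (HasRingHomProperty.Spec_iff (P := @Flat)).mpr
      (show (algebraMap Γ(X, U) X.functionField).Flat from RingHom.flat_algebraMap_iff.mpr this)
  infer_instance

variable {X}

theorem genericInclusion_mem (W : X.Opens) [h : Nonempty W] : genericPoint X ∈ W :=
  ((genericPoint_spec X).mem_open_set_iff W.isOpen).mpr (by simpa using h)

theorem genericInclusion_preimage (W : X.Opens) [h : Nonempty W] :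
    genericInclusion X ⁻¹ᵁ W = ⊤ := by
  rw [eq_top_iff]
  rintro x -
  have hx : x = IsLocalRing.closedPoint X.functionField :=
    Subsingleton.elim (α := PrimeSpectrum X.functionField) _ _
  subst hx
  change X.fromSpecStalk (genericPoint X) _ ∈ W
  rw [Scheme.fromSpecStalk_closedPoint]
  exact genericInclusion_mem W

theorem genericInclusion_appLE (W : X.Opens) [h : Nonempty W] :
    (genericInclusion X).appLE W ⊤ (genericInclusion_preimage W).ge =
      X.germToFunctionField W ≫ (Scheme.ΓSpecIso X.functionField).inv := by
  refine (congrArg (· ≫ _) (Scheme.fromSpecStalk_app (genericInclusion_mem W))).trans ?_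
  refine (Category.assoc _ _ _).trans (congrArg (X.germToFunctionField W ≫ ·) ?_)
  refine (Category.assoc _ _ _).trans ?_
  refine (congrArg (_ ≫ ·) ((Spec X.functionField).presheaf.map_comp _ _).symm).trans ?_
  refine (congrArg (_ ≫ ·) ((Spec X.functionField).presheaf.map_id _)).trans ?_
  exact Category.comp_id _

variable {X' : Scheme.{0}} (k : X' ⟶ X)

/-- The structure map from the function field to the sections of the generic fibre. -/
def genericFibreStructure (V : X'.Opens) :
    X.functionField ⟶
      Γ(pullback (genericInclusion X) k, pullback.snd (genericInclusion X) k ⁻¹ᵁ V) :=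
  (Scheme.ΓSpecIso X.functionField).inv ≫ (pullback.fst (genericInclusion X) k).appLE ⊤ _
    (show _ ≤ pullback.fst (genericInclusion X) k ⁻¹ᵁ ⊤ from le_top)

/-- Flat base change for sections along the generic inclusion. `V` is only required to be compact
and quasi-separated, since it will be an intersection of an affine open with the preimage of
another. -/
theorem isPushout_genericFibre (W : X.Opens) [Nonempty W] (hW : IsAffineOpen W) (V : X'.Opens)
    (hV : IsCompact (V : Set X')) (hV' : IsQuasiSeparated (V : Set X')) (hVW : V ≤ k ⁻¹ᵁ W) :
    IsPushout (k.appLE W V hVW) (X.germToFunctionField W)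
      ((pullback.snd (genericInclusion X) k).app V) (genericFibreStructure k V) := by
  have h := (isIso_pushoutSection_iff
    (IsPullback.of_hasPullback (genericInclusion X) k).flip (US := W) (UT := ⊤) (UX := V)
    (genericInclusion_preimage W).ge hVW
    (UY := pullback.snd (genericInclusion X) k ⁻¹ᵁ V) (by simp)).mp
    (isIso_pushoutSection_of_isQuasiSeparated_of_flat_right _ _ _ _ hW (isAffineOpen_top _) hV hV')
  refine h.of_iso (Iso.refl _) (Iso.refl _) (Scheme.ΓSpecIso X.functionField) (Iso.refl _)
    (by simp) ?_ ?_ ?_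
  · rw [genericInclusion_appLE]
    simp
  · simp [Scheme.Hom.app_eq_appLE]
  · simp [genericFibreStructure]

theorem appLE_genericFibre (W : X.Opens) [Nonempty W] (V : X'.Opens) (hVW : V ≤ k ⁻¹ᵁ W) :
    k.appLE W V hVW ≫ (pullback.snd (genericInclusion X) k).app V =
      X.germToFunctionField W ≫ genericFibreStructure k V := by
  rw [genericFibreStructure, ← Category.assoc, ← genericInclusion_appLE,
    Scheme.Hom.app_eq_appLE, Scheme.Hom.appLE_comp_appLE, Scheme.Hom.appLE_comp_appLE]
  simp only [pullback.condition]

theorem isUnit_genericFibre (W : X.Opens) [Nonempty W] (V : X'.Opens) (hVW : V ≤ k ⁻¹ᵁ W)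
    {r : Γ(X, W)} (hr : r ≠ 0) :
    IsUnit ((pullback.snd (genericInclusion X) k).app V (k.appLE W V hVW r)) := by
  have h := ConcreteCategory.congr_hom (appLE_genericFibre k W V hVW) r
  have hu : IsUnit (X.germToFunctionField W r) :=
    isUnit_iff_ne_zero.mpr fun h0 ↦ hr
      (X.germToFunctionField_injective W (h0.trans (map_zero _).symm))
  exact h ▸ hu.map (genericFibreStructure k V).hom

/-- A nonzero function on an integral scheme is a regular element, and flatness preserves regular
elements; on a nonempty affine open a regular element is not zero. -/
theorem appLE_ne_zero [IsIntegral X'] [Flat k] {W : X.Opens} (hW : IsAffineOpen W) {V : X'.Opens}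
    [hne : Nonempty V] (hVW : V ≤ k ⁻¹ᵁ W) {r : Γ(X, W)} (hr : r ≠ 0) : k.appLE W V hVW r ≠ 0 := by
  obtain ⟨⟨v, hv⟩⟩ := hne
  have : Nonempty W := ⟨⟨_, hVW hv⟩⟩
  obtain ⟨V₀, hV₀, hv₀, hle⟩ := exists_isAffineOpen_mem_and_subset (x := v) (U := V) hv
  have : Nonempty V₀ := ⟨⟨_, hv₀⟩⟩
  intro h0
  have hfl := k.flat_appLE hW hV₀ (hle.trans hVW)
  have h1 : k.appLE W V₀ (hle.trans hVW) r = 0 := by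
    have := ConcreteCategory.congr_hom (k.appLE_map (V := V) hVW (homOfLE hle).op) r
    rw [← this]
    exact (congrArg _ h0).trans (map_zero (X'.presheaf.map (homOfLE hle).op).hom)
  algebraize [(k.appLE W V₀ (hle.trans hVW)).hom]
  have : Module.Flat Γ(X, W) Γ(X', V₀) := hfl
  have hreg : IsSMulRegular Γ(X', V₀) r :=
    (IsSMulRegular.of_ne_zero hr : IsSMulRegular Γ(X, W) r).of_flat
  have h2 : r • (1 : Γ(X', V₀)) = r • 0 := by
    rw [Algebra.smul_def, smul_zero, mul_one]
    exact h1
  exact one_ne_zero (hreg h2)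

theorem genericFibre_preimage_eq (W : X.Opens) [Nonempty W] (V : X'.Opens) :
    pullback.snd (genericInclusion X) k ⁻¹ᵁ (V ⊓ k ⁻¹ᵁ W) =
      pullback.snd (genericInclusion X) k ⁻¹ᵁ V := by
  have h : pullback.snd (genericInclusion X) k ⁻¹ᵁ (k ⁻¹ᵁ W) = ⊤ := by
    rw [← Scheme.Hom.comp_preimage, ← pullback.condition, Scheme.Hom.comp_preimage,
      genericInclusion_preimage]
    rfl
  rw [Scheme.Hom.preimage_inf, h, inf_top_eq]

/-- Over `V' = V ⊓ k ⁻¹ᵁ W`, with `W` affine, the sections of the generic fibre are the localization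
of those of `X'` at the nonzero functions of `W`. Replacing `V` by `V'` does not change the generic
fibre, as it lies over the generic point of `X`. A section over `V'` is in turn a fraction of
sections over the affine `V`, which gives fractions with numerator and denominator on `V`. -/
theorem genericFibre_isFractional [IsIntegral X'] [QuasiSeparatedSpace X'] [Flat k] [QuasiCompact k]
    {V : X'.Opens} (hV : IsAffineOpen V) [hne : Nonempty V] :
    IsDomain Γ(pullback (genericInclusion X) k, pullback.snd (genericInclusion X) k ⁻¹ᵁ V) ∧
    Function.Injective ((pullback.snd (genericInclusion X) k).app V) ∧
    ∀ x, ∃ b ≠ 0, ∃ b', (pullback.snd (genericInclusion X) k).app V b * x =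
      (pullback.snd (genericInclusion X) k).app V b' := by
  obtain ⟨⟨v, hv⟩⟩ := hne
  obtain ⟨W, hW, hvW, -⟩ := exists_isAffineOpen_mem_and_subset (x := k v) (U := ⊤) trivial
  have : Nonempty W := ⟨⟨_, hvW⟩⟩
  set V' : X'.Opens := V ⊓ k ⁻¹ᵁ W with hV'
  have hv' : v ∈ V' := ⟨hv, hvW⟩
  have : Nonempty V' := ⟨⟨_, hv'⟩⟩
  have : Nonempty V := ⟨⟨_, hv⟩⟩
  have hle : V' ≤ V := inf_le_left
  have hcpt : IsCompact (V' : Set X') :=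
    QuasiSeparatedSpace.inter_isCompact _ _ V.2 hV.isCompact (k ⁻¹ᵁ W).2
      (k.isCompact_preimage hW.isCompact)
  have hpo := isPushout_genericFibre k W hW V' hcpt (IsQuasiSeparated.of_quasiSeparatedSpace _)
    inf_le_right
  have hloc := isLocalization_of_isPushout hpo (nonZeroDivisors Γ(X, W))
    (functionField_isFractionRing_of_isAffineOpen X W hW)
  set s := pullback.snd (genericInclusion X) k with hs
  let := (s.app V').hom.toAlgebra
  have hle0 : (nonZeroDivisors Γ(X, W)).map (k.appLE W V' inf_le_right).hom ≤
      nonZeroDivisors Γ(X', V') := by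
    rintro _ ⟨r, hr, rfl⟩
    exact mem_nonZeroDivisors_of_ne_zero (appLE_ne_zero k hW _ (nonZeroDivisors.ne_zero hr))
  have hdom : IsDomain Γ(pullback (genericInclusion X) k, s ⁻¹ᵁ V') :=
    IsLocalization.isDomain_of_le_nonZeroDivisors _ hle0
  have hinj : Function.Injective (s.app V') := IsLocalization.injective _ hle0
  have hres : Function.Injective (X'.presheaf.map (homOfLE hle).op) :=
    map_injective_of_isIntegral X' (homOfLE hle)
  have heq : s ⁻¹ᵁ V' = s ⁻¹ᵁ V := genericFibre_preimage_eq k W V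
  let ρ : Γ(pullback (genericInclusion X) k, s ⁻¹ᵁ V) ⟶
    Γ(pullback (genericInclusion X) k, s ⁻¹ᵁ V') :=
    (pullback (genericInclusion X) k).presheaf.map (eqToHom heq).op
  have hρ : Function.Injective ρ := (ConcreteCategory.bijective_of_isIso ρ).1
  have hnat (b : Γ(X', V)) : ρ (s.app V b) = s.app V' (X'.presheaf.map (homOfLE hle).op b) :=
    (ConcreteCategory.congr_hom (s.naturality (homOfLE hle).op) b).symm
  -- Choose a nonempty basic open of `V` inside `V'`; a power of its defining function clears the
  -- denominator of `z`, and restriction to this smaller open is injective.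
  have hclear (z : Γ(X', V')) : ∃ b ≠ 0, ∃ b',
      X'.presheaf.map (homOfLE hle).op b * z = X'.presheaf.map (homOfLE hle).op b' := by
    obtain ⟨b, hb, hvb⟩ := hV.exists_basicOpen_le ⟨v, hv'⟩ hv
    have : Nonempty (X'.basicOpen b) := ⟨⟨_, hvb⟩⟩
    have hb0 : b ≠ 0 := by
      rintro rfl
      rw [Scheme.basicOpen_zero] at hvb
      exact hvb
    have := hV.isLocalization_basicOpen b
    obtain ⟨⟨b', _, n, rfl⟩, h⟩ := IsLocalization.surj (.powers b)
      (X'.presheaf.map (homOfLE hb).op z)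
    refine ⟨b ^ n, pow_ne_zero _ hb0, b', map_injective_of_isIntegral X' (homOfLE hb) ?_⟩
    have hc (c : Γ(X', V)) : X'.presheaf.map (homOfLE hb).op (X'.presheaf.map (homOfLE hle).op c) =
        algebraMap Γ(X', V) Γ(X', X'.basicOpen b) c := by
      rw [← ConcreteCategory.comp_apply, ← Functor.map_comp]
      rfl
    rw [map_mul, hc, hc, mul_comm]
    exact h
  refine ⟨hρ.isDomain ρ.hom, ?_, fun x ↦ ?_⟩
  · exact fun a b hab ↦ hres (hinj (by rw [← hnat, ← hnat, hab]))
  · obtain ⟨⟨z, _, r, hr, rfl⟩, h⟩ := IsLocalization.surj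
      ((nonZeroDivisors Γ(X, W)).map (k.appLE W V' inf_le_right).hom) (ρ x)
    obtain ⟨b₁, hb₁, c₁, h₁⟩ := hclear z
    obtain ⟨b₂, hb₂, c₂, h₂⟩ := hclear (k.appLE W V' inf_le_right r)
    have hr0 := appLE_ne_zero k hW (V := V') inf_le_right (nonZeroDivisors.ne_zero hr)
    have hc₂ : c₂ ≠ 0 := by
      rintro rfl
      rw [map_zero, mul_eq_zero] at h₂
      exact h₂.elim (fun h ↦ hb₂ (hres (h.trans (map_zero _).symm))) hr0
    refine ⟨b₁ * c₂, mul_ne_zero hb₁ hc₂, b₂ * c₁, hρ ?_⟩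
    have h' : ρ x * s.app V' (k.appLE W V' inf_le_right r) = s.app V' z := h
    have h₁' := congrArg (s.app V') h₁
    have h₂' := congrArg (s.app V') h₂
    simp only [map_mul] at h₁' h₂'
    simp only [map_mul, hnat]
    rw [← h₁', ← h₂', ← h']
    ring

end GenericFibre

/-! ### Normalization charts -/

/-- A normal domain `D` which is integral over `B`, with a conductor element invertible in `E`, is
the integral closure of `B` in `E`. -/
theorem exists_equiv_integralClosure {B D E : Type} [CommRing B] [CommRing D] [CommRing E]
    [IsDomain D] [IsIntegrallyClosed D] [IsDomain E] [Algebra B E]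
    (hι : Function.Injective (algebraMap B E))
    (hfrac : ∀ x : E, ∃ b ≠ 0, ∃ b', algebraMap B E b * x = algebraMap B E b')
    (φ : B →+* D) (hφ : Function.Injective φ) (hint : φ.IsIntegral) (y : B)
    (hy : IsUnit (algebraMap B E y)) (hc : ∀ d, ∃ b, φ b = φ y * d) :
    ∃ ε : D ≃+* integralClosure B E, ∀ b, ε (φ b) = algebraMap B (integralClosure B E) b := by
  choose c hc using hc
  have hy0 : φ y ≠ 0 := fun h ↦ hy.ne_zero (by rw [hφ (h.trans (map_zero φ).symm), map_zero])
  obtain ⟨v, hv⟩ := isUnit_iff_exists_inv.mp hy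
  have hcB (b) : c (φ b) = y * b := hφ (by rw [hc, map_mul])
  -- An element `d` is sent to `(y d) / y`: the numerator lies in `B` by the conductor property, and
  -- the denominator is invertible in `E`.
  let ψ : D →+* E :=
    { toFun d := algebraMap B E (c d) * v
      map_one' := by
        have := hcB 1
        rw [map_one, mul_one] at this
        rw [this, hv]
      map_zero' := by
        have := hcB 0
        rw [map_zero, mul_zero] at this
        rw [this, map_zero, zero_mul]
      map_add' d d' := by
        have : c (d + d') = c d + c d' := hφ (by rw [map_add, hc, hc, hc, mul_add])
        rw [this, map_add, add_mul]
      map_mul' d d' := by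
        have : c (d * d') * y = c d * c d' := hφ (by rw [map_mul, map_mul, hc, hc, hc]; ring)
        have h := congrArg (algebraMap B E) this
        rw [map_mul, map_mul] at h
        linear_combination (v * v) * h + (-algebraMap B E (c (d * d')) * v) * hv }
  have hψφ (b) : ψ (φ b) = algebraMap B E b := by
    change algebraMap B E (c (φ b)) * v = _
    rw [hcB, map_mul]
    linear_combination algebraMap B E b * hv
  have hψ : Function.Injective ψ := by
    refine (injective_iff_map_eq_zero ψ).mpr fun d hd ↦ ?_
    have h0 : algebraMap B E (c d) = 0 := by
      have hd' : algebraMap B E (c d) * v = 0 := hd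
      linear_combination algebraMap B E y * hd' - algebraMap B E (c d) * hv
    have := hc d
    rw [hι (h0.trans (map_zero _).symm), map_zero, eq_comm, mul_eq_zero] at this
    exact this.resolve_left hy0
  have hmem (d) : ψ d ∈ integralClosure B E := by
    obtain ⟨p, hp, hpd⟩ := hint d
    refine ⟨p, hp, ?_⟩
    have := congrArg ψ hpd
    rwa [map_zero, Polynomial.hom_eval₂,
      show ψ.comp φ = algebraMap B E from RingHom.ext hψφ] at this
  -- By `hfrac`, `x` is a fraction `z` of elements of `B`, and it is integral over `D`, so normality
  -- of `D` applies. As `E` need not be a field, the comparison with `Frac D` takes place in `Frac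
  -- E`.
  have hsurj (x : E) (hx : IsIntegral B x) : ∃ d, ψ d = x := by
    let := ψ.toAlgebra
    let := φ.toAlgebra
    have : IsScalarTower B D E := .of_algebraMap_eq fun b ↦ (hψφ b).symm
    have hx' : IsIntegral D x := hx.tower_top
    obtain ⟨b, hb, b', hbb'⟩ := hfrac x
    let L := FractionRing E
    have hinjL : Function.Injective (Algebra.ofId D L) := (IsFractionRing.injective E L).comp hψ
    let Λ : FractionRing D →ₐ[D] L := IsFractionRing.liftAlgHom (g := Algebra.ofId D L) hinjL
    let z : FractionRing D := algebraMap D _ (φ b') / algebraMap D _ (φ b)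
    have hz : Λ z = algebraMap E L x := by
      have hb0 : algebraMap E L (algebraMap B E b) ≠ 0 := fun h ↦ hb
        (hι ((IsFractionRing.injective E L (h.trans (map_zero _).symm)).trans (map_zero _).symm))
      have h1 (b : B) : Λ (algebraMap D _ (φ b)) = algebraMap E L (algebraMap B E b) := by
        rw [Λ.commutes, ← hψφ]
        rfl
      rw [map_div₀, h1, h1, div_eq_iff hb0, ← map_mul, mul_comm x, hbb']
    have hzint : IsIntegral D z := by
      refine (isIntegral_algHom_iff Λ Λ.toRingHom.injective).mp ?_
      rw [hz]
      exact hx'.algebraMap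
    obtain ⟨d, hd⟩ := IsIntegrallyClosed.isIntegral_iff.mp hzint
    refine ⟨d, IsFractionRing.injective E L ?_⟩
    rw [← hz, ← hd, Λ.commutes]
    rfl
  refine ⟨RingEquiv.ofBijective (ψ.codRestrict (integralClosure B E).toSubring hmem)
    ⟨fun d d' h ↦ hψ (congrArg Subtype.val h), fun x ↦ ?_⟩, fun b ↦ Subtype.ext (hψφ b)⟩
  obtain ⟨d, hd⟩ := hsurj x x.2
  exact ⟨d, Subtype.ext hd⟩

/-- Sections of the normalization over an affine chart of a flat base change. -/
theorem exists_equiv_normalization_sections {X X' : Scheme.{0}} [IsIntegral X] (k : X' ⟶ X)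
    [IsIntegral X'] [QuasiSeparatedSpace X'] [Flat k] [QuasiCompact k]
    {V : X'.Opens} (hV : IsAffineOpen V) [Nonempty V] {D : Type} [CommRing D] [IsDomain D]
    [IsIntegrallyClosed D] (φ : Γ(X', V) →+* D) (hφ : Function.Injective φ) (hint : φ.IsIntegral)
    (W : X.Opens) [Nonempty W] (hVW : V ≤ k ⁻¹ᵁ W) {y : Γ(X, W)} (hy : y ≠ 0)
    (hc : ∀ d, ∃ b, φ b = φ (k.appLE W V hVW y) * d) :
    ∃ ε : D ≃+* Γ((pullback.snd (genericInclusion X) k).normalization,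
        (pullback.snd (genericInclusion X) k).fromNormalization ⁻¹ᵁ V),
      ∀ b, ε (φ b) = (pullback.snd (genericInclusion X) k).fromNormalization.app V b := by
  obtain ⟨hdom, hinj, hfrac⟩ := genericFibre_isFractional k hV
  set s := pullback.snd (genericInclusion X) k with hs
  let := (s.app V).hom.toAlgebra
  obtain ⟨ε, hε⟩ := exists_equiv_integralClosure hinj hfrac φ hφ hint (k.appLE W V hVW y)
    (isUnit_genericFibre k W V hVW hy) hc
  refine ⟨ε.trans (s.normalizationObjIso hV).symm.commRingCatIsoToRingEquiv, fun b ↦ ?_⟩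
  rw [s.fromNormalization_app hV]
  change (s.normalizationObjIso hV).inv (ε (φ b)) = _
  rw [hε]
  rfl

/-! ### Descent of integrality -/

/-- A flat local homomorphism of local rings is faithfully flat, hence injective. This lets
reducedness descend. -/
theorem injective_stalkMap_of_flat {X Y : Scheme.{0}} (f : X ⟶ Y) [Flat f] (x : X) :
    Function.Injective (f.stalkMap x) := by
  have hfl := Flat.stalkMap f x
  algebraize [(f.stalkMap x).hom]
  have : Module.Flat (Y.presheaf.stalk (f x)) (X.presheaf.stalk x) := hfl
  have : IsLocalHom (algebraMap (Y.presheaf.stalk (f x)) (X.presheaf.stalk x)) :=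
    inferInstanceAs (IsLocalHom (f.stalkMap x).hom)
  have : Module.FaithfullyFlat (Y.presheaf.stalk (f x)) (X.presheaf.stalk x) :=
    Module.FaithfullyFlat.of_flat_of_isLocalHom
  exact FaithfulSMul.algebraMap_injective (Y.presheaf.stalk (f x)) (X.presheaf.stalk x)

/-- A scheme is integral if it is covered by pairwise meeting open images of flat morphisms from
integral schemes. -/
theorem isIntegral_of_flat_cover {ι : Type} [Nonempty ι] {Y : Scheme.{0}} {X : ι → Scheme.{0}}
    [∀ i, IsIntegral (X i)] (f : ∀ i, X i ⟶ Y) [∀ i, Flat (f i)]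
    (hopen : ∀ i, IsOpen (Set.range (f i))) (hcov : ∀ y, ∃ i, y ∈ Set.range (f i))
    (hmeet : ∀ i j, (Set.range (f i) ∩ Set.range (f j)).Nonempty) : IsIntegral Y := by
  have hred : IsReduced Y := by
    have (y : Y) : _root_.IsReduced (Y.presheaf.stalk y) := by
      obtain ⟨i, x, rfl⟩ := hcov y
      exact isReduced_of_injective ((f i).stalkMap x).hom (injective_stalkMap_of_flat (f i) x)
    exact isReduced_of_isReduced_stalk Y
  have hirr (i) : IsIrreducible (Set.range (f i)) := by
    rw [← Set.image_univ]
    exact (irreducibleSpace_def _ |>.mp inferInstance).image _ (f i).continuous.continuousOn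
  have hY : IrreducibleSpace Y := by
    have hne : Nonempty Y := by
      obtain ⟨y, -⟩ := hmeet (Classical.arbitrary ι) (Classical.arbitrary ι)
      exact ⟨y⟩
    refine @IrreducibleSpace.mk _ _ ⟨fun U V hU hV ⟨u, _, hu⟩ ⟨v, _, hv⟩ ↦ ?_⟩ hne
    obtain ⟨i, hi⟩ := hcov u
    obtain ⟨j, hj⟩ := hcov v
    -- Irreducibility of the first image moves `U` into the second image, and irreducibility of the
    -- second makes `U` meet `V` there.
    obtain ⟨z, hz, hzU, hzj⟩ := (hirr i).2 U (Set.range (f j)) hU (hopen j) ⟨u, hi, hu⟩ (hmeet i j)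
    obtain ⟨w, -, hwU, hwV⟩ := (hirr j).2 U V hU hV ⟨z, hzj, hzU⟩ ⟨v, hj, hv⟩
    exact ⟨w, trivial, hwU, hwV⟩
  exact isIntegral_of_irreducibleSpace_of_isReduced Y

section

attribute [local instance] MvPolynomial.gradedAlgebra

/-! ### The split degenerate conic `Z² = y² X Y` -/

section SplitConic

open HomogeneousLocalization Matrix

variable {R : Type} [CommRing R] (y : R)

/-- The matrix of the form `2 (Z² - y² X Y)`. -/
def splitMatrix : Matrix (Fin 3) (Fin 3) R :=
  !![0, -y ^ 2, 0; -y ^ 2, 0, 0; 0, 0, 2]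

theorem dotProduct_splitMatrix {G : Type} [CommRing G] (φ : R →+* G) (v : Fin 3 → G) :
    v ⬝ᵥ (splitMatrix y).map φ *ᵥ v = 2 * (v 2 ^ 2 - φ y ^ 2 * (v 0 * v 1)) := by
  have h2 : φ 2 = 2 := map_ofNat φ 2
  simp [splitMatrix, Matrix.mulVec, dotProduct, Fin.sum_univ_three, h2]
  ring

variable {y} in
theorem splitConic_relation (h2 : IsUnit (2 : R)) {i j : Fin 2} (hij : i ≠ j) :
    conicCoord (splitMatrix y) 2 ^ 2 = algebraMap R _ y ^ 2 *
      (conicCoord (splitMatrix y) i.castSucc * conicCoord (splitMatrix y) j.castSucc) := by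
  have h := conicCoord_relation (splitMatrix y)
  rw [dotProduct_splitMatrix] at h
  have h2' := h2.map (algebraMap R (ConicRing (splitMatrix y)))
  rw [map_ofNat] at h2'
  have h3 := sub_eq_zero.mp (h2'.mul_right_eq_zero.mp h)
  fin_cases i <;> fin_cases j
  · simp at hij
  · exact h3
  · rw [h3]
    simp [mul_comm]
  · simp at hij

/-- The values of the coordinates on a chart of the normalization of the split conic. -/
def chartValue (i : Fin 2) (k : Fin 3) : Polynomial R :=
  if k = 2 then .C y * .X else if k = i.castSucc then 1 else .X ^ 2

theorem chartValue_two (i : Fin 2) : chartValue y i 2 = .C y * .X := rfl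

theorem chartValue_self (i : Fin 2) : chartValue y i i.castSucc = 1 := by
  fin_cases i <;> simp [chartValue]

theorem chartValue_of_ne {i j : Fin 2} (h : i ≠ j) : chartValue y i j.castSucc = .X ^ 2 := by
  fin_cases i <;> fin_cases j <;> simp_all [chartValue]

/-- The map from the coordinate ring of the split conic describing a chart of its normalization. -/
def chartLift (i : Fin 2) : ConicRing (splitMatrix y) →+* Polynomial R :=
  conicLift (splitMatrix y) Polynomial.C (chartValue y i) (by
    rw [dotProduct_splitMatrix]
    fin_cases i <;> simp [chartValue] <;> ring)

theorem chartLift_coord (i : Fin 2) (k : Fin 3) :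
    chartLift y i (conicCoord _ k) = chartValue y i k :=
  conicLift_coord ..

theorem chartLift_algebraMap (i : Fin 2) (r : R) : chartLift y i (algebraMap R _ r) = .C r :=
  conicLift_algebraMap ..

theorem chartLift_self (i : Fin 2) : chartLift y i (conicCoord _ i.castSucc) = 1 := by
  rw [chartLift_coord, chartValue_self]

/-- The ring homomorphism describing a chart of the normalization of the split conic. -/
def chartEval (i : Fin 2) : Away (conicGrading (splitMatrix y)) (conicCoord _ i.castSucc) →+*
    Polynomial R :=
  awayEval (conicGrading (splitMatrix y)) (chartLift y i) (f := conicCoord _ i.castSucc) (by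
    rw [chartLift_self]
    exact isUnit_one)

/-- Restriction of homogeneous coordinates to a chart of the split conic. -/
def chartHomogenize (i : Fin 2) : ConicRing (splitMatrix y) →+*
    Away (conicGrading (splitMatrix y)) (conicCoord _ i.castSucc) :=
  awayHomogenize (conicCoord_mem _ i.castSucc)

theorem chartHomogenize_surjective (i : Fin 2) : Function.Surjective (chartHomogenize y i) :=
  awayHomogenize_surjective _

theorem chartEval_homogenize (i : Fin 2) (a : ConicRing (splitMatrix y)) :
    chartEval y i (chartHomogenize y i a) = chartLift y i a :=
  awayEval_homogenize (conicCoord_mem _ i.castSucc) (chartLift y i) (chartLift_self y i) a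

theorem exists_ne_fin_two (i : Fin 2) : ∃ j : Fin 2, i ≠ j := by
  obtain ⟨j, hj⟩ := exists_ne i
  exact ⟨j, hj.symm⟩

theorem fin_three_cases {i j : Fin 2} (h : i ≠ j) (k : Fin 3) :
    k = i.castSucc ∨ k = j.castSucc ∨ k = 2 := by
  fin_cases i <;> fin_cases j <;> fin_cases k <;> simp_all

open Polynomial in
-- On the chart where coordinate `i` is `1` the equation reads `Z² = y² X_j`, so the chart ring is a
-- quotient of `R[X][√(y² X)]`, whose elements have the form `p + q √(y² X)`.
theorem exists_chart_decomposition (h2 : IsUnit (2 : R)) {i j : Fin 2} (hij : i ≠ j)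
    (b : Away (conicGrading (splitMatrix y)) (conicCoord _ i.castSucc)) :
    ∃ p q : R[X], b = eval₂ (conicAwayBase _ _) (chartHomogenize y i (conicCoord _ j.castSucc)) p +
      eval₂ (conicAwayBase _ _) (chartHomogenize y i (conicCoord _ j.castSucc)) q *
        chartHomogenize y i (conicCoord _ 2) := by
  obtain ⟨d, hd⟩ : ∃ d : R[X], d = C y ^ 2 * X := ⟨_, rfl⟩
  let ev : R[X] →+* Away (conicGrading (splitMatrix y)) (conicCoord _ i.castSucc) :=
    eval₂RingHom (conicAwayBase _ _) (chartHomogenize y i (conicCoord _ j.castSucc))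
  have hbase (r : R) : chartHomogenize y i (algebraMap R _ r) = conicAwayBase _ _ r :=
    awayHomogenize_algebraMap (conicCoord_mem _ i.castSucc) r
  have hself : chartHomogenize y i (conicCoord _ i.castSucc) = 1 := awayHomogenize_self _
  have hrel : (X ^ 2 - C d : R[X][X]).eval₂ ev (chartHomogenize y i (conicCoord _ 2)) = 0 := by
    rw [eval₂_sub, eval₂_X_pow, eval₂_C, sub_eq_zero, ← map_pow, splitConic_relation h2 hij,
      map_mul, map_mul, hself, map_pow, hbase]
    simp [ev, hd, eval₂_pow]
  let g : QuadExt d →+* Away (conicGrading (splitMatrix y)) (conicCoord _ i.castSucc) :=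
    AdjoinRoot.lift ev _ hrel
  have hg (p : R[X]) : g (algebraMap R[X] _ p) = ev p := AdjoinRoot.lift_of hrel
  have hroot : g (AdjoinRoot.root _) = chartHomogenize y i (conicCoord _ 2) :=
    AdjoinRoot.lift_root hrel
  have hmem (P : MvPolynomial (Fin 3) R) :
      chartHomogenize y i (Ideal.Quotient.mk _ P) ∈ g.range := by
    induction P using MvPolynomial.induction_on with
    | C r =>
      refine ⟨algebraMap R[X] _ (C r), (hg _).trans ?_⟩
      rw [coe_eval₂RingHom, eval₂_C]
      exact (hbase r).symm
    | add p q hp hq =>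
      rw [map_add, map_add]
      exact add_mem hp hq
    | mul_X p k hp =>
      rw [map_mul, map_mul]
      refine mul_mem hp ?_
      change chartHomogenize y i (conicCoord _ k) ∈ _
      obtain rfl | rfl | rfl := fin_three_cases hij k
      · rw [hself]
        exact one_mem _
      · exact ⟨algebraMap R[X] _ X, (hg _).trans (eval₂_X _ _)⟩
      · exact ⟨_, hroot⟩
  obtain ⟨a, rfl⟩ := chartHomogenize_surjective y i b
  obtain ⟨P, rfl⟩ := Ideal.Quotient.mk_surjective a
  obtain ⟨x, hx⟩ := hmem P
  obtain ⟨p, q, rfl⟩ := quadExt_exists d x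
  refine ⟨p, q, ?_⟩
  rw [← hx, map_add, map_mul, hroot, hg, hg]
  rfl

theorem chartEval_base (i : Fin 2) (r : R) : chartEval y i (conicAwayBase _ _ r) = .C r :=
  (awayEval_conicAwayBase (chartLift y i) (conicCoord_mem _ i.castSucc) _ r).trans
    (chartLift_algebraMap y i r)

open Polynomial in
theorem chartEval_eval₂ {i j : Fin 2} (hij : i ≠ j) (p : R[X]) :
    chartEval y i (eval₂ (conicAwayBase _ _) (chartHomogenize y i (conicCoord _ j.castSucc)) p) =
      expand R 2 p := by
  rw [hom_eval₂, chartEval_homogenize, chartLift_coord, chartValue_of_ne y hij, expand_eq_sum,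
    eval₂_eq_sum]
  congr 1
  ext1 n
  ext1 a
  rw [RingHom.comp_apply, chartEval_base]

open Polynomial in
-- The image of `p(X_j) + q(X_j) Z` is `p(t²) + y t q(t²)`. Its even and odd parts vanish
-- separately, and `y` is not a zero divisor.
theorem chartEval_injective [IsDomain R] (h2 : IsUnit (2 : R)) (hy : y ≠ 0) (i : Fin 2) :
    Function.Injective (chartEval y i) := by
  refine (injective_iff_map_eq_zero _).mpr fun b hb ↦ ?_
  obtain ⟨j, hij⟩ := exists_ne_fin_two i
  obtain ⟨p, q, rfl⟩ := exists_chart_decomposition y h2 hij b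
  rw [map_add, map_mul, chartEval_eval₂ y hij, chartEval_eval₂ y hij, chartEval_homogenize,
    chartLift_coord, chartValue_two] at hb
  have hodd (f : R[X]) (n : ℕ) : (expand R 2 f).coeff (n * 2 + 1) = 0 := by
    rw [coeff_expand two_pos, if_neg (by omega)]
  have hb' : expand R 2 p + C y * (expand R 2 q * X) = 0 := by rw [← hb]; ring
  have hp : p = 0 := by
    ext n
    have := congrArg (coeff · (n * 2)) hb'
    have h0 : (expand R 2 q * X).coeff (n * 2) = 0 := by
      cases n with
      | zero => exact coeff_mul_X_zero _
      | succ n =>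
        rw [show (n + 1) * 2 = n * 2 + 1 + 1 by ring, coeff_mul_X]
        exact hodd q n
    simpa only [coeff_add, coeff_expand_mul two_pos, coeff_zero, coeff_C_mul, h0, mul_zero,
      add_zero] using this
  have hq : q = 0 := by
    ext n
    have := congrArg (coeff · (n * 2 + 1)) hb'
    simp only [coeff_add, coeff_zero, coeff_C_mul, hodd, zero_add, coeff_mul_X,
      coeff_expand_mul two_pos, mul_eq_zero, hy, false_or] at this
    rw [this, coeff_zero]
  simp [hp, hq]

open Polynomial in
-- The parameter `t` is integral because `t²` is the image of `X_j`.
theorem chartEval_isIntegral (i : Fin 2) : (chartEval y i).IsIntegral := by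
  obtain ⟨j, hij⟩ := exists_ne_fin_two i
  let := (chartEval y i).toAlgebra
  have hX : (chartEval y i).IsIntegralElem (X : R[X]) := by
    refine IsIntegral.of_pow (R := Away (conicGrading (splitMatrix y)) (conicCoord _ i.castSucc))
      two_pos ?_
    rw [← chartValue_of_ne y hij, ← chartLift_coord, ← chartEval_homogenize]
    exact isIntegral_algebraMap
  have hC (r : R) : (chartEval y i).IsIntegralElem (C r : R[X]) := by
    rw [← chartEval_base y i r]
    exact RingHom.isIntegralElem_map _
  intro p
  induction p using Polynomial.induction_on' with
  | add p q hp hq => exact RingHom.IsIntegralElem.add _ hp hq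
  | monomial n r =>
    rw [← C_mul_X_pow_eq_monomial]
    refine RingHom.IsIntegralElem.mul _ (hC r)
      (IsIntegral.pow (R := Away (conicGrading (splitMatrix y)) (conicCoord _ i.castSucc)) hX n)

open Polynomial in
-- The conductor computation: `y t^(2m)` is the image of `y X_j^m`, and `y t^(2m+1)` that of `Z
-- X_j^m`.
theorem exists_chartEval_eq (i : Fin 2) (p : R[X]) : ∃ b, chartEval y i b = C y * p := by
  obtain ⟨j, hij⟩ := exists_ne_fin_two i
  induction p using Polynomial.induction_on' with
  | add p q hp hq =>
    obtain ⟨b, hb⟩ := hp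
    obtain ⟨b', hb'⟩ := hq
    exact ⟨b + b', by rw [map_add, hb, hb', mul_add]⟩
  | monomial n r =>
    obtain ⟨m, rfl | rfl⟩ := n.even_or_odd'
    · refine ⟨chartHomogenize y i (algebraMap R _ (y * r) * conicCoord _ j.castSucc ^ m), ?_⟩
      rw [chartEval_homogenize, map_mul, map_pow, chartLift_algebraMap, chartLift_coord,
        chartValue_of_ne y hij, ← C_mul_X_pow_eq_monomial, C_mul]
      ring
    · refine ⟨chartHomogenize y i (algebraMap R _ r * conicCoord _ 2 * conicCoord _ j.castSucc ^ m),
        ?_⟩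
      rw [chartEval_homogenize, map_mul, map_mul, map_pow, chartLift_algebraMap, chartLift_coord,
        chartLift_coord, chartValue_of_ne y hij, chartValue_two, ← C_mul_X_pow_eq_monomial]
      ring

end SplitConic

end

section

attribute [local instance] MvPolynomial.gradedAlgebra

/-! ### Homogeneous coordinates as sections -/

section ProjCoord

open HomogeneousLocalization

variable {R A : Type} [CommRing R] [CommRing A] [Algebra R A] {𝒜 : ℕ → Submodule R A}
  [GradedAlgebra 𝒜] {f g : A}

/-- Dehomogenized forms as sections over a standard open subset of `Proj`. -/
def projCoord (hf : f ∈ 𝒜 1) : A →+* Γ(Proj 𝒜, Proj.basicOpen 𝒜 f) :=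
  (Proj.awayToSection 𝒜 f).hom.comp (awayHomogenize hf)

theorem awayHomogenize_eq_isLocalizationElem (hf : f ∈ 𝒜 1) (hg : g ∈ 𝒜 1) :
    awayHomogenize hf g = Away.isLocalizationElem hf hg := by
  have hg' : g ∈ 𝒜 (1 • 1) := hg
  rw [awayHomogenize_of_mem hf 1 hg']
  ext
  simp [Away.isLocalizationElem]

theorem basicOpen_projCoord (hf : f ∈ 𝒜 1) (hg : g ∈ 𝒜 1) :
    (Proj 𝒜).basicOpen (projCoord hf g) = Proj.basicOpen 𝒜 f ⊓ Proj.basicOpen 𝒜 g := by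
  have h1 : (Proj.basicOpen 𝒜 f).ι ⁻¹ᵁ (Proj 𝒜).basicOpen (projCoord hf g) =
      (Proj.basicOpen 𝒜 f).ι ⁻¹ᵁ Proj.basicOpen 𝒜 g := by
    have h2 : (Proj.basicOpen 𝒜 f).ι =
        Proj.basicOpenToSpec 𝒜 f ≫ Proj.awayι 𝒜 f hf zero_lt_one := by
      rw [← Proj.basicOpenIsoSpec_hom 𝒜 f hf zero_lt_one, ← Proj.basicOpenIsoSpec_inv_ι,
        Iso.hom_inv_id_assoc]
    conv_rhs => rw [h2]
    rw [Scheme.Hom.comp_preimage, Proj.awayι_preimage_basicOpen 𝒜 hf zero_lt_one hg zero_lt_one,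
      ← Scheme.Opens.toSpecΓ_preimage_basicOpen, Proj.basicOpenToSpec,
      ← awayHomogenize_eq_isLocalizationElem hf hg]
    rfl
  have h3 := congrArg (fun W ↦ (Proj.basicOpen 𝒜 f).ι ''ᵁ W) h1
  simp only [Scheme.Hom.image_preimage_eq_opensRange_inf, Scheme.Opens.opensRange_ι] at h3
  rw [← h3]
  exact (inf_eq_right.mpr ((Proj 𝒜).basicOpen_le _)).symm

/-- This is the identity `a / f = (g / f) (a / g)`. -/
theorem projCoord_overlap (hf : f ∈ 𝒜 1) (hg : g ∈ 𝒜 1) {a : A} (ha : a ∈ 𝒜 1) :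
    (Proj 𝒜).presheaf.map (homOfLE inf_le_left).op (projCoord hf a) =
      (Proj 𝒜).presheaf.map (homOfLE (inf_le_left (b := Proj.basicOpen 𝒜 g))).op (projCoord hf g) *
      (Proj 𝒜).presheaf.map (homOfLE (inf_le_right (a := Proj.basicOpen 𝒜 f))).op
        (projCoord hg a) := by
  have hle : Proj.basicOpen 𝒜 f ⊓ Proj.basicOpen 𝒜 g ≤ Proj.basicOpen 𝒜 (f * g) :=
    (Proj.basicOpen_mul 𝒜 f g).ge
  have h1 (b : A) : (Proj 𝒜).presheaf.map (homOfLE inf_le_left).op (projCoord hf b) =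
      (Proj 𝒜).presheaf.map (homOfLE hle).op
        (Proj.awayToSection 𝒜 (f * g) (awayMap 𝒜 hg rfl (awayHomogenize hf b))) := by
    have := ConcreteCategory.congr_hom
      (Proj.awayMap_awayToSection (𝒜 := 𝒜) (f := f) (x := f * g) (g_deg := hg) (hx := rfl))
      (awayHomogenize hf b)
    refine Eq.trans ?_ (congrArg ((Proj 𝒜).presheaf.map (homOfLE hle).op) this).symm
    rw [ConcreteCategory.comp_apply, ← ConcreteCategory.comp_apply, ← Functor.map_comp]
    rfl
  have h2 (b : A) : (Proj 𝒜).presheaf.map (homOfLE inf_le_right).op (projCoord hg b) =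
      (Proj 𝒜).presheaf.map (homOfLE hle).op
        (Proj.awayToSection 𝒜 (f * g) (awayMap 𝒜 hf (mul_comm f g) (awayHomogenize hg b))) := by
    have := ConcreteCategory.congr_hom
      (Proj.awayMap_awayToSection (𝒜 := 𝒜) (f := g) (x := f * g) (g_deg := hf) (hx := mul_comm f g))
      (awayHomogenize hg b)
    refine Eq.trans ?_ (congrArg ((Proj 𝒜).presheaf.map (homOfLE hle).op) this).symm
    rw [ConcreteCategory.comp_apply, ← ConcreteCategory.comp_apply, ← Functor.map_comp]
    rfl
  rw [h1, h1, h2, ← map_mul, ← map_mul]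
  congr 2
  have ha' : a ∈ 𝒜 (1 • 1) := ha
  have hg' : g ∈ 𝒜 (1 • 1) := hg
  rw [awayHomogenize_of_mem hf 1 ha', awayHomogenize_of_mem hf 1 hg',
    awayHomogenize_of_mem hg 1 ha', awayMap_mk, awayMap_mk, awayMap_mk]
  ext
  rw [HomogeneousLocalization.val_mul, Away.val_mk, Away.val_mk, Away.val_mk, Localization.mk_mul]
  refine Localization.mk_eq_mk_iff.mpr (Localization.r_iff_exists.mpr ⟨1, ?_⟩)
  simp
  ring

end ProjCoord

/-! ### The split conic as a scheme -/

section SplitConicScheme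

open HomogeneousLocalization

variable {R : Type} [CommRing R] (y : R)

/-- The charts of the split conic. -/
def splitChart (i : Fin 2) : (conic (splitMatrix y)).Opens :=
  Proj.basicOpen (conicGrading (splitMatrix y)) (conicCoord _ i.castSucc)

theorem isAffineOpen_splitChart (i : Fin 2) : IsAffineOpen (splitChart y i) :=
  Proj.isAffineOpen_basicOpen _ _ (conicCoord_mem _ _) zero_lt_one

/-- Two charts suffice: by `Z² = y² X Y`, the locus `Z ≠ 0` lies in the locus `X ≠ 0`. -/
theorem iSup_splitChart (h2 : IsUnit (2 : R)) : ⨆ i, splitChart y i = ⊤ := by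
  have h := Proj.iSup_basicOpen_eq_top (conicGrading (splitMatrix y)) (conicCoord _)
    (irrelevant_le_span_conicCoord _)
  refine eq_top_iff.mpr (h.symm.trans_le (iSup_le fun k ↦ ?_))
  obtain rfl | rfl | rfl := fin_three_cases zero_ne_one k
  · exact le_iSup (splitChart y) 0
  · exact le_iSup (splitChart y) 1
  · refine le_trans ?_ (le_iSup (splitChart y) 0)
    rw [← Proj.basicOpen_pow _ _ 2 two_pos, splitConic_relation h2 zero_ne_one]
    exact Proj.basicOpen_mono _ _ _ ((Dvd.intro _ rfl).mul_left _)

instance : (conic (splitMatrix y)).IsSeparated :=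
  inferInstanceAs (Scheme.IsSeparated (Proj (conicGrading (splitMatrix y))))

/-- Homogeneous coordinates as sections over a chart of the split conic. -/
def splitCoord (i : Fin 2) : ConicRing (splitMatrix y) →+*
    Γ(conic (splitMatrix y), splitChart y i) :=
  projCoord (conicCoord_mem _ i.castSucc)

/-- The sections over a chart of the split conic. -/
def splitSectionsEquiv (i : Fin 2) :
    Away (conicGrading (splitMatrix y)) (conicCoord _ i.castSucc) ≃+*
      Γ(conic (splitMatrix y), splitChart y i) :=
  (Proj.basicOpenIsoAway (conicGrading (splitMatrix y)) _ (conicCoord_mem _ i.castSucc)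
    zero_lt_one).commRingCatIsoToRingEquiv

theorem splitSectionsEquiv_homogenize (i : Fin 2) (a : ConicRing (splitMatrix y)) :
    splitSectionsEquiv y i (chartHomogenize y i a) = splitCoord y i a :=
  rfl

/-- The normalization of a chart of the split conic, on sections. -/
def splitEval (i : Fin 2) : Γ(conic (splitMatrix y), splitChart y i) →+* Polynomial R :=
  (chartEval y i).comp ((splitSectionsEquiv y i).symm : _ →+* _)

theorem splitEval_coord (i : Fin 2) (a : ConicRing (splitMatrix y)) :
    splitEval y i (splitCoord y i a) = chartLift y i a := by
  rw [← splitSectionsEquiv_homogenize, ← chartEval_homogenize]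
  exact congrArg (chartEval y i) ((splitSectionsEquiv y i).symm_apply_apply _)

theorem splitEval_injective [IsDomain R] (h2 : IsUnit (2 : R)) (hy : y ≠ 0) (i : Fin 2) :
    Function.Injective (splitEval y i) :=
  (chartEval_injective y h2 hy i).comp (splitSectionsEquiv y i).symm.injective

theorem isIntegral_comp_symm {A B D : Type*} [CommRing A] [CommRing B] [CommRing D] (e : A ≃+* B)
    {φ : A →+* D} (h : φ.IsIntegral) : (φ.comp (e.symm : B →+* A)).IsIntegral :=
  (RingHom.isIntegral_of_surjective (e.symm : B →+* A) e.symm.surjective).trans _ _ h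

theorem splitEval_isIntegral (i : Fin 2) : (splitEval y i).IsIntegral := by
  have h := isIntegral_comp_symm (B := Γ(conic (splitMatrix y), splitChart y i))
    (splitSectionsEquiv y i) (chartEval_isIntegral y i)
  exact h

theorem exists_splitEval_eq (i : Fin 2) (p : Polynomial R) :
    ∃ b, splitEval y i b = .C y * p := by
  obtain ⟨b, hb⟩ := exists_chartEval_eq y i p
  exact ⟨splitSectionsEquiv y i b,
    (congrArg (chartEval y i) ((splitSectionsEquiv y i).symm_apply_apply _)).trans hb⟩

theorem basicOpen_splitCoord {i j : Fin 2} :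
    (conic (splitMatrix y)).basicOpen (splitCoord y i (conicCoord _ j.castSucc)) =
      splitChart y i ⊓ splitChart y j :=
  basicOpen_projCoord (conicCoord_mem _ _) (conicCoord_mem _ _)

theorem splitCoord_overlap (i j : Fin 2) (k : Fin 3) :
    (conic (splitMatrix y)).presheaf.map (homOfLE inf_le_left).op
        (splitCoord y i (conicCoord _ k)) =
      (conic (splitMatrix y)).presheaf.map (homOfLE (inf_le_left (b := splitChart y j))).op
        (splitCoord y i (conicCoord _ j.castSucc)) *
      (conic (splitMatrix y)).presheaf.map (homOfLE (inf_le_right (a := splitChart y i))).op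
        (splitCoord y j (conicCoord _ k)) :=
  projCoord_overlap (conicCoord_mem _ _) (conicCoord_mem _ _) (conicCoord_mem _ _)

/-- The inclusion of a chart of the split conic. -/
def splitι (i : Fin 2) :
    Spec (.of (Away (conicGrading (splitMatrix y)) (conicCoord _ i.castSucc))) ⟶
    conic (splitMatrix y) :=
  Proj.awayι _ _ (conicCoord_mem _ _) zero_lt_one

instance (i : Fin 2) : IsOpenImmersion (splitι y i) :=
  inferInstanceAs (IsOpenImmersion (Proj.awayι (conicGrading (splitMatrix y)) _ _ _))

theorem opensRange_splitι (i : Fin 2) : (splitι y i).opensRange = splitChart y i :=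
  Proj.opensRange_awayι ..

theorem splitι_conicToSpec (i : Fin 2) :
    splitι y i ≫ conicToSpec _ = Spec.map (CommRingCat.ofHom (conicAwayBase _ _)) :=
  awayι_conicToSpec _ _

theorem splitChart_toSpecΓ (i : Fin 2) :
    (splitChart y i).toSpecΓ ≫ Spec.map (CommRingCat.ofHom
      (S := Γ(conic (splitMatrix y), splitChart y i)) ((splitCoord y i).comp (algebraMap R _))) =
          (splitChart y i).ι ≫ conicToSpec _ := by
  let τ : ((splitChart y i : Scheme) : Scheme.{0}) ⟶
      Spec (.of (Away (conicGrading (splitMatrix y)) (conicCoord _ i.castSucc))) :=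
    Proj.basicOpenToSpec (conicGrading (splitMatrix y)) _
  have h1 : (splitChart y i).ι = τ ≫ splitι y i := by
    refine Eq.symm ?_
    refine (congrArg (· ≫ splitι y i) (Proj.basicOpenIsoSpec_hom (conicGrading (splitMatrix y)) _
      (conicCoord_mem _ i.castSucc) zero_lt_one).symm).trans ?_
    exact (Iso.hom_inv_id_assoc _ _)
  let β : CommRingCat.of (Away (conicGrading (splitMatrix y)) (conicCoord _ i.castSucc)) ⟶
      Γ(conic (splitMatrix y), splitChart y i) :=
    Proj.awayToSection (conicGrading (splitMatrix y)) _
  have h2 : τ = (splitChart y i).toSpecΓ ≫ Spec.map β := Proj.basicOpenToSpec.eq_1 ..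
  have h3 : CommRingCat.ofHom (conicAwayBase _ _) ≫ β = CommRingCat.ofHom
      (S := Γ(conic (splitMatrix y), splitChart y i)) ((splitCoord y i).comp (algebraMap R _)) :=
    CommRingCat.hom_ext (RingHom.ext fun r ↦ congrArg β.hom
      (awayHomogenize_algebraMap (conicCoord_mem _ i.castSucc) r).symm)
  rw [h1, Category.assoc, splitι_conicToSpec, h2, Category.assoc, ← Spec.map_comp, h3]

/-- Putting `t = 0` in a chart gives a section of the structure morphism. -/
theorem conicToSpec_splitMatrix_surjective :
    Function.Surjective (conicToSpec (splitMatrix y)) := by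
  intro p
  let β := (Polynomial.evalRingHom (0 : R)).comp (chartEval y 0)
  have hβ : β.comp (conicAwayBase _ _) = RingHom.id R :=
    RingHom.ext fun r ↦ by
      simp only [β, RingHom.comp_apply, chartEval_base, Polynomial.coe_evalRingHom,
        Polynomial.eval_C, RingHom.id_apply]
  have h : Spec.map (CommRingCat.ofHom β) ≫ splitι y 0 ≫ conicToSpec _ = 𝟙 _ := by
    rw [splitι_conicToSpec, ← Spec.map_comp, ← CommRingCat.ofHom_comp, hβ]
    exact Spec.map_id _
  refine ⟨(Spec.map (CommRingCat.ofHom β) ≫ splitι y 0) p, ?_⟩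
  rw [← Scheme.Hom.comp_apply, Category.assoc, h]
  rfl

/-- The two chart rings embed in `R[t]`, hence are domains. The charts meet because their
intersection is the nonvanishing locus of a function with image `1` or `t²`, which is not nilpotent.
-/
theorem isIntegral_splitConic [IsDomain R] (h2 : IsUnit (2 : R)) (hy : y ≠ 0) :
    IsIntegral (conic (splitMatrix y)) := by
  have (i : Fin 2) :
      IsDomain (Away (conicGrading (splitMatrix y)) (conicCoord _ i.castSucc)) :=
    (chartEval_injective y h2 hy i).isDomain _
  refine isIntegral_of_flat_cover (splitι y) (fun i ↦ (splitι y i).isOpenEmbedding.isOpen_range)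
    (fun x ↦ ?_) fun i j ↦ ?_
  · have hx : x ∈ ⨆ i, splitChart y i := by
      rw [iSup_splitChart y h2]
      trivial
    obtain ⟨i, hi⟩ := TopologicalSpace.Opens.mem_iSup.mp hx
    rw [← opensRange_splitι] at hi
    exact ⟨i, hi⟩
  · have hne : splitCoord y i (conicCoord _ j.castSucc) ≠ 0 := by
      intro h
      have h1 := splitEval_coord y i (conicCoord _ j.castSucc)
      rw [h, map_zero, chartLift_coord] at h1
      by_cases hij : i = j
      · subst hij
        rw [chartValue_self] at h1
        exact zero_ne_one h1
      · rw [chartValue_of_ne y hij] at h1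
        exact pow_ne_zero 2 Polynomial.X_ne_zero h1.symm
    have hdom : IsDomain Γ(conic (splitMatrix y), splitChart y i) :=
      (splitEval_injective y h2 hy i).isDomain _
    by_contra hempty
    refine hne (IsNilpotent.eq_zero ?_)
    refine (Scheme.isNilpotent_iff_basicOpen_eq_bot_of_isCompact
      (isAffineOpen_splitChart y i).isCompact _).mpr ?_
    rw [basicOpen_splitCoord, ← opensRange_splitι, ← opensRange_splitι]
    exact TopologicalSpace.Opens.ext (Set.not_nonempty_iff_eq_empty.mp hempty)

end SplitConicScheme

end

/-! ### Consequences of the Jacobian criterion -/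

section Jacobian

/-- An ideal whose only possible zero is the origin contains powers of the coordinates. -/
theorem exists_X_pow_mem {I : Ideal CoordRing}
    (hI : ∀ u : Fin 3 → ℂ, (∀ g ∈ I, MvPolynomial.eval u g = 0) → u = 0) (i : Fin 3) :
    ∃ n, (MvPolynomial.X i : CoordRing) ^ n ∈ I := by
  have h : (MvPolynomial.X i : CoordRing) ∈ I.radical := by
    rw [← MvPolynomial.vanishingIdeal_zeroLocus_eq_radical (K := ℂ)]
    intro u hu
    have h0 : u = 0 := hI u fun g hg ↦ hu g hg
    simp [h0]
  exact h

theorem isRelPrime_X_pow {i j : Fin 3} (hij : i ≠ j) (m n : ℕ) :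
    IsRelPrime ((MvPolynomial.X i : CoordRing) ^ m) (MvPolynomial.X j ^ n) := by
  refine IsRelPrime.pow ?_
  refine (MvPolynomial.X_prime.irreducible.isRelPrime_iff_not_dvd).mpr fun h ↦ ?_
  rw [MvPolynomial.X_dvd_X] at h
  exact hij h

/-- The Jacobian criterion for a plane projective curve. -/
def IsSmoothForm (f : CoordRing) : Prop :=
  ∀ u : Fin 3 → ℂ, u ≠ 0 → MvPolynomial.eval u f = 0 →
    ∃ i, MvPolynomial.eval u (MvPolynomial.pderiv i f) ≠ 0

variable {f : CoordRing}

/-- Wherever `d` vanishes, `f` and all its partial derivatives vanish, so smoothness leaves only the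
origin. By the Nullstellensatz `d` divides powers of two different coordinates, and these are
coprime. -/
theorem isUnit_of_sq_dvd (hf : IsSmoothForm f) {d : CoordRing} (hd : d * d ∣ f) : IsUnit d := by
  have hI (u : Fin 3 → ℂ) (hu : ∀ g ∈ Ideal.span {d}, MvPolynomial.eval u g = 0) : u = 0 := by
    by_contra h0
    have hdu := hu d (Ideal.mem_span_singleton_self d)
    obtain ⟨g, rfl⟩ := hd
    obtain ⟨i, hi⟩ := hf u h0 (by simp [hdu])
    refine hi ?_
    simp [Derivation.leibniz, hdu]
  obtain ⟨m, hm⟩ := exists_X_pow_mem hI 0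
  obtain ⟨n, hn⟩ := exists_X_pow_mem hI 1
  exact isRelPrime_X_pow zero_ne_one m n (Ideal.mem_span_singleton.mp hm)
    (Ideal.mem_span_singleton.mp hn)

theorem not_isSquare_of_smooth (hf : IsSmoothForm f) (h0 : MvPolynomial.eval 0 f = 0) :
    ¬ IsSquare f := by
  rintro ⟨r, rfl⟩
  have hr := isUnit_of_sq_dvd hf (dvd_refl (r * r))
  have := (hr.mul hr).map (MvPolynomial.eval (0 : Fin 3 → ℂ))
  rw [h0] at this
  exact not_isUnit_zero this

/-- For a reduced fraction `a / b` the hypothesis says `b² ∣ a² f`, whence `b² ∣ f` and `b` is a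
unit. -/
theorem isIntegral_of_sq_mul (hf : IsSmoothForm f) {K : Type} [Field K]
    [Algebra CoordRing K] [IsFractionRing CoordRing K] (x : K)
    (hx : IsIntegral CoordRing (x ^ 2 * algebraMap CoordRing K f)) : IsIntegral CoordRing x := by
  obtain ⟨g, hg⟩ := IsIntegrallyClosed.isIntegral_iff.mp hx
  obtain ⟨a, b, hab, rfl⟩ := IsFractionRing.exists_reduced_fraction CoordRing x
  have hb0 : algebraMap CoordRing K b ≠ 0 :=
    IsFractionRing.to_map_ne_zero_of_mem_nonZeroDivisors b.2
  have h : (b : CoordRing) * b ∣ a ^ 2 * f := by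
    refine ⟨g, IsFractionRing.injective CoordRing K ?_⟩
    rw [map_mul, map_mul, map_mul, hg, map_pow, IsFractionRing.mk'_eq_div]
    field_simp
  have hrel : IsRelPrime ((b : CoordRing) * b) (a ^ 2) := by
    rw [← sq]
    exact hab.symm.pow
  obtain ⟨c, hc⟩ := isUnit_of_sq_dvd hf (hrel.dvd_of_dvd_mul_left h)
  refine IsIntegrallyClosed.isIntegral_iff.mpr ⟨a * (↑c⁻¹ : CoordRing), ?_⟩
  rw [IsFractionRing.mk'_eq_div, eq_div_iff hb0, ← map_mul, ← hc, mul_assoc, Units.inv_mul,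
    mul_one]

end Jacobian

/-! ### Smooth discriminants: rank of the net and normality of the double cover -/

namespace QuadricNet

variable {N : QuadricNet}

theorem qPlus_apply (N : QuadricNet) (i j : Fin 3) : N.qPlus i j =
    ∑ k : Fin 3, (MvPolynomial.X k : CoordRing) * MvPolynomial.C ((N.q k).toBlocks₁₁ i j) := by
  rw [qPlus, Matrix.sum_apply]
  rfl

theorem qPlus_isSymm (N : QuadricNet) : N.qPlus.IsSymm := by
  refine Matrix.IsSymm.ext fun i j ↦ ?_
  rw [qPlus_apply, qPlus_apply]
  refine Finset.sum_congr rfl fun (k : Fin 3) _ ↦ ?_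
  have := congrFun (congrFun (N.isSymm k) (Sum.inl j)) (Sum.inl i)
  rw [Matrix.transpose_apply] at this
  rw [Matrix.toBlocks₁₁, Matrix.of_apply, Matrix.of_apply, this]

theorem qPlus_mem (N : QuadricNet) (i j : Fin 3) :
    N.qPlus i j ∈ Ideal.span (Set.range (MvPolynomial.X : Fin 3 → CoordRing)) := by
  rw [qPlus_apply]
  exact Ideal.sum_mem _ fun k _ ↦ Ideal.mul_mem_right _ _ (Ideal.subset_span ⟨k, rfl⟩)

theorem eval_zero_fPlus (N : QuadricNet) : MvPolynomial.eval 0 N.fPlus = 0 := by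
  rw [fPlus, Matrix.det_fin_three]
  simp [qPlus_apply]

/-- Jacobi's formula: the derivative of the determinant is the trace of the adjugate times the
derivative of the matrix. -/
theorem eval_pderiv_fPlus {u : Fin 3 → ℂ}
    (hu : ∀ i j, MvPolynomial.eval u (N.qPlus.adjugate i j) = 0) (k : Fin 3) :
    MvPolynomial.eval u (MvPolynomial.pderiv k N.fPlus) = 0 := by
  have h : MvPolynomial.pderiv k N.fPlus =
      ∑ i, ∑ j, N.qPlus.adjugate i j * MvPolynomial.pderiv k (N.qPlus j i) := by
    rw [fPlus, Matrix.det_fin_three, Matrix.adjugate_fin_three]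
    simp only [map_add, map_sub, Derivation.leibniz, smul_eq_mul, Fin.sum_univ_three,
      Matrix.of_apply, Matrix.cons_val', Matrix.cons_val_zero, Matrix.cons_val_one,
      Matrix.cons_val_fin_one, Matrix.cons_val]
    ring
  rw [h]
  simp [hu]

/-- A common zero of the entries of the adjugate also kills the determinant and, by Jacobi's
formula, its derivatives. Smoothness confines such zeros to the origin, so a prime containing all
entries contains every coordinate. -/
theorem SmoothCurvePlus.exists_adjugate_notMem (hN : N.SmoothCurvePlus) (p : Ideal CoordRing)
    [p.IsPrime] (hp : ¬ Set.range MvPolynomial.X ⊆ (p : Set CoordRing)) :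
    ∃ i j, N.qPlus.adjugate i j ∉ p := by
  by_contra! hadj
  refine hp ?_
  rintro _ ⟨k, rfl⟩
  have hI (u : Fin 3 → ℂ) (hu : ∀ g ∈ Ideal.span (Set.range fun ij : Fin 3 × Fin 3 ↦
      N.qPlus.adjugate ij.1 ij.2), MvPolynomial.eval u g = 0) : u = 0 := by
    by_contra h0
    have hu' (i j : Fin 3) : MvPolynomial.eval u (N.qPlus.adjugate i j) = 0 :=
      hu _ (Ideal.subset_span ⟨(i, j), rfl⟩)
    have hfu : MvPolynomial.eval u N.fPlus = 0 := by
      have h := congrFun (congrFun (Matrix.mul_adjugate N.qPlus) 0) 0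
      rw [Matrix.mul_apply, Matrix.smul_apply, Matrix.one_apply_eq, smul_eq_mul, mul_one] at h
      rw [fPlus, ← h]
      simp [hu']
    obtain ⟨i, hi⟩ := hN u h0 hfu
    exact hi (eval_pderiv_fPlus hu' i)
  obtain ⟨n, hn⟩ := exists_X_pow_mem hI k
  refine ‹p.IsPrime›.mem_of_pow_mem n (Ideal.span_le.mpr ?_ hn)
  rintro _ ⟨ij, rfl⟩
  exact hadj ij.1 ij.2

theorem SmoothCurvePlus.not_isSquare (hN : N.SmoothCurvePlus) : ¬ IsSquare N.fPlus :=
  not_isSquare_of_smooth hN N.eval_zero_fPlus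

theorem SmoothCurvePlus.isDomain (hN : N.SmoothCurvePlus) : IsDomain N.APlus :=
  quadExt_isDomain hN.not_isSquare

theorem isUnit_two_coordRing : IsUnit (2 : CoordRing) := by
  have := (isUnit_iff_ne_zero.mpr (two_ne_zero (α := ℂ))).map (algebraMap ℂ CoordRing)
  rwa [map_ofNat] at this

theorem SmoothCurvePlus.isIntegrallyClosed (hN : N.SmoothCurvePlus) :
    IsIntegrallyClosed N.APlus :=
  quadExt_isIntegrallyClosed hN.not_isSquare isUnit_two_coordRing (isIntegral_of_sq_mul hN)

end QuadricNet

/-! ### Diagonalizing ternary quadratic forms -/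

section TernaryForms

open Matrix

variable {B : Type} [CommRing B]

theorem eq_of_isSymm_fin_three {B : Type} {q : Matrix (Fin 3) (Fin 3) B} (hq : q.IsSymm) :
    q = !![q 0 0, q 0 1, q 0 2; q 0 1, q 1 1, q 1 2; q 0 2, q 1 2, q 2 2] := by
  ext i j
  fin_cases i <;> fin_cases j <;> first | rfl | exact hq.apply _ _

/-- A symmetric matrix with an entry outside a prime ideal has, in some integral basis, its last
diagonal entry outside this prime ideal. -/
theorem exists_basis_last_notMem {M : Matrix (Fin 3) (Fin 3) B} (hM : M.IsSymm) (p : Ideal B)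
    [p.IsPrime] (h2 : (2 : B) ∉ p) {i j : Fin 3} (hij : M i j ∉ p) :
    ∃ Q : Matrix (Fin 3) (Fin 3) ℤ, Q.det = 1 ∧
      (Q.map (Int.castRingHom B) * M * (Q.map (Int.castRingHom B))ᵀ) 2 2 ∉ p := by
  by_contra! h
  rw [eq_of_isSymm_fin_three hM] at h hij
  have hp {x : B} (hx : 2 * x ∈ p) : x ∈ p := (‹p.IsPrime›.mem_or_mem hx).resolve_left h2
  -- The last diagonal entry is the value of the form on the last row of `Q`. The six matrices probe
  -- the basis vectors and their pairwise sums, and polarization recovers twice each off-diagonal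
  -- entry.
  have h22 := h 1 det_one
  have h11 := h !![1, 0, 0; 0, 0, -1; 0, 1, 0] (by simp [det_fin_three])
  have h00 := h !![0, 0, -1; 0, 1, 0; 1, 0, 0] (by simp [det_fin_three])
  have h12 := h !![1, 0, 0; 0, 1, 0; 0, 1, 1] (by simp [det_fin_three])
  have h02 := h !![1, 0, 0; 0, 1, 0; 1, 0, 1] (by simp [det_fin_three])
  have h01 := h !![1, 0, 0; 0, 0, -1; 1, 1, 0] (by simp [det_fin_three])
  simp [Matrix.mul_apply, Fin.sum_univ_three, Matrix.one_apply] at h22 h11 h00 h12 h02 h01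
  have h12' : M 1 2 ∈ p := hp (by
    convert p.sub_mem (p.sub_mem h12 h11) h22 using 1
    ring)
  have h02' : M 0 2 ∈ p := hp (by
    convert p.sub_mem (p.sub_mem h02 h00) h22 using 1
    ring)
  have h01' : M 0 1 ∈ p := hp (by
    convert p.sub_mem (p.sub_mem h01 h00) h11 using 1
    ring)
  refine hij ?_
  fin_cases i <;> fin_cases j <;> simpa

/-- If `q 0 0` and `q 1 1` both lie in `p`, then `q 0 1` does not, since the minor does not; the
value on the sum of the first two basis vectors is then outside `p`. If only `q 0 0` lies in `p`,
the two vectors are exchanged up to sign. Unimodular changes among these two vectors preserve the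
minor. -/
theorem exists_basis_first_notMem {q : Matrix (Fin 3) (Fin 3) B} (hq : q.IsSymm) (p : Ideal B)
    [p.IsPrime] (h2 : (2 : B) ∉ p) (h : q.adjugate 2 2 ∉ p) :
    ∃ Q : Matrix (Fin 3) (Fin 3) ℤ, Q.det = 1 ∧
      ((Q.map (Int.castRingHom B))ᵀ * q * Q.map (Int.castRingHom B)) 0 0 ∉ p ∧
      ((Q.map (Int.castRingHom B))ᵀ * q * Q.map (Int.castRingHom B)).adjugate 2 2 ∉ p := by
  have hadj : q.adjugate 2 2 = q 0 0 * q 1 1 - q 0 1 * q 0 1 := by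
    rw [adjugate_fin_three, ← hq.apply 1 0]
    simp
  rw [hadj] at h
  by_cases h0 : q 0 0 ∈ p
  · by_cases h1 : q 1 1 ∈ p
    · refine ⟨!![1, 0, 0; 1, 1, 0; 0, 0, 1], by simp [det_fin_three], fun h' ↦ h ?_, fun h' ↦ h ?_⟩
      · have h01 : q 0 1 ∈ p := by
          refine (‹p.IsPrime›.mem_or_mem (x := 2) ?_).resolve_left h2
          rw [eq_of_isSymm_fin_three hq] at h'
          simp [Matrix.mul_apply, Fin.sum_univ_three] at h'
          convert p.sub_mem (p.sub_mem h' h0) h1 using 1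
          ring
        exact p.sub_mem (p.mul_mem_left _ h1) (p.mul_mem_left _ h01)
      · rw [eq_of_isSymm_fin_three hq, adjugate_fin_three] at h'
        simp [Matrix.mul_apply, Fin.sum_univ_three] at h'
        convert h' using 1
        ring
    · refine ⟨!![0, -1, 0; 1, 0, 0; 0, 0, 1], by simp [det_fin_three],
        fun h' ↦ h1 ?_, fun h' ↦ h ?_⟩
      · simpa [Matrix.mul_apply, Fin.sum_univ_three] using h'
      · rw [eq_of_isSymm_fin_three hq, adjugate_fin_three] at h'
        simp [Matrix.mul_apply, Fin.sum_univ_three] at h'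
        convert h' using 1
        ring
  · refine ⟨1, det_one, ?_, ?_⟩
    · simpa [Matrix.map_one] using h0
    · simpa [Matrix.map_one, hadj] using h

theorem isSymm_transpose_mul_mul {q : Matrix (Fin 3) (Fin 3) B} (hq : q.IsSymm)
    (P : Matrix (Fin 3) (Fin 3) B) : (Pᵀ * q * P).IsSymm := by
  rw [IsSymm, transpose_mul, transpose_mul, transpose_transpose, hq.eq, mul_assoc]

/-- A symmetric matrix with nonzero adjugate modulo a prime ideal has, in some integral basis, its
first two principal minors nonzero modulo this prime ideal. -/
theorem exists_good_basis {q : Matrix (Fin 3) (Fin 3) B} (hq : q.IsSymm) (p : Ideal B)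
    [p.IsPrime] (h2 : (2 : B) ∉ p) {i j : Fin 3} (hij : q.adjugate i j ∉ p) :
    ∃ Q : Matrix (Fin 3) (Fin 3) ℤ, Q.det = 1 ∧
      ((Q.map (Int.castRingHom B))ᵀ * q * Q.map (Int.castRingHom B)) 0 0 ∉ p ∧
      ((Q.map (Int.castRingHom B))ᵀ * q * Q.map (Int.castRingHom B)).adjugate 2 2 ∉ p := by
  -- `Q` changes the basis for the adjugate form; since `adj (Pᵀ q P) = adj P * adj q * (adj P)ᵀ`,
  -- the matching change for `q` itself is `P = adj Q`.
  obtain ⟨Q, hQ, hQ'⟩ := exists_basis_last_notMem hq.adjugate p h2 hij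
  have hadj : Q.adjugate.adjugate = Q := by
    rw [adjugate_adjugate _ (by simp), hQ, one_pow, one_smul]
  have hdet : Q.adjugate.det = 1 := by rw [det_adjugate, hQ, one_pow]
  set P := Q.adjugate.map (Int.castRingHom B) with hP
  have hPQ : P.adjugate = Q.map (Int.castRingHom B) := by
    have := RingHom.map_adjugate (Int.castRingHom B) Q.adjugate
    rw [hadj] at this
    exact this.symm
  have h := exists_basis_first_notMem (q := Pᵀ * q * P) (isSymm_transpose_mul_mul hq P) p h2 (by
    rw [adjugate_mul_distrib, adjugate_mul_distrib, ← adjugate_transpose, hPQ, ← mul_assoc]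
    exact hQ')
  obtain ⟨Q2, h1, h2, h3⟩ := h
  have e : ((Q.adjugate * Q2).map (Int.castRingHom B))ᵀ * q *
      (Q.adjugate * Q2).map (Int.castRingHom B) = (Q2.map (Int.castRingHom B))ᵀ * (Pᵀ * q * P) *
      Q2.map (Int.castRingHom B) := by
    rw [Matrix.map_mul, transpose_mul]
    simp only [mul_assoc, hP]
  exact ⟨Q.adjugate * Q2, by rw [det_mul, hdet, h1, one_mul], e ▸ h2, e ▸ h3⟩

/-- The change of coordinates which splits the adjugate form. -/
theorem splitMatrix_pullback {a b c d e g r s y : B} (ha : s * a = 1)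
    (hr : r ^ 2 = -(a * d - b * b)) (hy : y ^ 2 = det !![a, b, c; b, d, e; c, e, g]) :
    let L : Matrix (Fin 3) (Fin 3) B := !![(b + r) * s, -1, 0; r - b, a, 0;
      b * e - c * d, b * c - a * e, a * d - b * b]
    Lᵀ * splitMatrix y * L =
      (2 * (a * d - b * b)) • adjugate !![a, b, c; b, d, e; c, e, g] := by
  intro L
  rw [det_fin_three] at hy
  simp at hy
  -- The third row of `L` is that of the adjugate: multiplying the adjugate form by `h = a d - b²`
  -- and completing the square leaves `det * (d x₀² - 2 b x₀ x₁ + a x₁²)`. This binary form has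
  -- discriminant `4 r²`, and minus it is the product of the linear forms in the first two rows;
  -- `k1` and `k2` compute its coefficients.
  have k1 : (b + r) * s * (r - b) = -d := by linear_combination s * hr - d * ha
  have k2 : (b + r) * s * a = b + r := by linear_combination (b + r) * ha
  rw [adjugate_fin_three]
  ext i j
  fin_cases i <;> fin_cases j <;>
    simp [L, splitMatrix, Matrix.mul_apply, Fin.sum_univ_three]
  · linear_combination (-2 * y ^ 2) * k1 + 2 * d * hy
  · linear_combination (-y ^ 2) * k2 - 2 * b * hy
  · ring
  · linear_combination (-y ^ 2) * k2 - 2 * b * hy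
  · linear_combination 2 * a * hy
  · ring
  · ring
  · ring
  · ring

/-- The coordinate change `L` has determinant `2 r h` with `h = q.adjugate 2 2`. It is invertible
because `r² = -h` makes `r` a unit. -/
theorem exists_splitMatrix_eq {q : Matrix (Fin 3) (Fin 3) B} (hq : q.IsSymm) {r y : B}
    (h2 : IsUnit (2 : B)) (ha : IsUnit (q 0 0)) (hh : IsUnit (q.adjugate 2 2))
    (hr : r ^ 2 = -q.adjugate 2 2) (hy : y ^ 2 = q.det) :
    ∃ (T T' : Matrix (Fin 3) (Fin 3) B) (c : B), IsUnit c ∧ T' * T = 1 ∧ T * T' = 1 ∧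
      splitMatrix y = c • (Tᵀ * q.adjugate * T) := by
  obtain ⟨u, hu⟩ := ha
  have hadj : q.adjugate 2 2 = q 0 0 * q 1 1 - q 0 1 * q 0 1 := by
    rw [adjugate_fin_three, ← hq.apply 1 0]
    simp
  have hsa : (↑u⁻¹ : B) * q 0 0 = 1 := by rw [← hu, Units.inv_mul]
  have key := splitMatrix_pullback (c := q 0 2) (e := q 1 2) (g := q 2 2) hsa (hadj ▸ hr)
    (eq_of_isSymm_fin_three hq ▸ hy)
  rw [← eq_of_isSymm_fin_three hq] at key
  set L : Matrix (Fin 3) (Fin 3) B := !![(q 0 1 + r) * (↑u⁻¹ : B), -1, 0; r - q 0 1, q 0 0, 0;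
      q 0 1 * q 1 2 - q 0 2 * q 1 1, q 0 1 * q 0 2 - q 0 0 * q 1 2,
      q 0 0 * q 1 1 - q 0 1 * q 0 1] with hL
  have hLdet : L.det = 2 * r * (q.adjugate 2 2) := by
    rw [hL, det_fin_three, hadj]
    simp
    linear_combination (q 0 1 + r) * (q 0 0 * q 1 1 - q 0 1 * q 0 1) * hsa
  have hr' : IsUnit r := (isUnit_pow_iff two_ne_zero).mp (hr ▸ hh.neg)
  have hLu : IsUnit L.det := hLdet ▸ (h2.mul hr').mul hh
  refine ⟨L⁻¹, L, 2 * q.adjugate 2 2, h2.mul hh, mul_nonsing_inv _ hLu, nonsing_inv_mul _ hLu, ?_⟩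
  rw [← smul_mul_assoc, ← mul_smul_comm, hadj]
  refine Eq.trans ?_ (congrArg (fun Z ↦ (L⁻¹)ᵀ * Z * L⁻¹) key)
  have hLt : (L⁻¹)ᵀ * Lᵀ = 1 := by rw [← transpose_mul, mul_nonsing_inv _ hLu, transpose_one]
  rw [mul_assoc, mul_assoc (Lᵀ * _), mul_nonsing_inv _ hLu, mul_one, ← mul_assoc, hLt, one_mul]

end TernaryForms

/-! ### Étale local splitting of the adjugate form of a net -/

namespace QuadricNet

open Matrix

variable {N : QuadricNet}

theorem mem_puncturedCover_iff {p : PrimeSpectrum N.APlus} : p ∈ N.puncturedCover ↔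
    ¬ Set.range MvPolynomial.X ⊆ (p.asIdeal.comap (algebraMap CoordRing N.APlus) : Set CoordRing) :=
  Iff.rfl

/-- Since `Q` has determinant one, the basis change leaves the determinant equal to the image of
`f₊`, whose square root is the image of the root in `A₊`. The change induced on adjugates is
absorbed into `T`. -/
theorem exists_splitting_coordinates {B : Type} [CommRing B] (φ : N.APlus →+* B)
    {Q : Matrix (Fin 3) (Fin 3) ℤ} (hQ : Q.det = 1) (h2 : IsUnit (2 : B))
    {q : Matrix (Fin 3) (Fin 3) B} (hq : q = (Q.map (Int.castRingHom B))ᵀ *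
      N.qPlus.map (φ.comp (algebraMap CoordRing N.APlus)) * Q.map (Int.castRingHom B))
    (ha : IsUnit (q 0 0)) (hh : IsUnit (q.adjugate 2 2)) {r : B}
    (hr : r ^ 2 = -q.adjugate 2 2) :
    ∃ (T T' : Matrix (Fin 3) (Fin 3) B) (c : B), IsUnit c ∧ T' * T = 1 ∧ T * T' = 1 ∧
      splitMatrix (φ (AdjoinRoot.root _)) =
        c • (Tᵀ * N.qPlus.adjugate.map (φ.comp (algebraMap CoordRing N.APlus)) * T) := by
  set ψ := φ.comp (algebraMap CoordRing N.APlus)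
  set P := Q.map (Int.castRingHom B) with hP
  have hPdet : P.det = 1 := by
    have := RingHom.map_det (Int.castRingHom B) Q
    rw [hQ, map_one] at this
    exact this.symm
  have hqs : q.IsSymm := by
    rw [hq]
    exact isSymm_transpose_mul_mul (N.qPlus_isSymm.map _) P
  have hy : φ (AdjoinRoot.root _) ^ 2 = q.det := by
    rw [hq, det_mul, det_mul, det_transpose, hPdet, one_mul, mul_one, ← map_pow,
      quadExt_root_sq]
    exact RingHom.map_det ψ N.qPlus
  obtain ⟨T, T', c, hc, h1, h3, h⟩ := exists_splitMatrix_eq hqs h2 ha hh hr hy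
  have hadj : q.adjugate = P.adjugate * N.qPlus.adjugate.map ψ * P.adjugateᵀ := by
    rw [hq, adjugate_mul_distrib, adjugate_mul_distrib, ← adjugate_transpose, ← mul_assoc]
    congr 2
    exact (RingHom.map_adjugate ψ N.qPlus).symm
  have h4 : P.adjugate * P = 1 := by rw [adjugate_mul, hPdet, one_smul]
  have h5 : P * P.adjugate = 1 := by rw [mul_adjugate, hPdet, one_smul]
  refine ⟨P.adjugateᵀ * T, T' * Pᵀ, c, hc, ?_, ?_, ?_⟩
  · rw [mul_assoc, ← mul_assoc Pᵀ, ← transpose_mul, h4, transpose_one, one_mul, h1]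
  · rw [mul_assoc, ← mul_assoc T, h3, one_mul, ← transpose_mul, h5, transpose_one]
  · rw [h, hadj, transpose_mul, transpose_transpose]
    simp only [mul_assoc]

/-- Étale locally on the punctured double cover, the adjugate form is split. -/
theorem SmoothCurvePlus.exists_splitting_cover (hN : N.SmoothCurvePlus)
    {p : PrimeSpectrum N.APlus} (hp : p ∈ N.puncturedCover) :
    ∃ (S : Type) (_ : CommRing S) (φ : N.APlus →+* S), IsDomain S ∧ IsIntegrallyClosed S ∧
      φ.Etale ∧ Function.Injective φ ∧ p ∈ Set.range (PrimeSpectrum.comap φ) ∧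
      (∀ P, PrimeSpectrum.comap φ P ∈ N.puncturedCover) ∧
      ∃ (T T' : Matrix (Fin 3) (Fin 3) S) (c : S), IsUnit c ∧ T' * T = 1 ∧ T * T' = 1 ∧
        splitMatrix (φ (AdjoinRoot.root _)) =
          c • (Tᵀ * N.qPlus.adjugate.map (φ.comp (algebraMap CoordRing N.APlus)) * T) := by
  have := hN.isDomain
  have := hN.isIntegrallyClosed
  let ψ := algebraMap CoordRing N.APlus
  have h2 : IsUnit (2 : N.APlus) := by
    have := isUnit_two_coordRing.map ψ
    rwa [map_ofNat] at this
  have h2p : (2 : N.APlus) ∉ p.asIdeal := fun h ↦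
    p.isPrime.ne_top (Ideal.eq_top_of_isUnit_mem _ h h2)
  obtain ⟨i, j, hij⟩ := hN.exists_adjugate_notMem (p.asIdeal.comap ψ) hp
  have hadj : (N.qPlus.map ψ).adjugate = N.qPlus.adjugate.map ψ :=
    (RingHom.map_adjugate ψ N.qPlus).symm
  obtain ⟨Q, hQ, ha, hh⟩ := exists_good_basis (N.qPlus_isSymm.map ψ) p.asIdeal h2p
    (i := i) (j := j) (by rw [hadj]; exact hij)
  set q := (Q.map (Int.castRingHom N.APlus))ᵀ * N.qPlus.map ψ * Q.map (Int.castRingHom N.APlus)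
    with hq
  -- Inverting `t` makes both leading minors units; the étale extension then adjoins a square root
  -- of `-q.adjugate 2 2`.
  set t := q 0 0 * q.adjugate 2 2 with ht
  have htp : t ∉ p.asIdeal := fun h ↦ (p.isPrime.mem_or_mem h).elim ha hh
  have ht0 : t ≠ 0 := fun h ↦ htp (h ▸ p.asIdeal.zero_mem)
  have hpow : Submonoid.powers t ≤ nonZeroDivisors N.APlus :=
    powers_le_nonZeroDivisors_of_noZeroDivisors ht0
  let A₁ := Localization.Away t
  have : IsDomain A₁ := IsLocalization.isDomain_localization hpow
  have : IsIntegrallyClosed A₁ :=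
    isIntegrallyClosed_of_isLocalization A₁ (Submonoid.powers t) hpow
  have htu : IsUnit (algebraMap N.APlus A₁ (q 0 0) * algebraMap N.APlus A₁ (q.adjugate 2 2)) := by
    rw [← map_mul]
    exact IsLocalization.Away.algebraMap_isUnit t
  have h2' : IsUnit (2 : A₁) := by
    have := h2.map (algebraMap N.APlus A₁)
    rwa [map_ofNat] at this
  have hhu := (isUnit_of_mul_isUnit_right htu).neg
  obtain ⟨S, _, _, _, _, _, hinj, _, r, hr⟩ := exists_etale_sqrt h2' hhu
  let φ : N.APlus →+* S := (algebraMap A₁ S).comp (algebraMap N.APlus A₁)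
  have hφq : q.map φ = (Q.map (Int.castRingHom S))ᵀ *
      N.qPlus.map (φ.comp ψ) * Q.map (Int.castRingHom S) := by
    have hQS : (Q.map (Int.castRingHom N.APlus)).map φ = Q.map (Int.castRingHom S) := by
      ext i j
      simp
    rw [hq, Matrix.map_mul, Matrix.map_mul, ← hQS]
    rfl
  have hφadj : (q.map φ).adjugate = q.adjugate.map φ := (RingHom.map_adjugate φ q).symm
  have hhS : IsUnit ((q.map φ).adjugate 2 2) := by
    rw [hφadj]
    exact (isUnit_of_mul_isUnit_right htu).map (algebraMap A₁ S)
  refine ⟨S, inferInstance, φ, inferInstance, inferInstance, ?_, ?_, ?_, ?_, ?_⟩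
  · have : Algebra.Etale N.APlus A₁ := Algebra.Etale.of_isLocalizationAway t
    exact RingHom.Etale.stableUnderComposition _ _ (RingHom.etale_algebraMap.mpr inferInstance)
      (RingHom.etale_algebraMap.mpr inferInstance)
  · exact hinj.comp (IsLocalization.injective A₁ hpow)
  -- The point survives the localization because `t ∉ p`, and it lifts to `S` by lying over for an
  -- injective integral extension.
  · have h1 : p ∈ Set.range (PrimeSpectrum.comap (algebraMap N.APlus A₁)) := by
      rw [PrimeSpectrum.localization_away_comap_range A₁ t]
      exact htp
    obtain ⟨p₁, rfl⟩ := h1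
    have : FaithfulSMul A₁ S := (faithfulSMul_iff_algebraMap_injective A₁ S).mpr hinj
    obtain ⟨P, rfl⟩ := Algebra.IsIntegral.comap_surjective A₁ S p₁
    exact ⟨P, rfl⟩
  -- Over the locus `u = 0` all entries of `q`, being linear in `u`, would lie in `P`, and so would
  -- the unit `q.adjugate 2 2`.
  · intro P
    rw [mem_puncturedCover_iff]
    intro hX
    refine P.isPrime.ne_top (Ideal.eq_top_of_isUnit_mem _ ?_ hhS)
    have hle : Ideal.span (Set.range (MvPolynomial.X : Fin 3 → CoordRing)) ≤
        P.asIdeal.comap (φ.comp ψ) := Ideal.span_le.mpr hX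
    have hmem (i j : Fin 3) : q.map φ i j ∈ P.asIdeal := by
      rw [hφq, Matrix.mul_apply]
      refine Ideal.sum_mem _ fun k _ ↦ Ideal.mul_mem_right _ _ ?_
      rw [Matrix.mul_apply]
      exact Ideal.sum_mem _ fun l _ ↦ Ideal.mul_mem_left _ _ (hle (N.qPlus_mem l k))
    rw [adjugate_fin_three]
    simp
    exact P.asIdeal.sub_mem (Ideal.mul_mem_left _ _ (hmem _ _)) (Ideal.mul_mem_left _ _ (hmem _ _))
  · refine exists_splitting_coordinates φ hQ ?_ hφq ?_ hhS (r := r) ?_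
    · have := h2'.map (algebraMap A₁ S)
      rwa [map_ofNat] at this
    · exact (isUnit_of_mul_isUnit_left htu).map (algebraMap A₁ S)
    · rw [hr, hφadj, map_neg]
      rfl

end QuadricNet

section

attribute [local instance] MvPolynomial.gradedAlgebra

/-! ### Sections, pullback and restriction -/

theorem app_res {X Y : Scheme.{0}} (f : X ⟶ Y) {U V : Y.Opens} (h : V ≤ U) (a : Γ(Y, U)) :
    X.presheaf.map (homOfLE (f.preimage_mono h)).op (f.app U a) =
      f.app V (Y.presheaf.map (homOfLE h).op a) :=
  (ConcreteCategory.congr_hom (f.naturality (homOfLE h).op) a).symm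

theorem app_mul_eq {X Y : Scheme.{0}} (f : X ⟶ Y) (U : Y.Opens) {a b c : Γ(Y, U)}
    (h : a = b * c) : f.app U a = f.app U b * f.app U c := by
  rw [h, map_mul]

theorem appLE_res {X Y : Scheme.{0}} (f : X ⟶ Y) {U : Y.Opens} {V V' W : X.Opens} (i : W ⟶ V)
    (i' : W ⟶ V') (h : V ≤ f ⁻¹ᵁ U) (h' : V' ≤ f ⁻¹ᵁ U) (a : Γ(Y, U)) :
    X.presheaf.map i.op (f.appLE U V h a) = X.presheaf.map i'.op (f.appLE U V' h' a) := by
  rw [← ConcreteCategory.comp_apply, ← ConcreteCategory.comp_apply, Scheme.Hom.appLE_map,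
    Scheme.Hom.appLE_map]

/-! ### Normalization of the split conic over a base -/

section NormalizationSplitConic

theorem splitCoord_base_overlap {X : Scheme.{0}} {R : Type} [CommRing R] {y : R}
    (k : conic (splitMatrix y) ⟶ X) {z : Γ(X, ⊤)}
    (hz : ∀ i, k.appLE ⊤ (splitChart y i) le_top z = splitCoord y i (algebraMap R _ y))
    (i j : Fin 2) :
    (conic (splitMatrix y)).presheaf.map (homOfLE (inf_le_left (b := splitChart y j))).op
        (splitCoord y i (algebraMap R _ y)) =
      (conic (splitMatrix y)).presheaf.map (homOfLE (inf_le_right (a := splitChart y i))).op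
        (splitCoord y j (algebraMap R _ y)) := by
  rw [← hz, ← hz]
  exact appLE_res k (homOfLE _) (homOfLE _) _ _ z

variable {X : Scheme.{0}} [IsIntegral X] {R : Type} [CommRing R] [IsDomain R]
  [IsIntegrallyClosed R] {y : R} (k : conic (splitMatrix y) ⟶ X) [Flat k] [QuasiCompact k]

/-- The normalization of the split conic in its generic fibre over `X`. -/
def splitNormalization : Scheme.{0} := (pullback.snd (genericInclusion X) k).normalization

/-- The normalization morphism. -/
def fromSplitNormalization : splitNormalization k ⟶ conic (splitMatrix y) :=
  (pullback.snd (genericInclusion X) k).fromNormalization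

instance : IsIntegralHom (fromSplitNormalization k) :=
  inferInstanceAs (IsIntegralHom (pullback.snd (genericInclusion X) k).fromNormalization)

/-- The conductor criterion applies with conductor element `y`. It is invertible on the generic
fibre because it is the pullback of the nonzero function `z` on `X`. -/
theorem exists_splitNormalization_sections (h2 : IsUnit (2 : R)) (hy : y ≠ 0) {z : Γ(X, ⊤)}
    (i : Fin 2)
    (hz : k.appLE ⊤ (splitChart y i) le_top z = splitCoord y i (algebraMap R _ y)) :
    ∃ e : Polynomial R ≃+*
        Γ(splitNormalization k, fromSplitNormalization k ⁻¹ᵁ splitChart y i),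
      ∀ a, e (chartLift y i a) =
        (fromSplitNormalization k).app (splitChart y i) (splitCoord y i a) := by
  have := isIntegral_splitConic y h2 hy
  have hne : splitCoord y i (algebraMap R _ y) ≠ 0 := by
    intro h
    have h1 := splitEval_coord y i (algebraMap R _ y)
    rw [h, map_zero, chartLift_algebraMap] at h1
    exact hy (Polynomial.C_eq_zero.mp h1.symm)
  have : IsDomain (HomogeneousLocalization.Away (conicGrading (splitMatrix y))
      (conicCoord _ i.castSucc)) := (chartEval_injective y h2 hy i).isDomain _
  have : Nonempty (splitChart y i) := by
    let x : Spec (.of (HomogeneousLocalization.Away (conicGrading (splitMatrix y))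
      (conicCoord _ i.castSucc))) := (⊥ : PrimeSpectrum _)
    refine ⟨splitι y i x, ?_⟩
    rw [← opensRange_splitι]
    exact ⟨x, rfl⟩
  have : Nonempty (⊤ : X.Opens) := ⟨⟨genericPoint X, trivial⟩⟩
  have hz0 : z ≠ 0 := by
    rintro rfl
    rw [map_zero] at hz
    exact hne hz.symm
  obtain ⟨ε, hε⟩ := exists_equiv_normalization_sections k (isAffineOpen_splitChart y i)
    (splitEval y i) (splitEval_injective y h2 hy i) (splitEval_isIntegral y i) ⊤ le_top hz0
    fun p ↦ by
      obtain ⟨b, hb⟩ := exists_splitEval_eq y i p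
      refine ⟨b, hb.trans ?_⟩
      rw [hz, splitEval_coord, chartLift_algebraMap]
  refine ⟨ε, fun a ↦ ?_⟩
  rw [← splitEval_coord]
  exact hε _

/-- For the two parameters `s` and `t`, the hypothesis is `Z/X = (Y/X)(Z/Y)` on the overlap;
cancelling `y s` leaves `s t = 1`. -/
theorem mul_eq_one_of_overlap {L : Type} [CommRing L] [IsDomain L] {y s t : L} (hy : y ≠ 0)
    (hs : s ≠ 0) (h : y * s = s ^ 2 * (y * t)) : s * t = 1 := by
  refine mul_left_cancel₀ (mul_ne_zero hy hs) ?_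
  rw [mul_one]
  nth_rewrite 2 [h]
  ring

/-- The normalization of the split conic in its generic fibre is a projective line. -/
theorem exists_isPullback_splitNormalization (h2 : IsUnit (2 : R)) (hy : y ≠ 0) {z : Γ(X, ⊤)}
    (hz : ∀ i, k.appLE ⊤ (splitChart y i) le_top z = splitCoord y i (algebraMap R _ y)) :
    ∃ h : projectiveLine (Spec (.of R)) ⟶ splitNormalization k,
      IsPullback h (projectiveLineToBase _) (fromSplitNormalization k ≫ conicToSpec _) (𝟙 _) := by
  choose e he using fun i ↦ exists_splitNormalization_sections k h2 hy i (hz i)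
  let ν := fromSplitNormalization k
  let V (i : Fin 2) : (splitNormalization k).Opens := ν ⁻¹ᵁ splitChart y i
  have hV (i : Fin 2) : IsAffineOpen (V i) := (isAffineOpen_splitChart y i).preimage ν
  have heC (i : Fin 2) (r : R) : e i (.C r) =
      ν.app (splitChart y i) (splitCoord y i (algebraMap R _ r)) := by
    rw [← he, chartLift_algebraMap]
  have heX {i j : Fin 2} (hij : i ≠ j) : e i .X ^ 2 =
      ν.app (splitChart y i) (splitCoord y i (conicCoord _ j.castSucc)) := by
    rw [← he, chartLift_coord, chartValue_of_ne y hij, map_pow]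
  have heZ (i : Fin 2) : e i (.C y) * e i .X =
      ν.app (splitChart y i) (splitCoord y i (conicCoord _ 2)) := by
    rw [← he, chartLift_coord, chartValue_two, map_mul]
  have hb {i j : Fin 2} (hij : i ≠ j) :
      (splitNormalization k).basicOpen (e i .X) = V i ⊓ V j := by
    -- The parameter itself does not come from the conic, but its square does, and it has the same
    -- nonvanishing locus.
    rw [← Scheme.basicOpen_pow _ _ two_pos, heX hij, ← Scheme.preimage_basicOpen,
      basicOpen_splitCoord]
    rfl
  have hres (i j : Fin 2) (a : Γ(conic (splitMatrix y), splitChart y i)) :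
      (splitNormalization k).presheaf.map (homOfLE (inf_le_left (b := V j))).op
        (ν.app (splitChart y i) a) = ν.app (splitChart y i ⊓ splitChart y j)
        ((conic (splitMatrix y)).presheaf.map (homOfLE inf_le_left).op a) :=
    app_res ν (V := splitChart y i ⊓ splitChart y j) inf_le_left a
  have hres' (i j : Fin 2) (a : Γ(conic (splitMatrix y), splitChart y j)) :
      (splitNormalization k).presheaf.map (homOfLE (inf_le_right (a := V i))).op
        (ν.app (splitChart y j) a) = ν.app (splitChart y i ⊓ splitChart y j)
        ((conic (splitMatrix y)).presheaf.map (homOfLE inf_le_right).op a) :=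
    app_res ν (V := splitChart y i ⊓ splitChart y j) inf_le_right a
  refine exists_isPullback_projectiveLineToBase _ V hV ?_ e ?_ (fun i j ↦ hb) fun i j hij ↦ ?_
  · exact ν.iSup_preimage_eq_top (iSup_splitChart y h2)
  · intro i
    have h1 : CommRingCat.ofHom ((e i : Polynomial R →+* _).comp Polynomial.C) =
        CommRingCat.ofHom (S := Γ(conic (splitMatrix y), splitChart y i))
          ((splitCoord y i).comp (algebraMap R _)) ≫ ν.app (splitChart y i) :=
      CommRingCat.hom_ext (RingHom.ext (heC i))
    rw [h1, Spec.map_comp, Scheme.Hom.app_eq_appLE, Scheme.Opens.toSpecΓ_SpecMap_appLE_assoc,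
      splitChart_toSpecΓ]
    exact Scheme.Hom.resLE_comp_ι_assoc ..
  -- The sections over the overlap are `R[t]` localized at `t`, a domain containing the nonzero
  -- elements `y` and `t`, so cancellation is allowed.
  · have hdom : IsDomain Γ(splitNormalization k, V i) := (e i).symm.injective.isDomain _
    let := ((splitNormalization k).presheaf.map
      (homOfLE (inf_le_left (a := V i) (b := V j))).op).hom.toAlgebra
    have hloc : IsLocalization.Away (e i .X) Γ(splitNormalization k, V i ⊓ V j) :=
      (hV i).isLocalization_of_eq_basicOpen _ (homOfLE inf_le_left) (hb hij).symm
    have hX0 : e i .X ≠ 0 := (map_ne_zero_iff _ (e i).injective).mpr Polynomial.X_ne_zero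
    have hle : Submonoid.powers (e i .X) ≤ nonZeroDivisors _ :=
      powers_le_nonZeroDivisors_of_noZeroDivisors hX0
    have hdom' : IsDomain Γ(splitNormalization k, V i ⊓ V j) :=
      IsLocalization.isDomain_of_le_nonZeroDivisors _ hle
    have hinj := IsLocalization.injective Γ(splitNormalization k, V i ⊓ V j) hle
    have hy0 : e i (.C y) ≠ 0 :=
      (map_ne_zero_iff _ (e i).injective).mpr (Polynomial.C_ne_zero.mpr hy)
    refine mul_eq_one_of_overlap ((map_ne_zero_iff _ hinj).mpr hy0)
      ((map_ne_zero_iff _ hinj).mpr hX0) ?_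
    have hyy : (splitNormalization k).presheaf.map (homOfLE (inf_le_left (b := V j))).op
        (e i (.C y)) = (splitNormalization k).presheaf.map
          (homOfLE (inf_le_right (a := V i))).op (e j (.C y)) := by
      rw [heC, heC, hres, hres', splitCoord_base_overlap k hz]
    change (splitNormalization k).presheaf.map (homOfLE (inf_le_left (b := V j))).op
        (e i (.C y)) * (splitNormalization k).presheaf.map
        (homOfLE (inf_le_left (b := V j))).op (e i .X) = ((splitNormalization k).presheaf.map
        (homOfLE (inf_le_left (b := V j))).op (e i .X)) ^ 2 * ((splitNormalization k).presheaf.map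
        (homOfLE (inf_le_left (b := V j))).op (e i (.C y)) * _)
    rw [← map_mul, heZ, ← map_pow, heX hij, hyy, ← map_mul, heZ, hres, hres, hres']
    exact app_mul_eq ν _ (splitCoord_overlap y i j 2)

end NormalizationSplitConic

end

section

attribute [local instance] MvPolynomial.gradedAlgebra

/-! ### Assembling the local descriptions -/

/-- A function from `Spec A` can be pulled back to a chart of `X'` through `X` or through `Spec R`.
The agreement identifies the conductor element `y` of the split conic with the pullback of a
function on the original family. -/
theorem appLE_eq_of_toSpecΓ {X' X : Scheme.{0}} {A R : Type} [CommRing A] [CommRing R]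
    {V : X'.Opens} (hV : IsAffineOpen V) (k : X' ⟶ X) (p : X ⟶ Spec (.of A))
    (c : X' ⟶ Spec (.of R)) (φ : A →+* R) (ψ : R →+* Γ(X', V))
    (h : V.toSpecΓ ≫ Spec.map (CommRingCat.ofHom ψ) = V.ι ≫ c)
    (hk : k ≫ p = c ≫ Spec.map (CommRingCat.ofHom φ)) (hle : V ≤ k ⁻¹ᵁ ⊤) (a : A) :
    k.appLE ⊤ V hle (p.app ⊤ ((Scheme.ΓSpecIso (.of A)).inv a)) = ψ (φ a) := by
  have : IsIso V.toSpecΓ := hV.isoSpec.isIso_hom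
  have hle' : V ≤ (k ≫ p) ⁻¹ᵁ ⊤ := hle
  have key : (Scheme.ΓSpecIso (.of A)).inv ≫ (k ≫ p).appLE ⊤ V hle' =
      CommRingCat.ofHom φ ≫ CommRingCat.ofHom ψ := by
    apply Spec.map_injective
    rw [← cancel_epi V.toSpecΓ, Spec.map_comp, Spec.map_comp,
      Scheme.Opens.toSpecΓ_SpecMap_appLE_assoc, reassoc_of% h, ← hk, Scheme.Opens.toSpecΓ_top,
      Category.assoc, toSpecΓ_SpecMap_ΓSpecIso_inv, Category.comp_id]
    exact Scheme.Hom.resLE_comp_ι ..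
  rw [Scheme.Hom.comp_appLE] at key
  exact ConcreteCategory.congr_hom key a

theorem exists_preimage_of_isPullback {X Y S Z : Scheme.{0}} {f : X ⟶ S} {g : Y ⟶ S} {a : Z ⟶ X}
    {b : Z ⟶ Y} (h : IsPullback a b f g) {x : X} {y : Y} (hxy : f x = g y) :
    ∃ z, a z = x ∧ b z = y := by
  obtain ⟨w, hw1, hw2⟩ := Scheme.Pullback.exists_preimage_pullback x y hxy
  refine ⟨h.isoPullback.inv w, ?_, ?_⟩
  · rw [← Scheme.Hom.comp_apply, h.isoPullback_inv_fst, hw1]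
  · rw [← Scheme.Hom.comp_apply, h.isoPullback_inv_snd, hw2]

/-- A chart `Spec R ⟶ S` in the étale topology over which the family `X ⟶ S` is the split conic
`Z² = y² X Y`, where `y` is the restriction of a given function `a`. -/
structure SplittingChart {X S : Scheme.{0}} {A : Type} [CommRing A] (π : X ⟶ S)
    (ι : S ⟶ Spec (.of A)) (a : A) where
  /-- The coordinate ring of the chart. -/
  R : Type
  [commRing : CommRing R]
  [isDomain : IsDomain R]
  [isIntegrallyClosed : IsIntegrallyClosed R]
  isUnit_two : IsUnit (2 : R)
  /-- The chart, on coordinate rings. -/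
  φ : A →+* R
  map_ne_zero : φ a ≠ 0
  /-- The chart. -/
  toBase : Spec (.of R) ⟶ S
  [etale : Etale toBase]
  toBase_ι : toBase ≫ ι = Spec.map (CommRingCat.ofHom φ)
  /-- The splitting of the family. -/
  ofSplit : conic (splitMatrix (φ a)) ⟶ X
  isPullback : IsPullback ofSplit (conicToSpec _) π toBase

namespace SplittingChart

attribute [instance] commRing isDomain isIntegrallyClosed etale

variable {X S : Scheme.{0}} {A : Type} [CommRing A] {π : X ⟶ S} {ι : S ⟶ Spec (.of A)} {a : A}
  (C : SplittingChart π ι a)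

instance : Etale C.ofSplit :=
  MorphismProperty.of_isPullback (P := @Etale) C.isPullback.flip C.etale

instance [QuasiSeparatedSpace S] : QuasiCompact C.ofSplit := by
  have : QuasiCompact C.toBase := inferInstance
  exact MorphismProperty.of_isPullback (P := @QuasiCompact) C.isPullback.flip this

instance : AlgebraicGeometry.IsIntegral (conic (splitMatrix (C.φ a))) :=
  isIntegral_splitConic _ C.isUnit_two C.map_ne_zero

theorem isOpen_range : IsOpen (Set.range C.ofSplit) :=
  C.ofSplit.isOpenMap.isOpen_range

theorem isOpen_range_toBase : IsOpen (Set.range C.toBase) :=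
  C.toBase.isOpenMap.isOpen_range

theorem mem_range_ofSplit {x : X} : x ∈ Set.range C.ofSplit ↔ π x ∈ Set.range C.toBase := by
  constructor
  · rintro ⟨z, rfl⟩
    refine ⟨conicToSpec _ z, ?_⟩
    rw [← Scheme.Hom.comp_apply, ← Scheme.Hom.comp_apply, C.isPullback.w]
  · rintro ⟨u, hu⟩
    obtain ⟨z, hz, -⟩ := exists_preimage_of_isPullback C.isPullback hu.symm
    exact ⟨z, hz⟩

/-- A family of conics which is split étale locally on an integral base is integral. -/
theorem isIntegral [AlgebraicGeometry.IsIntegral S]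
    (h : ∀ s, ∃ C : SplittingChart π ι a, s ∈ Set.range C.toBase) :
    AlgebraicGeometry.IsIntegral X := by
  choose C hC using h
  refine isIntegral_of_flat_cover (fun s ↦ (C s).ofSplit) (fun s ↦ (C s).isOpen_range)
    (fun x ↦ ⟨π x, (C _).mem_range_ofSplit.mpr (hC _)⟩) fun s t ↦ ?_
  -- Two nonempty open images in the irreducible base share a point, and surjectivity of the split
  -- conic lifts it to a common point of the images upstairs.
  obtain ⟨u, hu⟩ := (PreirreducibleSpace.isPreirreducible_univ _ _
    (C s).isOpen_range_toBase (C t).isOpen_range_toBase ⟨s, trivial, hC s⟩ ⟨t, trivial, hC t⟩)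
  obtain ⟨v, hv⟩ := hu.2.1
  obtain ⟨w, rfl⟩ := conicToSpec_splitMatrix_surjective ((C s).φ a) v
  have hw : π ((C s).ofSplit w) = u := by
    rw [← hv, ← Scheme.Hom.comp_apply, ← Scheme.Hom.comp_apply, (C s).isPullback.w]
  refine ⟨(C s).ofSplit w, ⟨w, rfl⟩, (C t).mem_range_ofSplit.mpr ?_⟩
  rw [hw]
  exact hu.2.2

/-- Relative normalization commutes with smooth base change; what appears over `X'` is its
normalization in the fibre over the generic point of `X`. -/
theorem isPullback_normalization {X X' : Scheme.{0}} [AlgebraicGeometry.IsIntegral X] (k : X' ⟶ X)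
    [QuasiCompact k] [Smooth k] :
    IsPullback (Scheme.Hom.normalizationPullback (genericInclusion X) k ≫ pullback.fst _ _)
      (pullback.snd (genericInclusion X) k).fromNormalization (normalizationMap X) k :=
  (IsPullback.of_hasPullback (genericInclusion X).fromNormalization k).of_iso
    (asIso (Scheme.Hom.normalizationPullback (genericInclusion X) k)).symm
    (Iso.refl _) (Iso.refl _) (Iso.refl _) (by simp) (by simp)
      (by simp [normalizationMap]) (by simp)

theorem exists_isPullback [AlgebraicGeometry.IsIntegral X] [QuasiSeparatedSpace S] :
    ∃ h, IsPullback h (projectiveLineToBase _) (normalizationMap X ≫ π) C.toBase := by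
  let p := π ≫ ι
  let z : Γ(X, ⊤) := p.app ⊤ ((Scheme.ΓSpecIso (.of A)).inv a)
  have hp : C.ofSplit ≫ p = conicToSpec _ ≫ Spec.map (CommRingCat.ofHom C.φ) := by
    rw [← C.toBase_ι, C.isPullback.w_assoc]
  obtain ⟨h, hh⟩ := exists_isPullback_splitNormalization C.ofSplit C.isUnit_two C.map_ne_zero
    (z := z) fun i ↦ appLE_eq_of_toSpecΓ (isAffineOpen_splitChart _ i) C.ofSplit p _ C.φ
      ((splitCoord _ i).comp (algebraMap C.R _)) (splitChart_toSpecΓ _ i) hp le_top _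
  have h2 := hh.paste_horiz ((isPullback_normalization C.ofSplit).paste_vert C.isPullback)
  rw [Category.id_comp] at h2
  exact ⟨_, h2⟩

theorem isProjectiveLineBundle [AlgebraicGeometry.IsIntegral X] [QuasiSeparatedSpace S]
    (h : ∀ s, ∃ C : SplittingChart π ι a, s ∈ Set.range C.toBase) :
    IsProjectiveLineBundle (normalizationMap X ≫ π) := by
  intro s
  obtain ⟨C, hC⟩ := h s
  obtain ⟨h, hh⟩ := C.exists_isPullback
  exact ⟨_, C.toBase, h, inferInstance, hC, hh⟩

end SplittingChart

/-! ### The family `adj(C₊)`: integrality and the bundle property -/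

namespace QuadricNet

variable {N : QuadricNet}

/-- The projection from `adj(C₊)` to the family of conics over `W`. -/
def adjCPlusToConic (N : QuadricNet) : N.adjCPlus ⟶ conic N.qPlus.adjugate :=
  pullback.fst N.adjCToBase N.puncturedDoubleCover ≫ (N.adjConicToW ⁻¹ᵁ puncturedW).ι

/-- Pasting with the restriction square over `W ∖ 0` exhibits `adj(C₊)` as a base change of the
conic over all of `W`, so that base change of conics over affine rings applies. -/
theorem isPullback_adjCPlus (N : QuadricNet) : IsPullback N.adjCPlusToConic N.adjCPlusToBase
    N.adjConicToW (N.puncturedCover.ι ≫ N.doubleCover) := by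
  have h1 : IsPullback (pullback.fst N.adjCToBase N.puncturedDoubleCover) N.adjCPlusToBase
      N.adjCToBase N.puncturedDoubleCover := IsPullback.of_hasPullback _ _
  have h2 : IsPullback (N.adjConicToW ⁻¹ᵁ puncturedW).ι N.adjCToBase N.adjConicToW
      puncturedW.ι := (isPullback_morphismRestrict N.adjConicToW puncturedW).flip
  have h3 := h1.paste_horiz h2
  have h4 : N.puncturedDoubleCover ≫ puncturedW.ι = N.puncturedCover.ι ≫ N.doubleCover :=
    morphismRestrict_ι N.doubleCover puncturedW
  rw [h4] at h3
  exact h3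

theorem SmoothCurvePlus.root_ne_zero (hN : N.SmoothCurvePlus) :
    (AdjoinRoot.root _ : N.APlus) ≠ 0 := by
  intro h
  have h1 := quadExt_root_sq N.fPlus
  rw [h, zero_pow two_ne_zero] at h1
  have h2 : Function.Injective (algebraMap CoordRing N.APlus) :=
    AdjoinRoot.of.injective_of_degree_ne_zero (by
      rw [Polynomial.degree_X_pow_sub_C two_pos]; decide)
  have h3 : N.fPlus = 0 := h2 (h1.symm.trans (map_zero _).symm)
  exact hN.not_isSquare (h3 ▸ IsSquare.zero)

theorem SmoothCurvePlus.exists_splittingChart (hN : N.SmoothCurvePlus)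
    (s : (N.puncturedCover : Scheme.{0})) : 
    ∃ C : SplittingChart N.adjCPlusToBase N.puncturedCover.ι (AdjoinRoot.root _),
      s ∈ Set.range C.toBase := by
  obtain ⟨R, _, φ, _, _, hφ, hinj, ⟨P, hP⟩, hcov, T, T', c, hc, hT, hT', h⟩ :=
    hN.exists_splitting_cover s.2
  have h2 : IsUnit (2 : R) := by
    have := (isUnit_two_coordRing.map (algebraMap CoordRing N.APlus)).map φ
    rwa [map_ofNat, map_ofNat] at this
  have hrange : Set.range (Spec.map (CommRingCat.ofHom φ)) ⊆ Set.range N.puncturedCover.ι := by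
    rintro _ ⟨Q, rfl⟩
    rw [Scheme.Opens.range_ι]
    exact hcov Q
  let g := IsOpenImmersion.lift N.puncturedCover.ι (Spec.map (CommRingCat.ofHom φ)) hrange
  have hg : g ≫ N.puncturedCover.ι = Spec.map (CommRingCat.ofHom φ) :=
    IsOpenImmersion.lift_fac _ _ hrange
  have hφ' : Etale (Spec.map (CommRingCat.ofHom φ)) :=
    (HasRingHomProperty.Spec_iff (P := @Etale)).mpr hφ
  have : Etale (g ≫ N.puncturedCover.ι) := hg ▸ hφ'
  -- Étaleness cancels on the right: `g` followed by an open immersion is étale, so `g` is étale.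
  have hget : Etale g := MorphismProperty.of_postcomp (W := @Etale) (W' := @Etale)
    g N.puncturedCover.ι
    inferInstance this
  obtain ⟨k, hk⟩ := exists_isPullback_conic (φ.comp (algebraMap CoordRing N.APlus)) T T' hc hT hT' h
  have hbase : g ≫ N.puncturedCover.ι ≫ N.doubleCover =
      Spec.map (CommRingCat.ofHom (φ.comp (algebraMap CoordRing N.APlus))) := by
    rw [reassoc_of% hg, CommRingCat.ofHom_comp, Spec.map_comp]
    rfl
  have hk' : IsPullback k (conicToSpec _) N.adjConicToW
      (g ≫ N.puncturedCover.ι ≫ N.doubleCover) := hbase ▸ hk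
  have hpb := N.isPullback_adjCPlus
  refine ⟨⟨R, h2, φ, fun h0 ↦ hN.root_ne_zero (hinj (h0.trans (map_zero φ).symm)), g, hg,
    hpb.lift k (conicToSpec _ ≫ g) (by rw [hk'.w, Category.assoc]),
    IsPullback.of_right (by rwa [hpb.lift_fst]) (hpb.lift_snd ..) hpb⟩, P, ?_⟩
  refine N.puncturedCover.ι.isOpenEmbedding.injective ?_
  exact (congrArg (fun f : Spec (.of R) ⟶ Spec (.of N.APlus) ↦ f P) hg).trans hP

theorem SmoothCurvePlus.isIntegral_puncturedCover (hN : N.SmoothCurvePlus) :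
    IsIntegral (N.puncturedCover : Scheme.{0}) := by
  have := hN.isDomain
  have : Nonempty N.puncturedCover := by
    refine ⟨⟨(⊥ : PrimeSpectrum N.APlus), mem_puncturedCover_iff.mpr fun h ↦ ?_⟩⟩
    have h1 : algebraMap CoordRing N.APlus (MvPolynomial.X 0) = 0 := h ⟨0, rfl⟩
    have h2 : Function.Injective (algebraMap CoordRing N.APlus) :=
      AdjoinRoot.of.injective_of_degree_ne_zero (by
        rw [Polynomial.degree_X_pow_sub_C two_pos]; decide)
    exact MvPolynomial.X_ne_zero (R := ℂ) (0 : Fin 3) (h2 (h1.trans (map_zero _).symm))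
  infer_instance

theorem SmoothCurvePlus.isIntegral_adjCPlus (hN : N.SmoothCurvePlus) :
    AlgebraicGeometry.IsIntegral N.adjCPlus := by
  have := hN.isIntegral_puncturedCover
  exact SplittingChart.isIntegral hN.exists_splittingChart

theorem SmoothCurvePlus.isProjectiveLineBundle (hN : N.SmoothCurvePlus)
    [AlgebraicGeometry.IsIntegral N.adjCPlus] : IsProjectiveLineBundle N.PPlusToBase :=
  SplittingChart.isProjectiveLineBundle hN.exists_splittingChart

end QuadricNet

end

/-! ### Smoothness of the generic plane cubic -/

section GenericSmoothness

open MvPolynomial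

/-- The exponents of the quartic monomials in three variables. -/
abbrev QuarticExponent : Type := (Finset.univ : Finset (Fin 3)).finsuppAntidiag 4

theorem quarticExponent_degree (m : QuarticExponent) : m.1.degree = 4 := by
  rw [Finsupp.degree_eq_sum]
  exact (Finset.mem_finsuppAntidiag.mp m.2).1

theorem exists_two_le_quarticExponent (m : QuarticExponent) : ∃ i, 2 ≤ m.1 i := by
  by_contra! h
  have h4 := quarticExponent_degree m
  rw [Finsupp.degree_eq_sum, Fin.sum_univ_three] at h4
  have := h 0
  have := h 1
  have := h 2
  lia

/-- A variable whose square divides a given quartic monomial. -/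
def quarticIndex (m : QuarticExponent) : Fin 3 := (exists_two_le_quarticExponent m).choose

theorem two_le_quarticIndex (m : QuarticExponent) : 2 ≤ m.1 (quarticIndex m) :=
  (exists_two_le_quarticExponent m).choose_spec

/-- The matrix expressing products of quadratic monomials and partial derivatives of a cubic form
in terms of quartic monomials. -/
def jacobianMatrix {R : Type} [CommRing R] (f : MvPolynomial (Fin 3) R) :
    Matrix QuarticExponent QuarticExponent R :=
  fun m n ↦ coeff n.1 (monomial (m.1 - Finsupp.single (quarticIndex m) 2) 1 *
    pderiv (quarticIndex m) f)

/-- Compatibility with specialization is what makes the determinant for the generic cubic a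
polynomial condition on nets. -/
theorem jacobianMatrix_map {R R' : Type} [CommRing R] [CommRing R'] (φ : R →+* R')
    (f : MvPolynomial (Fin 3) R) : jacobianMatrix (map φ f) = (jacobianMatrix f).map φ := by
  ext m n
  rw [Matrix.map_apply, jacobianMatrix, jacobianMatrix, ← coeff_map, map_mul, map_monomial,
    map_one φ, pderiv_map]

theorem eval_eq_sum_quarticExponent {g : CoordRing} (hg : g.IsHomogeneous 4) (u : Fin 3 → ℂ) :
    eval u g = ∑ n : QuarticExponent, coeff n.1 g * ∏ i, u i ^ n.1 i := by
  rw [eval_eq', Finset.sum_coe_sort (Finset.finsuppAntidiag Finset.univ 4)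
    fun n ↦ coeff n g * ∏ i, u i ^ n i]
  refine Finset.sum_subset (fun d hd ↦ ?_) fun d _ hd ↦ ?_
  · refine Finset.mem_finsuppAntidiag.mpr ⟨?_, Finset.subset_univ _⟩
    have h : d.degree = 4 := by
      by_contra h
      exact mem_support_iff.mp hd (hg.coeff_eq_zero h)
    rwa [Finsupp.degree_eq_sum] at h
  · rw [notMem_support_iff.mp hd, zero_mul]

/-- If all partial derivatives vanish at `u`, the vector of quartic monomials at `u` is in the
kernel of an invertible matrix. In particular every `u i ^ 4` vanishes. -/
theorem isSmoothForm_of_jacobianMatrix {f : CoordRing} (hf : f.IsHomogeneous 3)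
    (h : (jacobianMatrix f).det ≠ 0) : IsSmoothForm f := by
  intro u hu _
  by_contra! hd
  refine hu (funext fun i ↦ ?_)
  have h0 : (jacobianMatrix f).mulVec (fun n ↦ ∏ i, u i ^ n.1 i) = 0 := by
    funext m
    have hg : (monomial (m.1 - Finsupp.single (quarticIndex m) 2) (1 : ℂ) *
        pderiv (quarticIndex m) f).IsHomogeneous 4 := by
      refine (isHomogeneous_monomial (n := 2) _ ?_).mul hf.pderiv
      have h1 := quarticExponent_degree m
      rw [← tsub_add_cancel_of_le (Finsupp.single_le_iff.mpr (two_le_quarticIndex m)),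
        map_add, Finsupp.degree_single] at h1
      lia
    rw [Matrix.mulVec, Pi.zero_apply]
    exact (eval_eq_sum_quarticExponent hg u).symm.trans (by rw [map_mul, hd, mul_zero])
  have h1 := congrFun (Matrix.eq_zero_of_mulVec_eq_zero h h0)
    ⟨Finsupp.single i 4, Finset.mem_finsuppAntidiag.mpr ⟨by simp, by simp⟩⟩
  simpa [Finsupp.single_apply, Finset.prod_ite_eq] using h1

/-- Here the partial derivative replaces the square of a variable by `c` times that square, so every
quartic monomial goes to `c` times itself. -/
theorem jacobianMatrix_fermat {c : ℂ} {f : CoordRing}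
    (hf : ∀ i, pderiv i f = C c * X i ^ 2) : jacobianMatrix f = Matrix.diagonal fun _ ↦ c := by
  ext m n
  have h1 : monomial (m.1 - Finsupp.single (quarticIndex m) 2) 1 * pderiv (quarticIndex m) f =
      monomial m.1 c := by
    rw [hf, X_pow_eq_monomial, C_mul_monomial, monomial_mul, one_mul, mul_one,
      tsub_add_cancel_of_le (Finsupp.single_le_iff.mpr (two_le_quarticIndex m))]
  rw [jacobianMatrix, h1, coeff_monomial, Matrix.diagonal_apply]
  exact if_congr Subtype.ext_iff.symm rfl rfl

end GenericSmoothness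

/-! ### A nonempty open set of nets with smooth discriminant -/

namespace QuadricNet

open MvPolynomial

/-- The ring of polynomial functions on triples of quadratic forms. -/
abbrev NetRing : Type := MvPolynomial (Fin 3 × (Fin 3 ⊕ Fin 3) × (Fin 3 ⊕ Fin 3)) ℂ

/-- The determinant of the restriction of the generic net to the invariant part. -/
def genericCubic : MvPolynomial (Fin 3) NetRing :=
  Matrix.det (Matrix.of fun i j ↦ ∑ k : Fin 3, X k * C (X (k, Sum.inl i, Sum.inl j)))

theorem map_genericCubic (N : QuadricNet) :
    map (eval fun p ↦ N.q p.1 p.2.1 p.2.2) genericCubic = N.fPlus := by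
  rw [genericCubic, RingHom.map_det, fPlus]
  congr 1
  ext1 i j
  rw [qPlus_apply]
  simp
  rfl

theorem qPlus_isHomogeneous (N : QuadricNet) (i j : Fin 3) : (N.qPlus i j).IsHomogeneous 1 := by
  rw [qPlus_apply]
  exact IsHomogeneous.sum _ _ _ fun k _ ↦ (isHomogeneous_X ℂ k).mul (isHomogeneous_C _ _)

theorem fPlus_isHomogeneous (N : QuadricNet) : N.fPlus.IsHomogeneous 3 := by
  have h (a b c d e f) : (N.qPlus a b * N.qPlus c d * N.qPlus e f).IsHomogeneous 3 :=
    ((N.qPlus_isHomogeneous _ _).mul (N.qPlus_isHomogeneous _ _)).mul (N.qPlus_isHomogeneous _ _)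
  rw [fPlus, Matrix.det_fin_three]
  exact (((((h ..).sub (h ..)).sub (h ..)).add (h ..)).add (h ..)).sub (h ..)

/-- The blocks of a net whose discriminant is a multiple of the Fermat cubic. -/
def fermatBlock (m : ℂ) : Fin 3 → Matrix (Fin 3) (Fin 3) ℂ :=
  ![!![1, 0, 0; 0, 0, m; 0, m, 0], !![0, 0, m; 0, 1, 0; m, 0, 0], !![0, m, 0; m, 0, 0; 0, 0, 1]]

theorem fermatBlock_isSymm (m : ℂ) (i : Fin 3) : (fermatBlock m i).IsSymm := by
  refine Matrix.IsSymm.ext fun a b ↦ ?_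
  fin_cases i <;> fin_cases a <;> fin_cases b <;> rfl

/-- A net whose discriminant is a multiple of the Fermat cubic. -/
def fermatNet (m : ℂ) : QuadricNet where
  q i := Matrix.fromBlocks (fermatBlock m i) 0 0 0
  isSymm i := (fermatBlock_isSymm m i).fromBlocks (by simp) (by simp [Matrix.IsSymm])
  invariant i := by simp [sigma, Matrix.fromBlocks_transpose, Matrix.fromBlocks_multiply]
  linearIndependent := by
    refine Fintype.linearIndependent_iff.mpr fun g hg i ↦ ?_
    have h := congrFun (congrFun hg (Sum.inl i)) (Sum.inl i)
    fin_cases i <;> simpa [Fin.sum_univ_three, fermatBlock] using h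

/-- The determinant is `(1 + 2 m³) X₀ X₁ X₂ - m² (X₀³ + X₁³ + X₂³)`, and `m` is chosen to remove the
mixed term. -/
theorem fPlus_fermatNet {m : ℂ} (hm : m ^ 3 = -1 / 2) :
    (fermatNet m).fPlus = C (-m ^ 2) * (X 0 ^ 3 + X 1 ^ 3 + X 2 ^ 3) := by
  have hC : (C m : CoordRing) ^ 3 * 2 = -1 := by
    rw [← map_pow, hm, ← map_ofNat C 2, ← map_mul]
    norm_num
  rw [fPlus, Matrix.det_fin_three]
  simp only [qPlus_apply, fermatNet, Matrix.toBlocks_fromBlocks₁₁, Fin.sum_univ_three, fermatBlock]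
  simp
  linear_combination (X 0 * X 1 * X 2) * hC

theorem holdsForGeneralNet_smoothCurvePlus : HoldsForGeneralNet SmoothCurvePlus := by
  refine ⟨(jacobianMatrix genericCubic).det, ?_, fun N hN ↦ ?_⟩
  -- At the Fermat net the determinant is a power of `-3 m²`, the common factor in the partial
  -- derivatives of `-m² ∑ X i ^ 3`.
  · obtain ⟨m, hm⟩ := IsAlgClosed.exists_pow_nat_eq (-1 / 2 : ℂ) (n := 3) (by norm_num)
    have hm0 : m ≠ 0 := by
      rintro rfl
      norm_num at hm
    refine ⟨fermatNet m, ?_⟩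
    rw [RingHom.map_det, RingHom.mapMatrix_apply, ← jacobianMatrix_map, map_genericCubic,
      fPlus_fermatNet hm, jacobianMatrix_fermat (c := -3 * m ^ 2), Matrix.det_diagonal]
    · exact Finset.prod_ne_zero_iff.mpr fun _ _ ↦
        mul_ne_zero (by norm_num) (pow_ne_zero 2 hm0)
    · intro i
      have h3 : (3 : CoordRing) = C 3 := (map_ofNat C 3).symm
      fin_cases i <;> simp [Derivation.leibniz, pderiv_X, h3] <;> ring
  · rw [RingHom.map_det, RingHom.mapMatrix_apply, ← jacobianMatrix_map, map_genericCubic] at hN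
    exact isSmoothForm_of_jacobianMatrix N.fPlus_isHomogeneous hN

end QuadricNet

end EnriquesNet

end

theorem proposition4p1 :
    EnriquesNet.HoldsForGeneralNet EnriquesNet.QuadricNet.SmoothCurvePlus ∧
    ∀ N : EnriquesNet.QuadricNet, N.SmoothCurvePlus →
      ∃ _ : AlgebraicGeometry.IsIntegral N.adjCPlus,
        EnriquesNet.IsProjectiveLineBundle N.PPlusToBase := by
  exact ⟨EnriquesNet.QuadricNet.holdsForGeneralNet_smoothCurvePlus, fun _ hN ↦
    have := hN.isIntegral_adjCPlus
    ⟨this, hN.isProjectiveLineBundle⟩⟩
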